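/- Let $\mathcal O$ be a complete discrete valuation ring with algebraically closed residue field $k$ of characteristic $2$ and with quotient field $K$ of characteristic $0$. Let $\tilde A_4 = Q_8\rtimes C_3$, where $Q_8$ is the quaternion group of order $8$ and a generator of $C_3$ acts on $Q_8$ as an automorphism of order $3$. For an $\mathcal O$-algebra $B$ with $K\otimes_{\mathcal O} B$ split semisimple let $\mathrm{Irr}_K(B)$ be the set of characters of the simple $K\otimes_{\mathcal O} B$-modules; let $\mathbb Z\mathrm{Irr}_K(B)$ be the group of generalised characters, free abelian on $\mathrm{Irr}_K(B)$, with the scalar product for which $\mathrm{Irr}_K(B)$ is orthonormal; let $\mathrm{Proj}(B)$ be its subgroup generated by the characters of the projective indecomposable $B$-modules; and for $\chi\in\mathrm{Irr}_K(B)$ let $e(\chi)$ be the primitive idempotent of $Z(K\otimes_{\mathcal O}B)$ corresponding to $\chi$; put $e(-\chi)=e(\chi)$. **Theorem C.** Let $A$ be a basic $\mathcal O$-free $\mathcal O$-algebra such that $K\otimes_{\mathcal O}A$ is split semisimple and $k\otimes_{\mathcal O}A\cong k\tilde A_4$ as $k$-algebras. Assume that there is an isometry $\Phi:\mathbb Z\mathrm{Irr}_K(A)\cong\mathbb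 Z\mathrm{Irr}_K(\mathcal O\tilde A_4)$ which maps $\mathrm{Proj}(A)$ onto $\mathrm{Proj}(\mathcal O\tilde A_4)$ and such that the map sending $e(\chi)$ to $e(\Phi(\chi))$ for every $\chi\in\mathrm{Irr}_K(A)$ induces an $\mathcal O$-algebra isomorphism of the centers $Z(A)\cong Z(\mathcal O\tilde A_4)$. Then $A$ is isomorphic to the unital associative $\mathcal O$-algebra with generators $e_0,e_1,e_2,\beta,\gamma,\delta,\eta,\lambda,\kappa$ subject to the following relations: $e_0,e_1,e_2$ are pairwise orthogonal idempotents with $e_0+e_1+e_2=1$, and $$\beta=e_0\beta=\beta e_1,\quad \gamma=e_1\gamma=\gamma e_0,\quad \delta=e_1\delta=\delta e_2,\quad \eta=e_2\eta=\eta e_1,\quad \lambda=e_2\lambda=\lambda e_0,\quad \kappa=e_0\kappa=\kappa e_2;$$ $$\beta\delta=-2\kappa+\kappa\lambda\kappa,\quad \eta\gamma=-2\lambda+\lambda\kappa\lambda,\quad \delta\lambda=-2\gamma+\gamma\beta\gamma,$$ $$\kappa\eta=-2\beta+\beta\gamma\beta,\quad \lambda\beta=-2\eta+\eta\delta\eta,\quad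 \gamma\kappa=-2\delta+\delta\eta\delta;$$ $$\gamma\beta\delta=-4\delta+2\delta\eta\delta,\quad \delta\eta\gamma=-4\gamma+2\gamma\beta\gamma,\quad \lambda\kappa\eta=-4\eta+2\eta\delta\eta,$$ $$\beta\gamma\kappa=-4\kappa+2\kappa\lambda\kappa,\quad \eta\delta\lambda=-4\lambda+2\lambda\kappa\lambda,\quad \kappa\lambda\beta=-4\beta+2\beta\gamma\beta,$$ $$\eta\gamma\beta=-4\eta+2\eta\delta\eta,\quad \beta\delta\eta=-4\beta+2\beta\gamma\beta,\quad \delta\lambda\kappa=-4\delta+2\delta\eta\delta,$$ $$\lambda\beta\gamma=-4\lambda+2\lambda\kappa\lambda,\quad \kappa\eta\delta=-4\kappa+2\kappa\lambda\kappa,\quad \gamma\kappa\lambda=-4\gamma+2\gamma\beta\gamma;$$ $$\beta\delta\lambda\beta=-8\beta+4\beta\gamma\beta,\quad \delta\lambda\beta\delta=-8\delta+4\delta\eta\delta,\quad \lambda\beta\delta\lambda=-8\lambda+4\lambda\kappa\lambda.$$ Consequently $A\cong\mathcal O\tilde A_4$ as $\mathcal O$-algebras. -/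

import Mathlib

open scoped TensorProduct

/-! ### The group `Ã₄ = Q₈ ⋊ C₃` -/

namespace Atilde4

open QuaternionGroup

/-- With `i = a 1`, `j = xa 0`, `k = i * j = xa 3` in `Q₈ = QuaternionGroup 2`, this is the
permutation `i ↦ j ↦ k ↦ i`, `-i ↦ -j ↦ -k ↦ -i`, fixing `1 = a 0` and `-1 = a 2`. -/
def rotFun : QuaternionGroup 2 → QuaternionGroup 2
  | a n => if n = 0 then a 0 else if n = 1 then xa 0 else if n = 2 then a 2 else xa 2
  | xa n => if n = 0 then xa 3 else if n = 1 then a 3 else if n = 2 then xa 1 else a 1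

theorem rotFun_cube (x : QuaternionGroup 2) : rotFun (rotFun (rotFun x)) = x := by
  revert x; decide

theorem rotFun_mul (x y : QuaternionGroup 2) : rotFun (x * y) = rotFun x * rotFun y := by
  revert x y; decide

/-- The automorphism of order three of `Q₈` with `i ↦ j ↦ k ↦ i`. -/
def rot : MulAut (QuaternionGroup 2) where
  toFun := rotFun
  invFun x := rotFun (rotFun x)
  left_inv := rotFun_cube
  right_inv := rotFun_cube
  map_mul' := rotFun_mul

theorem rot_cube : rot ^ 3 = 1 := by
  ext x
  exact rotFun_cube x

/-- The action of `C₃` on `Q₈` whose generator acts as `rot`. -/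
def action : Multiplicative (ZMod 3) →* MulAut (QuaternionGroup 2) where
  toFun c := rot ^ c.toAdd.val
  map_one' := by simp
  map_mul' c d := by
    rw [toAdd_mul, ZMod.val_add, ← pow_add, ← pow_eq_pow_mod _ rot_cube]

end Atilde4

/-- The group `Ã₄ = Q₈ ⋊ C₃` of order 24. -/
abbrev Atilde4 : Type := QuaternionGroup 2 ⋊[Atilde4.action] Multiplicative (ZMod 3)

/-! ### Idempotents and basic algebras -/

/-- A primitive idempotent: a nonzero idempotent that is not the sum of two nonzero orthogonal
idempotents. -/
def IsPrimitiveIdempotent {R : Type*} [Ring R] (e : R) : Prop :=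
  IsIdempotentElem e ∧ e ≠ 0 ∧
    ∀ f g : R, IsIdempotentElem f → IsIdempotentElem g → f * g = 0 → g * f = 0 → f + g = e →
      f = 0 ∨ g = 0

/-- A basic ring: the projective indecomposable modules `R e` and `R f` given by two different
idempotents of a primitive decomposition of `1`, that is, by two orthogonal primitive
idempotents, are never isomorphic. -/
def IsBasicRing (R : Type*) [Ring R] : Prop :=
  ∀ e f : R, IsPrimitiveIdempotent e → IsPrimitiveIdempotent f → e * f = 0 → f * e = 0 →
    ¬ Nonempty (Submodule.span R {e} ≃ₗ[R] Submodule.span R {f})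

/-! ### Characters -/

/-- A `K`-algebra is split semisimple if it is a finite product of full matrix algebras
over `K`. -/
def IsSplitSemisimple (K B : Type*) [Field K] [Ring B] [Algebra K B] : Prop :=
  ∃ (n : ℕ) (d : Fin n → ℕ), (∀ i, d i ≠ 0) ∧
    Nonempty (B ≃ₐ[K] ((i : Fin n) → Matrix (Fin (d i)) (Fin (d i)) K))

/-- The character `b ↦ trace_K (v ↦ b • v)` of a module `V` over the `K`-algebra `B`. -/
noncomputable def moduleCharacter (K B V : Type*) [Field K] [Ring B] [Algebra K B]
    [AddCommGroup V] [Module K V] [Module B V] [IsScalarTower K B V] : B →ₗ[K] K :=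
  LinearMap.trace K V ∘ₗ (Algebra.lsmul K K V : B →ₐ[K] Module.End K V).toLinearMap

/-- The set of characters of the simple `B`-modules. Every simple module is isomorphic to some
`B ⧸ m` with `m` a (maximal) left ideal. -/
def irrCharacters (K B : Type*) [Field K] [Ring B] [Algebra K B] : Set (B →ₗ[K] K) :=
  {χ | ∃ m : Submodule B B, IsSimpleModule B (B ⧸ m) ∧ χ = moduleCharacter K B (B ⧸ m)}

/-- The group of generalised characters, free abelian on the irreducible characters. -/
abbrev CharGroup (K B : Type*) [Field K] [Ring B] [Algebra K B] : Type _ :=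
  irrCharacters K B →₀ ℤ

namespace CharGroup

variable {K B : Type*} [Field K] [Ring B] [Algebra K B]

/-- The linear form on `B` given by a generalised character. -/
noncomputable def toLinearForm (f : CharGroup K B) : B →ₗ[K] K :=
  f.sum fun χ n => n • (χ : B →ₗ[K] K)

/-- The usual scalar product, for which the irreducible characters are orthonormal. -/
noncomputable def scalarProduct (f g : CharGroup K B) : ℤ :=
  f.sum fun χ n => n * g χ

/-- For `f = ±χ` with `χ` irreducible, this says that `e` is `e(χ)`: the primitive idempotent of
the center of `B` on which `χ` does not vanish. -/
def IsCentralIdempotentOf (f : CharGroup K B) (e : Subalgebra.center K B) : Prop :=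
  IsPrimitiveIdempotent e ∧ toLinearForm f (e : B) ≠ 0

end CharGroup

section Order

variable (O K : Type*) [CommRing O] [Field K] [Algebra O K]

/-- The subgroup of the group of generalised characters of `K ⊗ A` generated by the characters of
the projective indecomposable `A`-modules `A e`, where `e` runs over the primitive idempotents
of `A`; the module `K ⊗ A e` is the left ideal of `K ⊗ A` generated by `1 ⊗ e`. -/
noncomputable def projCharacters (A : Type*) [Ring A] [Algebra O A] : AddSubgroup (CharGroup K (K ⊗[O] A)) :=
  AddSubgroup.closure {f | ∃ e : A, IsPrimitiveIdempotent e ∧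
    f.toLinearForm = moduleCharacter K (K ⊗[O] A)
      (Submodule.span (K ⊗[O] A) {(1 : K) ⊗ₜ[O] e})}

theorem one_tmul_mem_center {A : Type*} [Ring A] [Algebra O A] (z : Subalgebra.center O A) :
    (1 : K) ⊗ₜ[O] (z : A) ∈ Subalgebra.center K (K ⊗[O] A) := by
  rw [Subalgebra.mem_center_iff]
  intro b
  induction b with
  | zero => simp
  | add x y hx hy => rw [add_mul, mul_add, hx, hy]
  | tmul c x =>
    rw [Algebra.TensorProduct.tmul_mul_tmul, Algebra.TensorProduct.tmul_mul_tmul, one_mul, mul_one,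
      Subalgebra.mem_center_iff.1 z.2 x]

/-- The canonical map `Z(A) → Z(K ⊗ A)`, `z ↦ 1 ⊗ z`. -/
def centerMap (A : Type*) [Ring A] [Algebra O A] (z : Subalgebra.center O A) :
    Subalgebra.center K (K ⊗[O] A) :=
  ⟨(1 : K) ⊗ₜ[O] (z : A), one_tmul_mem_center O K z⟩

/-- The `K`-linear map `Z(K ⊗ A) → Z(K ⊗ A')` sending `e(χ)` to `e(Φ(χ))` for every irreducible
character `χ` restricts to an isomorphism of `O`-algebras `Z(A) ≃ Z(A')`. -/
def InducesCenterIso {A A' : Type*} [Ring A] [Algebra O A] [Ring A'] [Algebra O A']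
    (Φ : CharGroup K (K ⊗[O] A) ≃+ CharGroup K (K ⊗[O] A')) : Prop :=
  ∃ (ψ : Subalgebra.center K (K ⊗[O] A) →ₗ[K] Subalgebra.center K (K ⊗[O] A'))
    (σ : Subalgebra.center O A ≃ₐ[O] Subalgebra.center O A'),
    (∀ (χ : irrCharacters K (K ⊗[O] A)) (e : Subalgebra.center K (K ⊗[O] A))
      (e' : Subalgebra.center K (K ⊗[O] A')),
      CharGroup.IsCentralIdempotentOf (Finsupp.single χ 1) e →
      CharGroup.IsCentralIdempotentOf (Φ (Finsupp.single χ 1)) e' → ψ e = e') ∧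
    ∀ z : Subalgebra.center O A, ψ (centerMap O K A z) = centerMap O K A' (σ z)

end Order

/-! ### The algebra given by generators and relations -/

/-- The nine generators `e₀, e₁, e₂, β, γ, δ, η, λ, κ`. -/
inductive Gen : Type
  | e0 | e1 | e2 | β | γ | δ | η | lam | κ

section Presentation

open Gen

/-- The generators in the free algebra. -/
def gen (O : Type*) [CommRing O] (g : Gen) : FreeAlgebra O Gen := FreeAlgebra.ι O g

/-- The defining relations. -/
inductive PresRel (O : Type*) [CommRing O] : FreeAlgebra O Gen → FreeAlgebra O Gen → Prop
  -- orthogonal idempotents with sum `1`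
  | idem0 : PresRel O (gen O e0 * gen O e0) (gen O e0)
  | idem1 : PresRel O (gen O e1 * gen O e1) (gen O e1)
  | idem2 : PresRel O (gen O e2 * gen O e2) (gen O e2)
  | orth01 : PresRel O (gen O e0 * gen O e1) 0
  | orth02 : PresRel O (gen O e0 * gen O e2) 0
  | orth10 : PresRel O (gen O e1 * gen O e0) 0
  | orth12 : PresRel O (gen O e1 * gen O e2) 0
  | orth20 : PresRel O (gen O e2 * gen O e0) 0
  | orth21 : PresRel O (gen O e2 * gen O e1) 0
  | sum_eq_one : PresRel O (gen O e0 + gen O e1 + gen O e2) 1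
  -- the arrows of the quiver
  | β_left : PresRel O (gen O β) (gen O e0 * gen O β)
  | β_right : PresRel O (gen O β) (gen O β * gen O e1)
  | γ_left : PresRel O (gen O γ) (gen O e1 * gen O γ)
  | γ_right : PresRel O (gen O γ) (gen O γ * gen O e0)
  | δ_left : PresRel O (gen O δ) (gen O e1 * gen O δ)
  | δ_right : PresRel O (gen O δ) (gen O δ * gen O e2)
  | η_left : PresRel O (gen O η) (gen O e2 * gen O η)
  | η_right : PresRel O (gen O η) (gen O η * gen O e1)
  | lam_left : PresRel O (gen O lam) (gen O e2 * gen O lam)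
  | lam_right : PresRel O (gen O lam) (gen O lam * gen O e0)
  | κ_left : PresRel O (gen O κ) (gen O e0 * gen O κ)
  | κ_right : PresRel O (gen O κ) (gen O κ * gen O e2)
  -- paths of length two
  | βδ : PresRel O (gen O β * gen O δ)
      ((-2 : O) • gen O κ + gen O κ * gen O lam * gen O κ)
  | ηγ : PresRel O (gen O η * gen O γ)
      ((-2 : O) • gen O lam + gen O lam * gen O κ * gen O lam)
  | δlam : PresRel O (gen O δ * gen O lam)
      ((-2 : O) • gen O γ + gen O γ * gen O β * gen O γ)
  | κη : PresRel O (gen O κ * gen O η)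
      ((-2 : O) • gen O β + gen O β * gen O γ * gen O β)
  | lamβ : PresRel O (gen O lam * gen O β)
      ((-2 : O) • gen O η + gen O η * gen O δ * gen O η)
  | γκ : PresRel O (gen O γ * gen O κ)
      ((-2 : O) • gen O δ + gen O δ * gen O η * gen O δ)
  -- paths of length three
  | γβδ : PresRel O (gen O γ * gen O β * gen O δ)
      ((-4 : O) • gen O δ + (2 : O) • (gen O δ * gen O η * gen O δ))
  | δηγ : PresRel O (gen O δ * gen O η * gen O γ)
      ((-4 : O) • gen O γ + (2 : O) • (gen O γ * gen O β * gen O γ))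
  | lamκη : PresRel O (gen O lam * gen O κ * gen O η)
      ((-4 : O) • gen O η + (2 : O) • (gen O η * gen O δ * gen O η))
  | βγκ : PresRel O (gen O β * gen O γ * gen O κ)
      ((-4 : O) • gen O κ + (2 : O) • (gen O κ * gen O lam * gen O κ))
  | ηδlam : PresRel O (gen O η * gen O δ * gen O lam)
      ((-4 : O) • gen O lam + (2 : O) • (gen O lam * gen O κ * gen O lam))
  | κlamβ : PresRel O (gen O κ * gen O lam * gen O β)
      ((-4 : O) • gen O β + (2 : O) • (gen O β * gen O γ * gen O β))
  | ηγβ : PresRel O (gen O η * gen O γ * gen O β)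
      ((-4 : O) • gen O η + (2 : O) • (gen O η * gen O δ * gen O η))
  | βδη : PresRel O (gen O β * gen O δ * gen O η)
      ((-4 : O) • gen O β + (2 : O) • (gen O β * gen O γ * gen O β))
  | δlamκ : PresRel O (gen O δ * gen O lam * gen O κ)
      ((-4 : O) • gen O δ + (2 : O) • (gen O δ * gen O η * gen O δ))
  | lamβγ : PresRel O (gen O lam * gen O β * gen O γ)
      ((-4 : O) • gen O lam + (2 : O) • (gen O lam * gen O κ * gen O lam))
  | κηδ : PresRel O (gen O κ * gen O η * gen O δ)
      ((-4 : O) • gen O κ + (2 : O) • (gen O κ * gen O lam * gen O κ))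
  | γκlam : PresRel O (gen O γ * gen O κ * gen O lam)
      ((-4 : O) • gen O γ + (2 : O) • (gen O γ * gen O β * gen O γ))
  -- paths of length four
  | βδlamβ : PresRel O (gen O β * gen O δ * gen O lam * gen O β)
      ((-8 : O) • gen O β + (4 : O) • (gen O β * gen O γ * gen O β))
  | δlamβδ : PresRel O (gen O δ * gen O lam * gen O β * gen O δ)
      ((-8 : O) • gen O δ + (4 : O) • (gen O δ * gen O η * gen O δ))
  | lamβδlam : PresRel O (gen O lam * gen O β * gen O δ * gen O lam)
      ((-8 : O) • gen O lam + (4 : O) • (gen O lam * gen O κ * gen O lam))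

end Presentation

/-- The unital associative `O`-algebra with these generators and relations. -/
abbrev PresAlgebra (O : Type*) [CommRing O] : Type _ := RingQuot (PresRel O)

/-!
An order `A` with reduction `k Ã₄` is shown to be determined by its center, once the center is known
in terms of the primitive central idempotents `ε t` of `K ⊗ A`; the hypotheses on `Φ` are used only
to put the center into that form.

*The center determines the order.* Index the characters of `Ã₄` by `CharIndex`: `none` stands for
the one of degree three, `some i` for those of degree one, and the three of degree two are indexed
by `ZMod 3`. The center of `O Ã₄` is spanned by `1`, by the elements `8 ε_a` for `a` a character of
odd degree, and by the elements `4 (ε_a + ε_b) + 2 φ` for two characters `a ≠ b` of odd degree,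
where `φ` belongs to the character of degree two attached to the partition of the four characters of
odd degree into `{a, b}` and its complement (`CharIndex.octFun`, `CharIndex.pairFun`,
`CharIndex.third`). Suppose that `A` has a center of this shape (`CentralLift`). The idempotents of
`k Ã₄` lift to idempotents `e i` of `A`. Write `z i` for the central element attached to the two
arrows `X i : i → i + 1` and `Y i : i + 1 → i`, and `s` for `8 ε_none`. By Nakayama's lemma
`e i A e i` has the basis `e i, z i e i, z (i + 2) e i, s e i`, while `e i A e (i + 1)` has the
basis `X i, z i X i`, and similarly for `Y i` (`CentralLift.peirceFrame`). So each product of arrows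
is a combination of these elements. Multiplication by central elements shows that `X i Y i` is a
combination of `z i e i` and `s e i` and that `X 0 X 1 X 2` is a multiple of `s e 0`. The
coefficients are units in the appropriate sense because of the reduction, and rescaling the arrows
by units of `O[z i]` gives `X i Y i = z i e i` and `X 0 X 1 X 2 = s e 0`
(`PeirceFrame.exists_normalized`). All the relations follow by calculations in the center
(`PeirceFrame.quiverRelations`). Conversely, the algebra given by the relations is spanned by 24
paths (`QuiverRelations.span_word_eq_top`), so its surjection onto the free `O`-module `A` of rank
24 is an isomorphism (`CentralLift.nonempty_algEquiv`).

*The group ring.* The irreducible representations of `Ã₄` are written down over `O`. They give the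
splitting of `K Ã₄`, and the class sums are combined into the elements above, so that `O Ã₄` is
itself one of the orders in question (`CharIndex.groupAlgebra_nonempty_algEquiv`).

*Using the isometry.* An isometry between groups of generalised characters is a bijection of the
irreducible characters up to signs (`Finsupp.exists_equiv_of_isometry`). The element of order three
of `Ã₄` lifts to a cube root of one in `A` by Newton's method, and its spectral idempotents `e i`
lift those of `k Ã₄` (`exists_idempotents`). The images under `Φ` of the characters of the
projective modules `A e i` satisfy the linear relations between the values of projective characters
of `O Ã₄` (`CharIndex.projRelation_of_mem`), and their scalar products are the ranks `4` and `2` of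
the Peirce components. The vectors of norm four which satisfy the relations correspond to the roots
of the root system `A₃` (`CharIndex.ProjRelation.exists_root`), and three roots with the given
scalar products have a common first or last index. Hence some permutation of the characters, induced
by a permutation of those of odd degree, puts the three images into standard position up to a common
sign (`CharIndex.exists_perm_of_gram`). This permutation preserves the set of functions `octFun`,
`pairFun`, so the isomorphism of the centers shows that `A` has a center of the required shape
(`nonempty_algEquiv_presAlgebra`).
-/

open scoped TensorProduct Pointwise

set_option linter.unusedSimpArgs false
set_option linter.unnecessarySeqFocus false

/-! ### The quiver relations in cyclic notation -/

/-- `(i, j, k)` is a cyclic rotation of `(0, 1, 2)`. -/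
def Cyc (i j k : ZMod 3) : Prop := j = i + 1 ∧ k = i + 2

theorem Cyc.rot {i j k : ZMod 3} (h : Cyc i j k) : Cyc j k i := by
  revert i j k; unfold Cyc; decide

theorem Cyc.ne {i j k : ZMod 3} (h : Cyc i j k) : i ≠ j ∧ j ≠ k ∧ k ≠ i := by
  revert i j k; unfold Cyc; decide

theorem Cyc.cases {i j k : ZMod 3} (h : Cyc i j k) (l : ZMod 3) : l = i ∨ l = j ∨ l = k := by
  revert i j k l; unfold Cyc; decide

theorem Cyc.eq_of_cyc {i j k l m : ZMod 3} (h : Cyc i j k) (h' : Cyc l i m) : l = k := by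
  revert i j k l m; unfold Cyc; decide

theorem cyc_self (i : ZMod 3) : Cyc i (i + 1) (i + 2) := ⟨rfl, rfl⟩

theorem exists_cyc (i : ZMod 3) : ∃ j k, Cyc i j k := ⟨_, _, cyc_self i⟩

/-- The relations of `PresAlgebra`, in cyclic notation: `X 0, X 1, X 2` are the arrows
`β, δ, λ` and `Y 0, Y 1, Y 2` the opposite arrows `γ, η, κ`, so that `X i` runs from `i` to `i + 1`
and `Y i` back. -/
structure QuiverRelations {P : Type*} [Ring P] (e X Y : ZMod 3 → P) : Prop where
  idem : ∀ i, e i * e i = e i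
  orth : ∀ i j, i ≠ j → e i * e j = 0
  sum_eq_one : e 0 + e 1 + e 2 = 1
  eX : ∀ i, e i * X i = X i
  Xe : ∀ i j k, Cyc i j k → X i * e j = X i
  eY : ∀ i j k, Cyc i j k → e j * Y i = Y i
  Ye : ∀ i, Y i * e i = Y i
  XX : ∀ i j k, Cyc i j k → X i * X j = -2 * Y k + Y k * X k * Y k
  YY : ∀ i j k, Cyc i j k → Y j * Y i = -2 * X k + X k * Y k * X k
  YXX : ∀ i j k, Cyc i j k → Y i * X i * X j = -4 * X j + 2 * (X j * Y j * X j)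
  XYY : ∀ i j k, Cyc i j k → X j * Y j * Y i = -4 * Y i + 2 * (Y i * X i * Y i)
  YYX : ∀ i j k, Cyc i j k → Y j * Y i * X i = -4 * Y j + 2 * (Y j * X j * Y j)
  XXY : ∀ i j k, Cyc i j k → X i * X j * Y j = -4 * X i + 2 * (X i * Y i * X i)
  XXXX : ∀ i j k, Cyc i j k → X i * X j * X k * X i = -8 * X i + 4 * (X i * Y i * X i)

namespace QuiverRelations

/-- The eight paths attached to the vertex `i` that span an algebra with the quiver relations. -/
def word {P : Type*} [Ring P] (e X Y : ZMod 3 → P) (i : ZMod 3) : Fin 8 → P :=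
  ![e i, X i, Y i, X i * Y i, Y i * X i, X i * Y i * X i, Y i * X i * Y i,
    X i * X (i + 1) * X (i + 2)]

variable {O P : Type*} [CommRing O] [Ring P] [Algebra O P] {e X Y : ZMod 3 → P}

/-- If `3` is invertible, the 24 paths `word` span every algebra generated by elements with the
quiver relations: their span contains `1` and is closed under left multiplication by the generators.
The inverse of `3` is needed for the paths `X i * (X j * Y j * X j)` of length four and their
opposites. -/
theorem span_word_eq_top (h : QuiverRelations e X Y) {t : O} (ht : 3 * t = 1)
    (hgen : Algebra.adjoin O (Set.range e ∪ Set.range X ∪ Set.range Y) = ⊤) :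
    Submodule.span O (Set.range fun p : ZMod 3 × Fin 8 => word e X Y p.1 p.2) = ⊤ := by
  set S := Submodule.span O (Set.range fun p : ZMod 3 × Fin 8 => word e X Y p.1 p.2) with hS
  have hw : ∀ i n, word e X Y i n ∈ S := fun i n => Submodule.subset_span ⟨(i, n), rfl⟩
  have m_e : ∀ i, e i ∈ S := fun i => hw i 0
  have m_X : ∀ i, X i ∈ S := fun i => hw i 1
  have m_Y : ∀ i, Y i ∈ S := fun i => hw i 2
  have m_XY : ∀ i, X i * Y i ∈ S := fun i => hw i 3
  have m_YX : ∀ i, Y i * X i ∈ S := fun i => hw i 4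
  have m_XYX : ∀ i, X i * Y i * X i ∈ S := fun i => hw i 5
  have m_YXY : ∀ i, Y i * X i * Y i ∈ S := fun i => hw i 6
  have m_XXX : ∀ i j k, Cyc i j k → X i * X j * X k ∈ S := by
    rintro i j k ⟨rfl, rfl⟩; exact hw i 7
  have two : ∀ x ∈ S, 2 * x ∈ S := fun x hx => by rw [two_mul]; exact S.add_mem hx hx
  have four : ∀ x ∈ S, 4 * x ∈ S := fun x hx => by
    rw [show (4 : P) = 2 * 2 by norm_num, mul_assoc]; exact two _ (two _ hx)
  have m_XX : ∀ i j k, Cyc i j k → X i * X j ∈ S := fun i j k hc => by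
    rw [h.XX i j k hc, neg_mul]
    exact S.add_mem (S.neg_mem (two _ (m_Y k))) (m_YXY k)
  have m_YY : ∀ i j k, Cyc i j k → Y j * Y i ∈ S := fun i j k hc => by
    rw [h.YY i j k hc, neg_mul]
    exact S.add_mem (S.neg_mem (two _ (m_X k))) (m_XYX k)
  have third : ∀ x : P, (3 : P) * x ∈ S → x ∈ S := fun x hx => by
    have := S.smul_mem t hx
    rwa [show (3 : P) * x = (3 : O) • x by rw [Algebra.smul_def, map_ofNat], smul_smul, mul_comm t, ht,
      one_smul] at this
  have m_XXYX : ∀ i j k, Cyc i j k → X i * (X j * Y j * X j) ∈ S := fun i j k hc => by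
    apply third
    have e1 := congrArg (· * X j) (h.XXY i j k hc)
    have e2 := congrArg (X i * ·) (h.YXX i j k hc)
    have : 3 * (X i * (X j * Y j * X j)) = 4 * (3 * (X i * X j)) := by
      linear_combination (norm := noncomm_ring) - e1 - 2 * e2
    rw [this]
    exact four _ (by rw [show (3 : P) = 2 + 1 by norm_num, add_mul, one_mul]
                     exact S.add_mem (two _ (m_XX i j k hc)) (m_XX i j k hc))
  have m_YYXY : ∀ i j k, Cyc i j k → Y j * (Y i * X i * Y i) ∈ S := fun i j k hc => by
    apply third
    have e1 := congrArg (· * Y i) (h.YYX i j k hc)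
    have e2 := congrArg (Y j * ·) (h.XYY i j k hc)
    have : 3 * (Y j * (Y i * X i * Y i)) = 4 * (3 * (Y j * Y i)) := by
      linear_combination (norm := noncomm_ring) - e1 - 2 * e2
    rw [this]
    exact four _ (by rw [show (3 : P) = 2 + 1 by norm_num, add_mul, one_mul]
                     exact S.add_mem (two _ (m_YY i j k hc)) (m_YY i j k hc))
  have m_YXXX : ∀ i j k, Cyc i j k → Y i * (X i * X j * X k) ∈ S := fun i j k hc => by
    have e1 := congrArg (· * X k) (h.YXX i j k hc)
    have e2 := congrArg (X j * ·) (h.YXX j k i hc.rot)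
    have : Y i * (X i * X j * X k) =
        - (4 * (X j * X k)) + (- (4 * (2 * (X j * X k))) + 4 * (X j * (X k * Y k * X k))) := by
      linear_combination (norm := noncomm_ring) e1 + 2 * e2
    rw [this]
    exact S.add_mem (S.neg_mem (four _ (m_XX _ _ _ hc.rot)))
      (S.add_mem (S.neg_mem (four _ (two _ (m_XX _ _ _ hc.rot)))) (four _ (m_XXYX _ _ _ hc.rot)))
  have m_XYXY : ∀ i j k, Cyc i j k → X i * (Y i * X i * Y i) ∈ S := fun i j k hc => by
    have : X i * (Y i * X i * Y i) = X i * X j * X k + 2 * (X i * Y i) := by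
      have := congrArg (X i * ·) (h.XX j k i hc.rot)
      linear_combination (norm := noncomm_ring) - this
    rw [this]
    exact S.add_mem (m_XXX _ _ _ hc) (two _ (m_XY i))
  have m_YXYX : ∀ i j k, Cyc i j k → Y i * (X i * Y i * X i) ∈ S := fun i j k hc => by
    have : Y i * (X i * Y i * X i) = X j * X k * X i + 2 * (Y i * X i) := by
      have := congrArg (· * X i) (h.XX j k i hc.rot)
      linear_combination (norm := noncomm_ring) - this
    rw [this]
    exact S.add_mem (m_XXX _ _ _ hc.rot) (two _ (m_YX i))
  have key : ∀ g ∈ Set.range e ∪ Set.range X ∪ Set.range Y, ∀ x ∈ S, g * x ∈ S := by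
    intro g hg x hx
    induction hx using Submodule.span_induction with
    | zero => rw [mul_zero]; exact S.zero_mem
    | add x y _ _ hx hy => rw [mul_add]; exact S.add_mem hx hy
    | smul a x _ hx => rw [mul_smul_comm]; exact S.smul_mem a hx
    | mem x hx =>
      obtain ⟨⟨l, n⟩, rfl⟩ := hx
      -- the source vertices of the words
      have src : ∀ i j k, Cyc i j k → ∀ w ∈ ({e i, X i, Y k, X i * Y i, Y k * X k,
          X i * Y i * X i, Y k * X k * Y k, X i * X j * X k} : Set P), e i * w = w := by
        intro i j k hc w hw
        have hY := h.eY k i j hc.rot.rot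
        have hX := h.eX i
        rcases hw with rfl | rfl | rfl | rfl | rfl | rfl | rfl | rfl <;>
          simp only [← mul_assoc, hX, hY, h.idem]
      have hsrc : ∃ i j k, Cyc i j k ∧ word e X Y l n ∈ ({e i, X i, Y k, X i * Y i, Y k * X k,
          X i * Y i * X i, Y k * X k * Y k, X i * X j * X k} : Set P) := by
        have c := cyc_self l
        have c' := c.rot
        fin_cases n <;> simp only [word]
        · exact ⟨_, _, _, c, by simp⟩
        · exact ⟨_, _, _, c, by simp⟩
        · exact ⟨_, _, _, c', by simp⟩
        · exact ⟨_, _, _, c, by simp⟩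
        · exact ⟨_, _, _, c', by simp⟩
        · exact ⟨_, _, _, c, by simp⟩
        · exact ⟨_, _, _, c', by simp⟩
        · exact ⟨_, _, _, c, by simp⟩
      obtain ⟨i, j, k, hc, hmem⟩ := hsrc
      have hs := src i j k hc _ hmem
      rcases hg with (⟨m, rfl⟩ | ⟨m, rfl⟩) | ⟨m, rfl⟩
      · by_cases hm : m = i
        · subst hm; simp only [hs]; exact hw l n
        · simp only
          rw [← hs, ← mul_assoc, h.orth m i hm, zero_mul]; exact S.zero_mem
      · by_cases hm : m = k
        · subst hm
          simp only
          have hc' := hc.rot.rot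
          rcases hmem with hq | hq | hq | hq | hq | hq | hq | hq <;> rw [hq]
          · rw [h.Xe _ _ _ hc']; exact m_X _
          · exact m_XX _ _ _ hc'
          · exact m_XY _
          · rw [← mul_assoc, h.XXY _ _ _ hc', neg_mul]
            exact S.add_mem (S.neg_mem (four _ (m_X _))) (two _ (m_XYX _))
          · rw [← mul_assoc]; exact m_XYX _
          · exact m_XXYX _ _ _ hc'
          · exact m_XYXY _ _ _ hc'
          · rw [← mul_assoc, ← mul_assoc, h.XXXX _ _ _ hc', neg_mul,
              show (8 : P) = 4 * 2 by norm_num, mul_assoc]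
            exact S.add_mem (S.neg_mem (four _ (two _ (m_X _)))) (four _ (m_XYX _))
        · obtain ⟨m', m'', hm'⟩ := exists_cyc m
          have : m' ≠ i := by
            rintro rfl
            exact hm (hc.eq_of_cyc hm')
          simp only
          rw [← hs, ← h.Xe m m' m'' hm', mul_assoc, ← mul_assoc (e m'), h.orth _ _ this,
            zero_mul, mul_zero]
          exact S.zero_mem
      · by_cases hm : m = i
        · subst hm
          simp only
          rcases hmem with hq | hq | hq | hq | hq | hq | hq | hq <;> rw [hq]
          · rw [h.Ye]; exact m_Y _
          · exact m_YX _
          · exact m_YY _ _ _ hc.rot.rot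
          · rw [← mul_assoc]; exact m_YXY _
          · rw [← mul_assoc, h.YYX _ _ _ hc.rot.rot, neg_mul]
            exact S.add_mem (S.neg_mem (four _ (m_Y _))) (two _ (m_YXY _))
          · exact m_YXYX _ _ _ hc
          · exact m_YYXY _ _ _ hc.rot.rot
          · exact m_YXXX _ _ _ hc
        · simp only
          rw [← hs, ← h.Ye m, mul_assoc, ← mul_assoc (e m), h.orth _ _ hm, zero_mul, mul_zero]
          exact S.zero_mem
  have one_mem : (1 : P) ∈ S := by
    rw [← h.sum_eq_one]; exact S.add_mem (S.add_mem (m_e 0) (m_e 1)) (m_e 2)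
  have all : ∀ a : P, ∀ x ∈ S, a * x ∈ S := by
    intro a
    have ha : a ∈ Algebra.adjoin O (Set.range e ∪ Set.range X ∪ Set.range Y) := by
      rw [hgen]; trivial
    induction ha using Algebra.adjoin_induction with
    | mem g hg => exact key g hg
    | algebraMap r => intro x hx; rw [← Algebra.smul_def]; exact S.smul_mem r hx
    | add a b _ _ ha hb => intro x hx; rw [add_mul]; exact S.add_mem (ha x hx) (hb x hx)
    | mul a b _ _ ha hb => intro x hx; rw [mul_assoc]; exact ha _ (hb x hx)
  rw [eq_top_iff]
  intro a _
  simpa using all a 1 one_mem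

end QuiverRelations

/-! ### Recognising the algebra given by generators and relations -/

namespace PresAlgebra

open Gen

variable (O : Type*) [CommRing O]

/-- The image of a generator in `PresAlgebra O`. -/
noncomputable def of (g : Gen) : PresAlgebra O := RingQuot.mkAlgHom O (PresRel O) (gen O g)

/-- The vertices in cyclic notation. -/
def vertex : ZMod 3 → Gen := ![e0, e1, e2]

/-- The arrows `β, δ, λ` in cyclic notation. -/
def arrow : ZMod 3 → Gen := ![β, δ, lam]

/-- The arrows `γ, η, κ` in cyclic notation. -/
def opArrow : ZMod 3 → Gen := ![γ, η, κ]

theorem adjoin_eq_top : Algebra.adjoin O (Set.range (of O ∘ vertex) ∪ Set.range (of O ∘ arrow) ∪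
    Set.range (of O ∘ opArrow)) = ⊤ := by
  have h1 : Algebra.adjoin O (Set.range (FreeAlgebra.ι O (X := Gen))) = ⊤ :=
    FreeAlgebra.adjoin_range_ι O Gen
  have h2 := congrArg (Subalgebra.map (RingQuot.mkAlgHom O (PresRel O))) h1
  rw [AlgHom.map_adjoin, Algebra.map_top,
    (AlgHom.range_eq_top _).2 (RingQuot.mkAlgHom_surjective O (PresRel O))] at h2
  rw [eq_top_iff, ← h2]
  apply Algebra.adjoin_mono
  rintro _ ⟨_, ⟨g, rfl⟩, rfl⟩
  cases g
  · exact Or.inl (Or.inl ⟨0, rfl⟩)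
  · exact Or.inl (Or.inl ⟨1, rfl⟩)
  · exact Or.inl (Or.inl ⟨2, rfl⟩)
  · exact Or.inl (Or.inr ⟨0, rfl⟩)
  · exact Or.inr ⟨0, rfl⟩
  · exact Or.inl (Or.inr ⟨1, rfl⟩)
  · exact Or.inr ⟨1, rfl⟩
  · exact Or.inl (Or.inr ⟨2, rfl⟩)
  · exact Or.inr ⟨2, rfl⟩

/-- The generators of `PresAlgebra O` satisfy the quiver relations. -/
theorem quiverRelations :
    QuiverRelations (of O ∘ vertex) (of O ∘ arrow) (of O ∘ opArrow) := by
  have R : ∀ {x y}, PresRel O x y →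
      RingQuot.mkAlgHom O (PresRel O) x = RingQuot.mkAlgHom O (PresRel O) y :=
    fun h => RingQuot.mkAlgHom_rel O h
  constructor
  case idem =>
    intro i; fin_cases i
    · have := R PresRel.idem0; simp only [map_mul] at this; exact this
    · have := R PresRel.idem1; simp only [map_mul] at this; exact this
    · have := R PresRel.idem2; simp only [map_mul] at this; exact this
  case orth =>
    intro i j hij; fin_cases i <;> fin_cases j
    · exact absurd rfl hij
    · have := R PresRel.orth01; simp only [map_mul, map_zero] at this; exact this
    · have := R PresRel.orth02; simp only [map_mul, map_zero] at this; exact this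
    · have := R PresRel.orth10; simp only [map_mul, map_zero] at this; exact this
    · exact absurd rfl hij
    · have := R PresRel.orth12; simp only [map_mul, map_zero] at this; exact this
    · have := R PresRel.orth20; simp only [map_mul, map_zero] at this; exact this
    · have := R PresRel.orth21; simp only [map_mul, map_zero] at this; exact this
    · exact absurd rfl hij
  case sum_eq_one => have := R PresRel.sum_eq_one; simp only [map_add, map_one] at this; exact this
  case eX =>
    intro i; fin_cases i
    · have := R PresRel.β_left; simp only [map_mul] at this; exact this.symm
    · have := R PresRel.δ_left; simp only [map_mul] at this; exact this.symm
    · have := R PresRel.lam_left; simp only [map_mul] at this; exact this.symm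
  case Ye =>
    intro i; fin_cases i
    · have := R PresRel.γ_right; simp only [map_mul] at this; exact this.symm
    · have := R PresRel.η_right; simp only [map_mul] at this; exact this.symm
    · have := R PresRel.κ_right; simp only [map_mul] at this; exact this.symm
  all_goals
    rintro i j k ⟨rfl, rfl⟩
  case Xe =>
    fin_cases i
    · have := R PresRel.β_right; simp only [map_mul] at this; exact this.symm
    · have := R PresRel.δ_right; simp only [map_mul] at this; exact this.symm
    · have := R PresRel.lam_right; simp only [map_mul] at this; exact this.symm
  case eY =>
    fin_cases i
    · have := R PresRel.γ_left; simp only [map_mul] at this; exact this.symm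
    · have := R PresRel.η_left; simp only [map_mul] at this; exact this.symm
    · have := R PresRel.κ_left; simp only [map_mul] at this; exact this.symm
  case XX =>
    fin_cases i
    · have := R PresRel.βδ; simp only [map_mul, map_add, Algebra.smul_def, map_neg, map_ofNat] at this; exact this
    · have := R PresRel.δlam; simp only [map_mul, map_add, Algebra.smul_def, map_neg, map_ofNat] at this; exact this
    · have := R PresRel.lamβ; simp only [map_mul, map_add, Algebra.smul_def, map_neg, map_ofNat] at this; exact this
  case YY =>
    fin_cases i
    · have := R PresRel.ηγ; simp only [map_mul, map_add, Algebra.smul_def, map_neg, map_ofNat] at this; exact this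
    · have := R PresRel.κη; simp only [map_mul, map_add, Algebra.smul_def, map_neg, map_ofNat] at this; exact this
    · have := R PresRel.γκ; simp only [map_mul, map_add, Algebra.smul_def, map_neg, map_ofNat] at this; exact this
  case YXX =>
    fin_cases i
    · have := R PresRel.γβδ; simp only [map_mul, map_add, Algebra.smul_def, map_neg, map_ofNat] at this; exact this
    · have := R PresRel.ηδlam; simp only [map_mul, map_add, Algebra.smul_def, map_neg, map_ofNat] at this; exact this
    · have := R PresRel.κlamβ; simp only [map_mul, map_add, Algebra.smul_def, map_neg, map_ofNat] at this; exact this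
  case XYY =>
    fin_cases i
    · have := R PresRel.δηγ; simp only [map_mul, map_add, Algebra.smul_def, map_neg, map_ofNat] at this; exact this
    · have := R PresRel.lamκη; simp only [map_mul, map_add, Algebra.smul_def, map_neg, map_ofNat] at this; exact this
    · have := R PresRel.βγκ; simp only [map_mul, map_add, Algebra.smul_def, map_neg, map_ofNat] at this; exact this
  case YYX =>
    fin_cases i
    · have := R PresRel.ηγβ; simp only [map_mul, map_add, Algebra.smul_def, map_neg, map_ofNat] at this; exact this
    · have := R PresRel.κηδ; simp only [map_mul, map_add, Algebra.smul_def, map_neg, map_ofNat] at this; exact this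
    · have := R PresRel.γκlam; simp only [map_mul, map_add, Algebra.smul_def, map_neg, map_ofNat] at this; exact this
  case XXY =>
    fin_cases i
    · have := R PresRel.βδη; simp only [map_mul, map_add, Algebra.smul_def, map_neg, map_ofNat] at this; exact this
    · have := R PresRel.δlamκ; simp only [map_mul, map_add, Algebra.smul_def, map_neg, map_ofNat] at this; exact this
    · have := R PresRel.lamβγ; simp only [map_mul, map_add, Algebra.smul_def, map_neg, map_ofNat] at this; exact this
  case XXXX =>
    fin_cases i
    · have := R PresRel.βδlamβ; simp only [map_mul, map_add, Algebra.smul_def, map_neg, map_ofNat] at this; exact this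
    · have := R PresRel.δlamβδ; simp only [map_mul, map_add, Algebra.smul_def, map_neg, map_ofNat] at this; exact this
    · have := R PresRel.lamβδlam; simp only [map_mul, map_add, Algebra.smul_def, map_neg, map_ofNat] at this; exact this

end PresAlgebra

/-! ### Orders with central elements of prescribed type -/

/-- Orthogonal idempotents `e i`, arrows `X i : i → i + 1`, `Y i : i + 1 → i` of an `O`-algebra `A`
and scalars `z i`, `s` from a commutative `O`-algebra `C` acting centrally, such that the Peirce
components of `A` have the displayed `O`-bases.

In the application `C` is the center of `A`, `s` is `8` times the central idempotent of the
character of degree three, and `z i` acts on `e i A e (i + 1)` as `4` on the component of that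
character and as `2` on the component of the only other common constituent. -/
structure PeirceFrame (O C : Type*) {A : Type*} [CommRing O] [CommRing C] [Algebra O C] [Ring A]
    [Algebra O A] [Algebra C A] (e X Y : ZMod 3 → A) (z : ZMod 3 → C) (s : C) : Prop where
  idem : ∀ i, e i * e i = e i
  orth : ∀ i j, i ≠ j → e i * e j = 0
  sum_eq_one : e 0 + e 1 + e 2 = 1
  eX : ∀ i, e i * X i = X i
  Xe : ∀ i j k, Cyc i j k → X i * e j = X i
  eY : ∀ i j k, Cyc i j k → e j * Y i = Y i
  Ye : ∀ i, Y i * e i = Y i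
  zz_src : ∀ i, (z i * z i) • e i = (2 * z i + s) • e i
  zz_tgt : ∀ i j k, Cyc i j k → (z i * z i) • e j = (2 * z i + s) • e j
  zz : ∀ i j, i ≠ j → z i * z j = 2 * s
  zs : ∀ i, z i * s = 4 * s
  ss : s * s = 8 * s
  s_smul : ∀ i j k, Cyc i j k → ∀ m, e i * m = m → m * e j = m → s • m = (4 * (z i - 2)) • m
  s_smul' : ∀ i j k, Cyc i j k → ∀ m, e j * m = m → m * e i = m → s • m = (4 * (z i - 2)) • m
  two_cancel : ∀ x : A, (2 : C) • x = 0 → x = 0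
  exists_diag : ∀ i j k, Cyc i j k → ∀ m, e i * m = m → m * e i = m →
    ∃ a b c d : O, m = a • e i + b • z i • e i + c • z k • e i + d • s • e i
  diag_indep : ∀ i j k, Cyc i j k → ∀ a b c d : O,
    a • e i + b • z i • e i + c • z k • e i + d • s • e i = 0 → a = 0 ∧ b = 0 ∧ c = 0 ∧ d = 0
  exists_X : ∀ i j k, Cyc i j k → ∀ m, e i * m = m → m * e j = m →
    ∃ a b : O, m = a • X i + b • z i • X i
  X_indep : ∀ i, ∀ a b : O, a • X i + b • z i • X i = 0 → a = 0 ∧ b = 0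
  exists_Y : ∀ i j k, Cyc i j k → ∀ m, e j * m = m → m * e i = m →
    ∃ a b : O, m = a • Y i + b • z i • Y i
  Y_indep : ∀ i, ∀ a b : O, a • Y i + b • z i • Y i = 0 → a = 0 ∧ b = 0

namespace PeirceFrame

variable {O C A : Type*} [CommRing O] [CommRing C] [Algebra O C] [Ring A]
  [Algebra O A] [Algebra C A] {e X Y : ZMod 3 → A} {z : ZMod 3 → C} {s : C}

theorem eight_cancel (h : PeirceFrame O C e X Y z s) {x y : A} (hxy : (8 : C) • x = (8 : C) • y) :
    x = y := by
  rw [← sub_eq_zero]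
  apply h.two_cancel; apply h.two_cancel; apply h.two_cancel
  linear_combination (norm := module) hxy

theorem four_cancel (h : PeirceFrame O C e X Y z s) {x y : A} (hxy : (4 : C) • x = (4 : C) • y) :
    x = y :=
  h.eight_cancel (by linear_combination (norm := module) (2 : C) • hxy)

/-- The value of `z j` on a Peirce component on which `s = 4 (z i - 2)`. -/
theorem z_smul_of_s_smul (h : PeirceFrame O C e X Y z s) {i j : ZMod 3} (hij : i ≠ j) {m : A}
    (hm : s • m = (4 * (z i - 2)) • m) : z j • m = (2 * (z i - 2)) • m := by
  apply h.eight_cancel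
  have h1 : (z i * z j) • m = (2 * s) • m := by rw [h.zz i j hij]
  have h2 : (z j * s) • m = (4 * s) • m := by rw [h.zs j]
  linear_combination (norm := module) (4 : C) • h1 - h2 + (z j + 4) • hm

variable [IsScalarTower O C A]

theorem s_smul_diag (h : PeirceFrame O C e X Y z s) (i k : ZMod 3)
    (a b c d : O) :
    s • (a • e i + b • z i • e i + c • z k • e i + d • s • e i) =
      (a + 4 * b + 4 * c + 8 * d) • s • e i := by
  have h1 : (z i * s) • e i = (4 * s) • e i := by rw [h.zs i]
  have h2 : (z k * s) • e i = (4 * s) • e i := by rw [h.zs k]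
  have h3 : (s * s) • e i = (8 * s) • e i := by rw [h.ss]
  linear_combination (norm := (match_scalars <;> simp only [map_mul, map_add, map_sub, map_neg, map_ofNat,
        map_zero, map_one] <;> ring)) b • h1 + c • h2 + d • h3

theorem z_smul_diag (h : PeirceFrame O C e X Y z s) {i j k : ZMod 3} (hc : Cyc i j k)
    (a b c d : O) :
    z i • (a • e i + b • z i • e i + c • z k • e i + d • s • e i) =
      (0 : O) • e i + (a + 2 * b) • z i • e i + (0 : O) • z k • e i +
        (b + 2 * c + 4 * d) • s • e i := by
  have h1 : (z i * s) • e i = (4 * s) • e i := by rw [h.zs i]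
  have h2 : (z i * z k) • e i = (2 * s) • e i := by rw [h.zz i k hc.ne.2.2.symm]
  linear_combination (norm := (match_scalars <;> simp only [map_mul, map_add, map_sub, map_neg, map_ofNat,
        map_zero, map_one] <;> ring)) b • h.zz_src i + c • h2 + d • h1

theorem z_smul_diag' (h : PeirceFrame O C e X Y z s) {i j k : ZMod 3} (hc : Cyc i j k)
    (a b c d : O) :
    z k • (a • e i + b • z i • e i + c • z k • e i + d • s • e i) =
      (0 : O) • e i + (0 : O) • z i • e i + (a + 2 * c) • z k • e i +
        (c + 2 * b + 4 * d) • s • e i := by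
  have h1 : (z k * s) • e i = (4 * s) • e i := by rw [h.zs k]
  have h2 : (z i * z k) • e i = (2 * s) • e i := by rw [h.zz i k hc.ne.2.2.symm]
  linear_combination (norm := (match_scalars <;> simp only [map_mul, map_add, map_sub, map_neg, map_ofNat,
        map_zero, map_one] <;> ring)) c • h.zz_tgt k i j hc.rot.rot + b • h2 + d • h1

variable [IsDomain O] [CharZero O]

/-- An endomorphism of the vertex `i` factoring through the arrows between `i` and `i + 1` is
supported on the constituents common to the vertices `i` and `i + 1`. -/
theorem exists_of_s_smul (h : PeirceFrame O C e X Y z s) {i j k : ZMod 3} (hc : Cyc i j k) {m : A}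
    (hl : e i * m = m) (hr : m * e i = m) (hm : s • m = (4 * (z i - 2)) • m) :
    ∃ b d : O, m = b • z i • e i + d • s • e i := by
  obtain ⟨a, b, c, d, rfl⟩ := h.exists_diag i j k hc m hl hr
  have h1 := h.s_smul_diag i k a b c d
  have h2 := h.z_smul_diag hc a b c d
  obtain ⟨-, ha, hc', -⟩ := h.diag_indep i j k hc (-8 * a) (4 * a) (-8 * c) (4 * c - a) (by
    linear_combination (norm := (match_scalars <;> simp only [map_mul, map_add, map_sub, map_neg, map_ofNat,
        map_zero, map_one] <;> ring)) h1 - hm - (4 : C) • h2)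
  have ha' : a = 0 := by simpa using ha
  have hc'' : c = 0 := by simpa using hc'
  subst ha' hc''
  exact ⟨b, d, by module⟩

theorem exists_of_s_smul' (h : PeirceFrame O C e X Y z s) {i j k : ZMod 3} (hc : Cyc i j k) {m : A}
    (hl : e i * m = m) (hr : m * e i = m) (hm : s • m = (4 * (z k - 2)) • m) :
    ∃ c d : O, m = c • z k • e i + d • s • e i := by
  obtain ⟨a, b, c, d, rfl⟩ := h.exists_diag i j k hc m hl hr
  have h1 := h.s_smul_diag i k a b c d
  have h2 := h.z_smul_diag' hc a b c d
  obtain ⟨-, hb', ha, -⟩ := h.diag_indep i j k hc (-8 * a) (-8 * b) (4 * a) (4 * b - a) (by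
    linear_combination (norm := (match_scalars <;> simp only [map_mul, map_add, map_sub, map_neg, map_ofNat,
        map_zero, map_one] <;> ring)) h1 - hm - (4 : C) • h2)
  have ha' : a = 0 := by simpa using ha
  have hb'' : b = 0 := by simpa using hb'
  subst ha' hb''
  exact ⟨c, d, by module⟩

theorem exists_of_s_smul_both (h : PeirceFrame O C e X Y z s) {i j k : ZMod 3} (hc : Cyc i j k)
    {m : A} (hl : e i * m = m) (hr : m * e i = m) (hm : s • m = (4 * (z i - 2)) • m)
    (hm' : s • m = (4 * (z k - 2)) • m) : ∃ d : O, m = d • s • e i := by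
  obtain ⟨b, d, h1⟩ := h.exists_of_s_smul hc hl hr hm
  obtain ⟨c, d', h2⟩ := h.exists_of_s_smul' hc hl hr hm'
  obtain ⟨-, hb, -, -⟩ := h.diag_indep i j k hc 0 b (-c) (d - d') (by
    linear_combination (norm := module) h2 - h1)
  subst hb
  exact ⟨d, by rw [h1]; module⟩

/-- The product of an arrow with the opposite arrow. -/
theorem exists_XY (h : PeirceFrame O C e X Y z s) (i : ZMod 3) :
    ∃ b d : O, X i * Y i = b • z i • e i + d • s • e i := by
  obtain ⟨j, k, hc⟩ := exists_cyc i
  apply h.exists_of_s_smul hc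
  · rw [← mul_assoc, h.eX]
  · rw [mul_assoc, h.Ye]
  · rw [← smul_mul_assoc, h.s_smul i j k hc _ (h.eX i) (h.Xe i j k hc), smul_mul_assoc]

/-- The product of the three arrows of an oriented triangle. -/
theorem exists_XXX (h : PeirceFrame O C e X Y z s) {i j k : ZMod 3} (hc : Cyc i j k) :
    ∃ d : O, X i * X j * X k = d • s • e i := by
  apply h.exists_of_s_smul_both hc
  · rw [← mul_assoc, ← mul_assoc, h.eX]
  · rw [mul_assoc, h.Xe k i j hc.rot.rot]
  · rw [mul_assoc, ← smul_mul_assoc, h.s_smul i j k hc _ (h.eX i) (h.Xe i j k hc), smul_mul_assoc]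
  · rw [← mul_smul_comm, h.s_smul k i j hc.rot.rot _ (h.eX k) (h.Xe k i j hc.rot.rot),
      mul_smul_comm]

end PeirceFrame

/-! ### Normalising the arrows -/

namespace PeirceFrame

variable {O C A : Type*} [CommRing O] [CommRing C] [Algebra O C] [Ring A]
  [Algebra O A] [Algebra C A] {e X Y : ZMod 3 → A} {z : ZMod 3 → C} {s : C}

theorem s_smul_X (h : PeirceFrame O C e X Y z s) (i : ZMod 3) :
    s • X i = (4 * (z i - 2)) • X i :=
  h.s_smul i _ _ (cyc_self i) _ (h.eX i) (h.Xe i _ _ (cyc_self i))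

theorem s_smul_Y (h : PeirceFrame O C e X Y z s) (i : ZMod 3) :
    s • Y i = (4 * (z i - 2)) • Y i :=
  h.s_smul' i _ _ (cyc_self i) _ (h.eY i _ _ (cyc_self i)) (h.Ye i)

theorem zz_smul_X (h : PeirceFrame O C e X Y z s) (i : ZMod 3) :
    (z i * z i) • X i = (6 * z i - 8) • X i := by
  have h1 := congrArg (· * X i) (h.zz_src i)
  simp only [smul_mul_assoc, h.eX] at h1
  linear_combination (norm := module) h1 + h.s_smul_X i

theorem zz_smul_Y (h : PeirceFrame O C e X Y z s) (i : ZMod 3) :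
    (z i * z i) • Y i = (6 * z i - 8) • Y i := by
  have h1 := congrArg (Y i * ·) (h.zz_src i)
  simp only [mul_smul_comm, h.Ye] at h1
  linear_combination (norm := module) h1 + h.s_smul_Y i

variable [IsScalarTower O C A]

/-- A frame stays a frame when the arrows `X i` are multiplied by units of `O` and the arrows `Y i`
by elements `p i + q i * z i` that are invertible on the respective Peirce component. -/
theorem rescale (h : PeirceFrame O C e X Y z s) (u : ZMod 3 → Oˣ) (p q p' q' : ZMod 3 → O)
    (hY : ∀ i, p' i • (p i • Y i + q i • z i • Y i) + q' i • z i • (p i • Y i + q i • z i • Y i) =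
      Y i) :
    PeirceFrame O C e (fun i => (u i : O) • X i) (fun i => p i • Y i + q i • z i • Y i) z s where
  idem := h.idem
  orth := h.orth
  sum_eq_one := h.sum_eq_one
  eX i := by simp only [mul_smul_comm, h.eX]
  Xe i j k hc := by simp only [smul_mul_assoc, h.Xe i j k hc]
  eY i j k hc := by simp only [mul_add, mul_smul_comm, h.eY i j k hc]
  Ye i := by simp only [add_mul, smul_mul_assoc, h.Ye]
  zz_src := h.zz_src
  zz_tgt := h.zz_tgt
  zz := h.zz
  zs := h.zs
  ss := h.ss
  s_smul := h.s_smul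
  s_smul' := h.s_smul'
  two_cancel := h.two_cancel
  exists_diag := h.exists_diag
  diag_indep := h.diag_indep
  exists_X i j k hc m hl hr := by
    obtain ⟨a, b, rfl⟩ := h.exists_X i j k hc m hl hr
    refine ⟨a * ↑(u i)⁻¹, b * ↑(u i)⁻¹, ?_⟩
    rw [smul_comm (z i), smul_smul, smul_smul, mul_assoc, mul_assoc, Units.inv_mul, mul_one, mul_one]
  X_indep i a b hab := by
    obtain ⟨ha, hb⟩ := h.X_indep i (a * u i) (b * u i) (by
      rw [smul_comm (z i), smul_smul, smul_smul] at hab; exact hab)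
    exact ⟨by simpa using ha, by simpa using hb⟩
  exists_Y i j k hc m hl hr := by
    obtain ⟨a, b, rfl⟩ := h.exists_Y i j k hc m hl hr
    set y := p i • Y i + q i • z i • Y i with hy
    have hzz : (z i * z i) • y = (6 * z i - 8) • y := by
      rw [hy]
      have := h.zz_smul_Y i
      linear_combination (norm := module) p i • this + q i • z i • this
    refine ⟨a * p' i - 8 * b * q' i, a * q' i + b * p' i + 6 * b * q' i, ?_⟩
    have h1 := hY i
    linear_combination (norm := (match_scalars <;> simp only [map_mul, map_add, map_sub, map_neg,
      map_ofNat, map_zero, map_one] <;> ring)) - a • h1 - b • z i • h1 + (b * q' i) • hzz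
  Y_indep i a b hab := by
    apply h.Y_indep i a b
    set y := p i • Y i + q i • z i • Y i with hy
    have h1 := hY i
    linear_combination (norm := module) p' i • hab + q' i • z i • hab - a • h1 - b • z i • h1

variable [IsDomain O] [CharZero O]

/-- The arrows of a frame can be normalized by units. The hypotheses say that certain products of
arrows are not divisible by non-units. -/
theorem exists_normalized (h : PeirceFrame O C e X Y z s)
    (hb : ∀ i, ∀ b d : O, X i * Y i = b • z i • e i + d • s • e i →
      IsUnit b ∧ IsUnit (b + 2 * d))
    (hd : ∀ d : O, X 0 * X 1 * X 2 = d • s • e 0 → IsUnit d) :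
    ∃ X' Y' : ZMod 3 → A, PeirceFrame O C e X' Y' z s ∧ (∀ i, X' i * Y' i = z i • e i) ∧
      X' 0 * X' 1 * X' 2 = s • e 0 := by
  have hc : Cyc 0 1 2 := by unfold Cyc; decide
  obtain ⟨D, hD⟩ := h.exists_XXX hc
  obtain ⟨D, rfl⟩ := hd D hD
  choose b d hbd using h.exists_XY
  choose b' hb' using fun i => (hb i (b i) (d i) (hbd i)).1
  choose g hg using fun i => (hb i (b i) (d i) (hbd i)).2
  -- the inverse of `b + d (z - 2)` on the component of `Y` is `b⁻¹ - c (z - 2)`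
  let c : ZMod 3 → O := fun i => d i * ↑(b' i)⁻¹ * ↑(g i)⁻¹
  have hbb : ∀ i, b i * (↑(b' i)⁻¹ : O) = 1 := fun i => by rw [← hb' i]; simp
  have hcc : ∀ i, c i * (b i + 2 * d i) = d i * ↑(b' i)⁻¹ := fun i => by
    rw [← hg i]; simp [c]
  let u : ZMod 3 → Oˣ := ![D⁻¹, 1, 1]
  let p : ZMod 3 → O := fun i => ↑(u i)⁻¹ * (↑(b' i)⁻¹ + 2 * c i)
  let q : ZMod 3 → O := fun i => - (↑(u i)⁻¹ * c i)
  have huu : ∀ i, (u i : O) * ↑(u i)⁻¹ = 1 := fun i => by simp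
  refine ⟨_, _, h.rescale u p q (fun i => u i * (b i - 2 * d i)) (fun i => u i * d i) ?_, ?_, ?_⟩
  · intro i
    have hz := h.zz_smul_Y i
    have e1 : ((u i * (b i - 2 * d i)) * p i - 8 * (u i * d i * q i)) • Y i = (1 : O) • Y i := by
      congr 1
      simp only [p, q]
      linear_combination ((b i - 2 * d i) * (↑(b' i)⁻¹ + 2 * c i) + 8 * d i * c i) * huu i +
        hbb i + 2 * hcc i
    have e2 : ((u i * (b i - 2 * d i)) * q i + u i * d i * p i + 6 * (u i * d i * q i)) • z i • Y i
        = (0 : O) • z i • Y i := by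
      congr 1
      simp only [p, q]
      linear_combination (-(b i - 2 * d i) * c i + d i * (↑(b' i)⁻¹ + 2 * c i) - 6 * d i * c i) *
        huu i - hcc i
    linear_combination (norm := (match_scalars <;> simp only [map_mul, map_add, map_sub, map_neg,
      map_ofNat, map_zero, map_one] <;> ring)) e1 + e2 + (u i * d i * q i) • hz
  · intro i
    have hz := h.zz_src i
    have hs : (z i * s) • e i = (4 * s) • e i := by rw [h.zs i]
    have e1 : ((u i * p i + 2 * (u i * q i)) * b i) • z i • e i = (1 : O) • z i • e i := by
      congr 1
      simp only [p, q]
      linear_combination (↑(b' i)⁻¹ * b i) * huu i + hbb i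
    have e2 : (u i * p i * d i + u i * q i * (b i + 4 * d i)) • s • e i = (0 : O) • s • e i := by
      congr 1
      simp only [p, q]
      linear_combination ((↑(b' i)⁻¹ + 2 * c i) * d i - c i * (b i + 4 * d i)) * huu i - hcc i
    have := hbd i
    simp only [mul_add, smul_mul_assoc, mul_smul_comm, this]
    linear_combination (norm := (match_scalars <;> simp only [map_mul, map_add, map_sub, map_neg,
      map_ofNat, map_zero, map_one] <;> ring)) e1 + e2 + (u i * q i * b i) • hz +
      (u i * q i * d i) • hs
  · have : (u 0 : O) • X 0 * (u 1 : O) • X 1 * (u 2 : O) • X 2 = (↑D⁻¹ : O) • (X 0 * X 1 * X 2) := by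
      simp [u]
    rw [this, hD, smul_smul, Units.inv_mul, one_smul]

end PeirceFrame

/-! ### The relations between normalised arrows -/

namespace PeirceFrame

variable {O C A : Type*} [CommRing O] [CommRing C] [Algebra O C] [Ring A]
  [Algebra O A] [Algebra C A] {e X Y : ZMod 3 → A} {z : ZMod 3 → C} {s : C}
  [IsScalarTower O C A] [IsDomain O] [CharZero O]

/-- If `X i * Y i` is normalised, so is the product in the other order: left multiplication by `X i`
determines the coefficients. -/
theorem YX_eq (h : PeirceFrame O C e X Y z s) (hXY : ∀ i, X i * Y i = z i • e i)
    {i j k : ZMod 3} (hc : Cyc i j k) : Y i * X i = z i • e j := by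
  obtain ⟨c, d, hP⟩ := h.exists_of_s_smul' hc.rot (m := Y i * X i)
    (by rw [← mul_assoc, h.eY i j k hc]) (by rw [mul_assoc, h.Xe i j k hc])
    (by rw [← smul_mul_assoc, h.s_smul_Y i, smul_mul_assoc])
  have h1 : z i • X i = c • z i • X i + d • s • X i := by
    have : X i * (Y i * X i) = z i • X i := by rw [← mul_assoc, hXY, smul_mul_assoc, h.eX]
    rw [hP] at this
    simp only [mul_add, mul_smul_comm, h.Xe i j k hc] at this
    exact this.symm
  obtain ⟨h2, h3⟩ := h.X_indep i (-8 * d) (c + 4 * d - 1) (by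
    linear_combination (norm := (match_scalars <;> simp only [map_mul, map_add, map_sub, map_neg,
      map_ofNat, map_zero, map_one] <;> ring)) - h1 - d • h.s_smul_X i)
  have hd : d = 0 := by simpa using h2
  subst hd
  have hc1 : c = 1 := by linear_combination h3
  rw [hP, hc1]; module

theorem XXX_rot (h : PeirceFrame O C e X Y z s) {i j k : ZMod 3} (hc : Cyc i j k)
    (hX : X i * X j * X k = s • e i) : X j * X k * X i = s • e j := by
  obtain ⟨d, hP⟩ := h.exists_XXX hc.rot
  have h1 : s • X i = d • s • X i := by
    have : X i * (X j * X k * X i) = s • X i := by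
      rw [← mul_assoc, ← mul_assoc, hX, smul_mul_assoc, h.eX]
    rw [hP] at this
    simp only [mul_smul_comm, h.Xe i j k hc] at this
    exact this.symm
  obtain ⟨-, h3⟩ := h.X_indep i (8 * (d - 1)) (-4 * (d - 1)) (by
    linear_combination (norm := (match_scalars <;> simp only [map_mul, map_add, map_sub, map_neg,
      map_ofNat, map_zero, map_one] <;> ring)) h1 + (d - 1) • h.s_smul_X i)
  have hd : d = 1 := by
    have : d - 1 = 0 := by simpa using h3
    linear_combination this
  rw [hP, hd, one_smul]

/-- Two consecutive arrows compose to `(z - 2)` times the arrow back that closes the triangle; the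
coefficients are found by completing the product to a closed path. -/
theorem XX_eq (h : PeirceFrame O C e X Y z s) (hXY : ∀ i, X i * Y i = z i • e i)
    {i j k : ZMod 3} (hc : Cyc i j k) (hX : X i * X j * X k = s • e i) :
    X i * X j = (z k - 2) • Y k := by
  obtain ⟨a, b, hP⟩ := h.exists_Y k i j hc.rot.rot (X i * X j) (by rw [← mul_assoc, h.eX])
    (by rw [mul_assoc, h.Xe j k i hc.rot])
  have h1 : s • e i = a • z k • e i + b • z k • z k • e i := by
    rw [← hX, hP]
    simp only [add_mul, smul_mul_assoc, h.YX_eq hXY hc.rot.rot]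
  obtain ⟨-, -, h2, h3⟩ := h.diag_indep i j k hc 0 0 (a + 2 * b) (b - 1) (by
    linear_combination (norm := (match_scalars <;> simp only [map_mul, map_add, map_sub, map_neg,
      map_ofNat, map_zero, map_one] <;> ring)) - h1 - b • h.zz_tgt k i j hc.rot.rot)
  have hb : b = 1 := by linear_combination h3
  have ha : a = -2 := by linear_combination h2 - 2 * h3
  rw [hP, ha, hb]
  match_scalars <;> simp only [map_neg, map_ofNat, map_one] <;> ring

theorem YY_eq (h : PeirceFrame O C e X Y z s) (hXY : ∀ i, X i * Y i = z i • e i)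
    {i j k : ZMod 3} (hc : Cyc i j k) (hX : X i * X j * X k = s • e i) :
    Y j * Y i = (z k - 2) • X k := by
  obtain ⟨a, b, hP⟩ := h.exists_X k i j hc.rot.rot (Y j * Y i)
    (by rw [← mul_assoc, h.eY j k i hc.rot]) (by rw [mul_assoc, h.Ye])
  -- both `X k` and `Y j` determine the action of `s` on the product
  have h1 : s • (Y j * Y i) = (4 * (z j - 2)) • (Y j * Y i) := by
    rw [← smul_mul_assoc, h.s_smul_Y j, smul_mul_assoc]
  have h2 : s • (Y j * Y i) = (4 * (z k - 2)) • (Y j * Y i) :=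
    h.s_smul k i j hc.rot.rot _ (by rw [← mul_assoc, h.eY j k i hc.rot]) (by rw [mul_assoc, h.Ye])
  have h3 : z j • (Y j * Y i) = (2 * (z k - 2)) • (Y j * Y i) :=
    h.z_smul_of_s_smul hc.ne.2.1.symm h2
  have h4 : z k • (Y j * Y i) = (4 : C) • (Y j * Y i) := by
    apply h.four_cancel
    linear_combination (norm := module) h2 - h1 - (4 : C) • h3
  obtain ⟨h5, -⟩ := h.X_indep k (-4 * a - 8 * b) (a + 2 * b) (by
    rw [hP] at h4
    linear_combination (norm := (match_scalars <;> simp only [map_mul, map_add, map_sub, map_neg,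
      map_ofNat, map_zero, map_one] <;> ring)) h4 - b • h.zz_smul_X k)
  have ha : a = -2 * b := by
    have : (4 : O) * (a + 2 * b) = 0 := by linear_combination -h5
    have := (mul_eq_zero.1 this).resolve_left (by norm_num)
    linear_combination this
  have h6 : (X i * X j) * (Y j * Y i) = (2 * s) • e i := by
    rw [show (X i * X j) * (Y j * Y i) = X i * (X j * Y j) * Y i by simp only [mul_assoc], hXY,
      mul_smul_comm, h.Xe i j k hc, smul_mul_assoc, hXY, smul_smul, h.zz j i hc.ne.1.symm]
  rw [h.XX_eq hXY hc hX, hP] at h6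
  simp only [mul_add, smul_mul_assoc, mul_smul_comm, h.YX_eq hXY hc.rot.rot] at h6
  have hs : (z k * s) • e i = (4 * s) • e i := by rw [h.zs]
  obtain ⟨-, -, -, h7⟩ := h.diag_indep i j k hc 0 0 0 (a + 4 * b - 2) (by
    linear_combination (norm := (match_scalars <;> simp only [map_mul, map_add, map_sub, map_neg,
      map_ofNat, map_zero, map_one] <;> ring)) h6 - b • hs -
      a • h.zz_tgt k i j hc.rot.rot - b • z k • h.zz_tgt k i j hc.rot.rot)
  have hb : b = 1 := by
    have : (2 : O) * (b - 1) = 0 := by linear_combination h7 - ha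
    have := (mul_eq_zero.1 this).resolve_left (by norm_num)
    linear_combination this
  rw [hP, ha, hb]
  match_scalars <;> simp only [map_mul, map_neg, map_ofNat, map_one] <;> ring

/-- A normalized frame satisfies the quiver relations. -/
theorem quiverRelations (h : PeirceFrame O C e X Y z s) (hXY : ∀ i, X i * Y i = z i • e i)
    (hXXX : X 0 * X 1 * X 2 = s • e 0) : QuiverRelations e X Y := by
  have hX : ∀ i j k, Cyc i j k → X i * X j * X k = s • e i := by
    have c0 : Cyc 0 1 2 := by unfold Cyc; decide
    have h1 := h.XXX_rot c0 hXXX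
    have h2 := h.XXX_rot c0.rot h1
    rintro i j k ⟨rfl, rfl⟩
    fin_cases i
    · exact hXXX
    · exact h1
    · exact h2
  have hYX := fun i j k (hc : Cyc i j k) => h.YX_eq hXY hc
  have n2 : ∀ x : A, 2 * x = (2 : C) • x := fun x => by rw [Algebra.smul_def, map_ofNat]
  have n4 : ∀ x : A, 4 * x = (4 : C) • x := fun x => by rw [Algebra.smul_def, map_ofNat]
  have n8 : ∀ x : A, 8 * x = (8 : C) • x := fun x => by rw [Algebra.smul_def, map_ofNat]
  have XYX : ∀ i, X i * Y i * X i = z i • X i := fun i => by rw [hXY, smul_mul_assoc, h.eX]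
  have YXY : ∀ i, Y i * X i * Y i = z i • Y i := fun i => by
    rw [mul_assoc, hXY, mul_smul_comm, h.Ye]
  have zX : ∀ i j, i ≠ j → z j • X i = (2 * (z i - 2)) • X i := fun i j hij =>
    h.z_smul_of_s_smul hij (h.s_smul_X i)
  have zY : ∀ i j, i ≠ j → z j • Y i = (2 * (z i - 2)) • Y i := fun i j hij =>
    h.z_smul_of_s_smul hij (h.s_smul_Y i)
  refine ⟨h.idem, h.orth, h.sum_eq_one, h.eX, h.Xe, h.eY, h.Ye, ?_, ?_, ?_, ?_, ?_, ?_, ?_⟩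
  · intro i j k hc
    rw [h.XX_eq hXY hc (hX i j k hc), YXY, neg_mul, n2]; module
  · intro i j k hc
    rw [h.YY_eq hXY hc (hX i j k hc), XYX, neg_mul, n2]; module
  · intro i j k hc
    rw [hYX i j k hc, smul_mul_assoc, h.eX, XYX, zX j i hc.ne.1.symm, neg_mul, n2, n4]; module
  · intro i j k hc
    rw [hXY, smul_mul_assoc, h.eY i j k hc, YXY, zY i j hc.ne.1, neg_mul, n2, n4]; module
  · intro i j k hc
    rw [mul_assoc, hYX i j k hc, mul_smul_comm, h.Ye, YXY, zY j i hc.ne.1.symm, neg_mul, n2, n4]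
    module
  · intro i j k hc
    rw [mul_assoc, hXY, mul_smul_comm, h.Xe i j k hc, XYX, zX i j hc.ne.1, neg_mul, n2, n4]; module
  · intro i j k hc
    rw [hX i j k hc, smul_mul_assoc, h.eX, XYX, h.s_smul_X, neg_mul, n8, n4]; module

/-- The idempotents and arrows of a normalized frame generate the algebra. -/
theorem adjoin_eq_top (h : PeirceFrame O C e X Y z s) (hXY : ∀ i, X i * Y i = z i • e i)
    (hXXX : X 0 * X 1 * X 2 = s • e 0) :
    Algebra.adjoin O (Set.range e ∪ Set.range X ∪ Set.range Y) = ⊤ := by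
  have hX : ∀ i j k, Cyc i j k → X i * X j * X k = s • e i := by
    have c0 : Cyc 0 1 2 := by unfold Cyc; decide
    have h1 := h.XXX_rot c0 hXXX
    have h2 := h.XXX_rot c0.rot h1
    rintro i j k ⟨rfl, rfl⟩
    fin_cases i
    · exact hXXX
    · exact h1
    · exact h2
  set S := Algebra.adjoin O (Set.range e ∪ Set.range X ∪ Set.range Y) with hS
  have m_e : ∀ i, e i ∈ S := fun i => Algebra.subset_adjoin (Or.inl (Or.inl ⟨i, rfl⟩))
  have m_X : ∀ i, X i ∈ S := fun i => Algebra.subset_adjoin (Or.inl (Or.inr ⟨i, rfl⟩))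
  have m_Y : ∀ i, Y i ∈ S := fun i => Algebra.subset_adjoin (Or.inr ⟨i, rfl⟩)
  have m_ze : ∀ i, z i • e i ∈ S := fun i => by rw [← hXY]; exact S.mul_mem (m_X i) (m_Y i)
  have diag : ∀ i, ∀ m, e i * m * e i ∈ S := fun i m => by
    obtain ⟨j, k, hc⟩ := exists_cyc i
    obtain ⟨a, b, c, d, hm⟩ := h.exists_diag i j k hc (e i * m * e i)
      (by rw [← mul_assoc, ← mul_assoc, h.idem]) (by rw [mul_assoc, h.idem])
    rw [hm]
    refine S.add_mem (S.add_mem (S.add_mem (S.smul_mem (m_e i) a) (S.smul_mem (m_ze i) b))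
      (S.smul_mem ?_ c)) (S.smul_mem ?_ d)
    · rw [← h.YX_eq hXY hc.rot.rot]; exact S.mul_mem (m_Y k) (m_X k)
    · rw [← hX i j k hc]; exact S.mul_mem (S.mul_mem (m_X i) (m_X j)) (m_X k)
  have up : ∀ i j k, Cyc i j k → ∀ m, e i * m * e j ∈ S := fun i j k hc m => by
    obtain ⟨a, b, hm⟩ := h.exists_X i j k hc (e i * m * e j)
      (by rw [← mul_assoc, ← mul_assoc, h.idem]) (by rw [mul_assoc, h.idem])
    rw [hm, show z i • X i = (z i • e i) * X i by rw [smul_mul_assoc, h.eX]]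
    exact S.add_mem (S.smul_mem (m_X i) a) (S.smul_mem (S.mul_mem (m_ze i) (m_X i)) b)
  have down : ∀ i j k, Cyc i j k → ∀ m, e j * m * e i ∈ S := fun i j k hc m => by
    obtain ⟨a, b, hm⟩ := h.exists_Y i j k hc (e j * m * e i)
      (by rw [← mul_assoc, ← mul_assoc, h.idem]) (by rw [mul_assoc, h.idem])
    rw [hm, show z i • Y i = Y i * (z i • e i) by rw [mul_smul_comm, h.Ye]]
    exact S.add_mem (S.smul_mem (m_Y i) a) (S.smul_mem (S.mul_mem (m_Y i) (m_ze i)) b)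
  have c0 : Cyc 0 1 2 := by unfold Cyc; decide
  rw [eq_top_iff]
  intro m _
  have : m = (e 0 + e 1 + e 2) * m * (e 0 + e 1 + e 2) := by rw [h.sum_eq_one, one_mul, mul_one]
  rw [this]
  simp only [add_mul, mul_add]
  refine S.add_mem (S.add_mem (S.add_mem (S.add_mem ?_ ?_) ?_) (S.add_mem (S.add_mem ?_ ?_) ?_))
    (S.add_mem (S.add_mem ?_ ?_) ?_)
  exacts [diag 0 m, down 0 1 2 c0 m, up 2 0 1 c0.rot.rot m, up 0 1 2 c0 m, diag 1 m,
    down 1 2 0 c0.rot m, down 2 0 1 c0.rot.rot m, up 1 2 0 c0.rot m, diag 2 m]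

end PeirceFrame

namespace PresAlgebra

open Gen

/-- The homomorphism from `PresAlgebra` given by elements satisfying the quiver relations. -/
noncomputable def lift {O A : Type*} [CommRing O] [Ring A] [Algebra O A] {e X Y : ZMod 3 → A}
    (h : QuiverRelations e X Y) : PresAlgebra O →ₐ[O] A :=
  RingQuot.liftAlgHom O ⟨FreeAlgebra.lift O fun g => match g with
    | e0 => e 0 | e1 => e 1 | e2 => e 2 | β => X 0 | δ => X 1 | lam => X 2
    | γ => Y 0 | η => Y 1 | κ => Y 2, by
    have c : Cyc 0 1 2 := by unfold Cyc; decide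
    intro x y hxy
    cases hxy <;>
      simp only [gen, map_mul, map_add, map_smul, map_zero, map_one, FreeAlgebra.lift_ι_apply,
        Algebra.smul_def, map_neg, map_ofNat]
    case idem0 => exact h.idem 0
    case idem1 => exact h.idem 1
    case idem2 => exact h.idem 2
    case orth01 => exact h.orth 0 1 (by decide)
    case orth02 => exact h.orth 0 2 (by decide)
    case orth10 => exact h.orth 1 0 (by decide)
    case orth12 => exact h.orth 1 2 (by decide)
    case orth20 => exact h.orth 2 0 (by decide)
    case orth21 => exact h.orth 2 1 (by decide)
    case sum_eq_one => exact h.sum_eq_one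
    case β_left => exact (h.eX 0).symm
    case δ_left => exact (h.eX 1).symm
    case lam_left => exact (h.eX 2).symm
    case β_right => exact (h.Xe 0 1 2 c).symm
    case δ_right => exact (h.Xe 1 2 0 c.rot).symm
    case lam_right => exact (h.Xe 2 0 1 c.rot.rot).symm
    case γ_left => exact (h.eY 0 1 2 c).symm
    case η_left => exact (h.eY 1 2 0 c.rot).symm
    case κ_left => exact (h.eY 2 0 1 c.rot.rot).symm
    case γ_right => exact (h.Ye 0).symm
    case η_right => exact (h.Ye 1).symm
    case κ_right => exact (h.Ye 2).symm
    case βδ => exact h.XX 0 1 2 c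
    case δlam => exact h.XX 1 2 0 c.rot
    case lamβ => exact h.XX 2 0 1 c.rot.rot
    case ηγ => exact h.YY 0 1 2 c
    case κη => exact h.YY 1 2 0 c.rot
    case γκ => exact h.YY 2 0 1 c.rot.rot
    case γβδ => exact h.YXX 0 1 2 c
    case ηδlam => exact h.YXX 1 2 0 c.rot
    case κlamβ => exact h.YXX 2 0 1 c.rot.rot
    case δηγ => exact h.XYY 0 1 2 c
    case lamκη => exact h.XYY 1 2 0 c.rot
    case βγκ => exact h.XYY 2 0 1 c.rot.rot
    case ηγβ => exact h.YYX 0 1 2 c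
    case κηδ => exact h.YYX 1 2 0 c.rot
    case γκlam => exact h.YYX 2 0 1 c.rot.rot
    case βδη => exact h.XXY 0 1 2 c
    case δlamκ => exact h.XXY 1 2 0 c.rot
    case lamβγ => exact h.XXY 2 0 1 c.rot.rot
    case βδlamβ => exact h.XXXX 0 1 2 c
    case δlamβδ => exact h.XXXX 1 2 0 c.rot
    case lamβδlam => exact h.XXXX 2 0 1 c.rot.rot⟩

theorem lift_of {O A : Type*} [CommRing O] [Ring A] [Algebra O A] {e X Y : ZMod 3 → A}
    (h : QuiverRelations e X Y) (g : Gen) : lift (O := O) h (of O g) = match g with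
    | e0 => e 0 | e1 => e 1 | e2 => e 2 | β => X 0 | δ => X 1 | lam => X 2
    | γ => Y 0 | η => Y 1 | κ => Y 2 := by
  simp only [lift, of, gen, RingQuot.liftAlgHom_mkAlgHom_apply, FreeAlgebra.lift_ι_apply]

/-- An algebra that is free of rank `24` and generated by elements satisfying the quiver relations
is isomorphic to `PresAlgebra`. -/
theorem nonempty_algEquiv {O A : Type*} [CommRing O] [Nontrivial O] [Ring A] [Algebra O A]
    {e X Y : ZMod 3 → A} (h : QuiverRelations e X Y) {t : O} (ht : 3 * t = 1)
    (hgen : Algebra.adjoin O (Set.range e ∪ Set.range X ∪ Set.range Y) = ⊤)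
    {ι : Type*} (b : Module.Basis ι O A) (hι : Nat.card ι = 24) :
    Nonempty (A ≃ₐ[O] PresAlgebra O) := by
  have hfin : Finite ι := Nat.finite_of_card_ne_zero (by omega)
  have surj : Function.Surjective (lift (O := O) h) := by
    rw [← AlgHom.range_eq_top, eq_top_iff, ← hgen, Algebra.adjoin_le_iff]
    rintro _ ((⟨i, rfl⟩ | ⟨i, rfl⟩) | ⟨i, rfl⟩)
    · refine ⟨of O (vertex i), (lift_of h _).trans ?_⟩
      fin_cases i <;> rfl
    · refine ⟨of O (arrow i), (lift_of h _).trans ?_⟩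
      fin_cases i <;> rfl
    · refine ⟨of O (opArrow i), (lift_of h _).trans ?_⟩
      fin_cases i <;> rfl
  have hspan := (quiverRelations O).span_word_eq_top ht (adjoin_eq_top O)
  set w := fun p : ZMod 3 × Fin 8 => QuiverRelations.word (of O ∘ vertex) (of O ∘ arrow)
    (of O ∘ opArrow) p.1 p.2 with hw
  let T : (ZMod 3 × Fin 8 → O) →ₗ[O] PresAlgebra O := Fintype.linearCombination O w
  have hT : Function.Surjective T := by
    rw [← LinearMap.range_eq_top, Fintype.range_linearCombination, hspan]
  have eqv : ι ≃ ZMod 3 × Fin 8 := by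
    have := Fintype.ofFinite ι
    apply Fintype.equivOfCardEq
    rw [← Nat.card_eq_fintype_card, hι]; rfl
  let b' := b.reindex eqv
  -- a surjective endomorphism of a finitely generated module is injective
  have hinj : Function.Injective (b'.equivFun.toLinearMap ∘ₗ (lift (O := O) h).toLinearMap ∘ₗ T) := by
    apply OrzechProperty.injective_of_surjective_endomorphism
    exact b'.equivFun.surjective.comp (surj.comp hT)
  have inj : Function.Injective (lift (O := O) h) := by
    intro x y hxy
    obtain ⟨x, rfl⟩ := hT x
    obtain ⟨y, rfl⟩ := hT y
    congr 1
    apply hinj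
    simp only [LinearMap.comp_apply, AlgHom.toLinearMap_apply, hxy]
  exact ⟨(AlgEquiv.ofBijective _ ⟨inj, surj⟩).symm⟩

end PresAlgebra

/-! ### The quaternion group algebra and its automorphism of order three -/

/-- Elements `I, J, K, Z, C` of a ring that multiply like the elements `i, j, k, -1` of `Q₈` and
the generator of `C₃` in `Ã₄`. -/
structure TetraRelations {B : Type*} [Ring B] (I J K Z C : B) : Prop where
  II : I * I = Z
  JJ : J * J = Z
  KK : K * K = Z
  IJ : I * J = K
  JK : J * K = I
  KI : K * I = J
  JI : J * I = Z * K
  KJ : K * J = Z * I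
  IK : I * K = Z * J
  IZ : I * Z = Z * I
  JZ : J * Z = Z * J
  KZ : K * Z = Z * K
  CZ : C * Z = Z * C
  ZZ : Z * Z = 1
  CI : C * I = J * C
  CJ : C * J = K * C
  CK : C * K = I * C
  CCC : C * (C * C) = 1

namespace TetraRelations

variable {R B : Type*} [CommRing R] [Ring B] [Algebra R B] {I J K Z C : B}

theorem ZZ_assoc (h : TetraRelations I J K Z C) (x : B) : Z * (Z * x) = x := by
  rw [← mul_assoc, h.ZZ, one_mul]

theorem IZ_assoc (h : TetraRelations I J K Z C) (x : B) : I * (Z * x) = Z * (I * x) := by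
  rw [← mul_assoc, h.IZ, mul_assoc]

theorem JZ_assoc (h : TetraRelations I J K Z C) (x : B) : J * (Z * x) = Z * (J * x) := by
  rw [← mul_assoc, h.JZ, mul_assoc]

theorem KZ_assoc (h : TetraRelations I J K Z C) (x : B) : K * (Z * x) = Z * (K * x) := by
  rw [← mul_assoc, h.KZ, mul_assoc]

variable (I J K) in
/-- The eigenvector `i + ω j + ω² k` of the automorphism of order three. -/
def eigX (ω : R) : B := I + ω • J + ω ^ 2 • K

variable (I J K) in
/-- The eigenvector `i + ω² j + ω k` of the automorphism of order three. -/
def eigY (ω : R) : B := I + ω ^ 2 • J + ω • K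

theorem eigX_mul_eigX (h : TetraRelations I J K Z C) {ω : R} (hω : ω ^ 2 + ω + 1 = 0) :
    eigX I J K ω * eigX I J K ω = (1 + Z) * eigY I J K ω := by
  simp only [eigX, eigY, mul_add, add_mul, smul_mul_assoc, mul_smul_comm, h.II, h.JJ, h.KK, h.IJ,
    h.JK, h.KI, h.JI, h.KJ, h.IK, one_mul]
  match_scalars <;> grind

theorem eigY_mul_eigY (h : TetraRelations I J K Z C) {ω : R} (hω : ω ^ 2 + ω + 1 = 0) :
    eigY I J K ω * eigY I J K ω = (1 + Z) * eigX I J K ω := by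
  simp only [eigX, eigY, mul_add, add_mul, smul_mul_assoc, mul_smul_comm, h.II, h.JJ, h.KK, h.IJ,
    h.JK, h.KI, h.JI, h.KJ, h.IK, one_mul]
  match_scalars <;> grind

theorem eigX_mul_eigY (h : TetraRelations I J K Z C) {ω : R} (hω : ω ^ 2 + ω + 1 = 0) :
    eigX I J K ω * eigY I J K ω = (3 : R) • Z + ω ^ 2 • (I + J + K) + ω • (Z * (I + J + K)) := by
  simp only [eigX, eigY, mul_add, add_mul, smul_mul_assoc, mul_smul_comm, h.II, h.JJ, h.KK, h.IJ,
    h.JK, h.KI, h.JI, h.KJ, h.IK, one_mul]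
  match_scalars <;> grind

theorem eigY_mul_eigX (h : TetraRelations I J K Z C) {ω : R} (hω : ω ^ 2 + ω + 1 = 0) :
    eigY I J K ω * eigX I J K ω = (3 : R) • Z + ω • (I + J + K) + ω ^ 2 • (Z * (I + J + K)) := by
  simp only [eigX, eigY, mul_add, add_mul, smul_mul_assoc, mul_smul_comm, h.II, h.JJ, h.KK, h.IJ,
    h.JK, h.KI, h.JI, h.KJ, h.IK, one_mul]
  match_scalars <;> grind

theorem eigX_eigY_eigX (h : TetraRelations I J K Z C) {ω : R} (hω : ω ^ 2 + ω + 1 = 0) :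
    eigX I J K ω * eigY I J K ω * eigX I J K ω = (5 * Z - 1) * eigX I J K ω := by
  rw [h.eigX_mul_eigY hω]
  simp only [eigX, mul_add, add_mul, sub_mul, smul_mul_assoc, mul_smul_comm, h.II, h.JJ, h.KK, h.IJ,
    h.JK, h.KI, h.JI, h.KJ, h.IK, one_mul, mul_assoc, h.ZZ, h.ZZ_assoc, mul_one,
    show (5 : B) = (5 : R) • 1 by rw [Algebra.smul_def, map_ofNat, mul_one]]
  match_scalars <;> grind

theorem eigY_eigX_eigY (h : TetraRelations I J K Z C) {ω : R} (hω : ω ^ 2 + ω + 1 = 0) :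
    eigY I J K ω * eigX I J K ω * eigY I J K ω = (5 * Z - 1) * eigY I J K ω := by
  rw [h.eigY_mul_eigX hω]
  simp only [eigY, mul_add, add_mul, sub_mul, smul_mul_assoc, mul_smul_comm, h.II, h.JJ, h.KK, h.IJ,
    h.JK, h.KI, h.JI, h.KJ, h.IK, one_mul, mul_assoc, h.ZZ, h.ZZ_assoc, mul_one,
    show (5 : B) = (5 : R) • 1 by rw [Algebra.smul_def, map_ofNat, mul_one]]
  match_scalars <;> grind

theorem C_mul_eigX (h : TetraRelations I J K Z C) {ω : R} (hω : ω ^ 2 + ω + 1 = 0) :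
    C * eigX I J K ω = ω ^ 2 • (eigX I J K ω * C) := by
  simp only [eigX, mul_add, add_mul, smul_mul_assoc, mul_smul_comm, h.CI, h.CJ, h.CK]
  match_scalars <;> grind

theorem C_mul_eigY (h : TetraRelations I J K Z C) {ω : R} (hω : ω ^ 2 + ω + 1 = 0) :
    C * eigY I J K ω = ω • (eigY I J K ω * C) := by
  simp only [eigY, mul_add, add_mul, smul_mul_assoc, mul_smul_comm, h.CI, h.CJ, h.CK]
  match_scalars <;> grind

theorem Z_mul_eigX (h : TetraRelations I J K Z C) (ω : R) :
    eigX I J K ω * Z = Z * eigX I J K ω := by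
  simp only [eigX, mul_add, add_mul, smul_mul_assoc, mul_smul_comm, h.IZ, h.JZ, h.KZ]

theorem Z_mul_eigY (h : TetraRelations I J K Z C) (ω : R) :
    eigY I J K ω * Z = Z * eigY I J K ω := by
  simp only [eigY, mul_add, add_mul, smul_mul_assoc, mul_smul_comm, h.IZ, h.JZ, h.KZ]

end TetraRelations

/-! ### Idempotents of a cyclic group of order three -/

/-- The idempotent `(1 + ω⁻ⁱ c + ω⁻²ⁱ c²) / 3` on which an element `c` with `c³ = 1` acts as
`ωⁱ`; here `t` is the inverse of `3` and `ω` a primitive third root of unity. -/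
def idemC {R B : Type*} [CommRing R] [Ring B] [Algebra R B] (ω t : R) (c : B) (i : ZMod 3) : B :=
  t • (1 + ω ^ (2 * i.val) • c + ω ^ i.val • (c * c))

section idemC

variable {R B : Type*} [CommRing R] [Ring B] [Algebra R B] {ω t : R} {c : B}

theorem idemC_zero : idemC ω t c 0 = t • (1 + c + c * c) := by
  simp [idemC]

theorem idemC_one : idemC ω t c 1 = t • (1 + ω ^ 2 • c + ω • (c * c)) := by
  simp [idemC, show (1 : ZMod 3).val = 1 from rfl]

theorem idemC_two (hω : ω ^ 2 + ω + 1 = 0) :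
    idemC ω t c 2 = t • (1 + ω • c + ω ^ 2 • (c * c)) := by
  have : ω ^ 4 = ω := by grind
  simp [idemC, show (2 : ZMod 3).val = 2 from rfl, this]

theorem idemC_sum (hω : ω ^ 2 + ω + 1 = 0) (ht : 3 * t = 1) :
    idemC ω t c 0 + idemC ω t c 1 + idemC ω t c 2 = 1 := by
  rw [idemC_zero, idemC_one, idemC_two hω]
  match_scalars <;> grind

theorem mul_idemC (hω : ω ^ 2 + ω + 1 = 0) (hc : c * (c * c) = 1) (i : ZMod 3) :
    c * idemC ω t c i = ω ^ i.val • idemC ω t c i := by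
  have h3 : ω ^ 3 = 1 := by grind
  fin_cases i
  · change c * idemC ω t c 0 = ω ^ 0 • idemC ω t c 0
    rw [idemC_zero]
    simp only [mul_smul_comm, mul_add, hc, mul_one]; match_scalars <;> grind
  · change c * idemC ω t c 1 = ω ^ 1 • idemC ω t c 1
    rw [idemC_one]
    simp only [mul_smul_comm, mul_add, hc, mul_one]; match_scalars <;> grind
  · change c * idemC ω t c 2 = ω ^ 2 • idemC ω t c 2
    rw [idemC_two hω]
    simp only [mul_smul_comm, mul_add, hc, mul_one]; match_scalars <;> grind

theorem idemC_mul_of_mul (hω : ω ^ 2 + ω + 1 = 0) (ht : 3 * t = 1) {x : B} {i : ZMod 3}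
    (hx : c * x = ω ^ i.val • x) (j : ZMod 3) :
    idemC ω t c j * x = if j = i then x else 0 := by
  have h3 : ω ^ 3 = 1 := by grind
  have v0 : (0 : ZMod 3).val = 0 := rfl
  have v1 : (1 : ZMod 3).val = 1 := rfl
  have v2 : (2 : ZMod 3).val = 2 := rfl
  have cases3 : ∀ l : ZMod 3, l = 0 ∨ l = 1 ∨ l = 2 := by decide
  simp only [idemC, smul_mul_assoc, mul_smul_comm, add_mul, one_mul, mul_assoc, hx]
  rcases cases3 i with rfl | rfl | rfl <;> rcases cases3 j with rfl | rfl | rfl <;>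
    first
    | rw [if_neg (by decide)]; simp only [v0, v1, v2]; match_scalars <;> grind
    | rw [if_pos rfl]; simp only [v0, v1, v2]; match_scalars <;> grind

theorem idemC_mul_idemC (hω : ω ^ 2 + ω + 1 = 0) (ht : 3 * t = 1) (hc : c * (c * c) = 1)
    (i j : ZMod 3) : idemC ω t c j * idemC ω t c i = if j = i then idemC ω t c i else 0 :=
  idemC_mul_of_mul hω ht (mul_idemC hω hc i) j

end idemC

/-! ### The algebra of `Ã₄` in characteristic two -/

/-- Paths spanning the algebra of `Ã₄`, eight for each vertex `i`. -/
def pathWord {P : Type*} [Ring P] (e X Y : ZMod 3 → P) (i : ZMod 3) : Fin 8 → P :=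
  ![e i, X i, Y i, X i * Y i, Y i * X i, X i * Y i * X i, Y i * X i * Y i, X i * Y i * X i * Y i]

/-- Orthogonal idempotents and arrows in an algebra over a ring of characteristic two that satisfy
the relations of the group algebra of `Ã₄`. -/
structure ResidueFrame (k : Type*) {B : Type*} [CommRing k] [Ring B] [Algebra k B]
    (e X Y : ZMod 3 → B) : Prop where
  idem : ∀ i, e i * e i = e i
  orth : ∀ i j, i ≠ j → e i * e j = 0
  eX : ∀ i, e i * X i = X i
  Xe : ∀ i j k, Cyc i j k → X i * e j = X i
  eY : ∀ i j k, Cyc i j k → e j * Y i = Y i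
  Ye : ∀ i, Y i * e i = Y i
  XXX : ∀ i j k, Cyc i j k → X i * X j * X k = X i * Y i * X i * Y i
  YXX : ∀ i j k, Cyc i j k → Y i * X i * X j = 0
  XXY : ∀ i j k, Cyc i j k → X i * X j * Y j = 0
  YYX : ∀ i j k, Cyc i j k → Y j * Y i * X i = 0
  XYY : ∀ i j k, Cyc i j k → X j * Y j * Y i = 0
  XYXYX : ∀ i, X i * Y i * X i * Y i * X i = 0
  YXYXY : ∀ i, Y i * X i * Y i * X i * Y i = 0
  top_le_span : ⊤ ≤ Submodule.span k (Set.range fun p : ZMod 3 × Fin 8 => pathWord e X Y p.1 p.2)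

namespace ResidueFrame

variable {k B : Type*} [CommRing k] [Ring B] [Algebra k B] {e X Y : ZMod 3 → B}

/-- An element commuting with the idempotents and the arrows is central. -/
theorem mem_center (h : ResidueFrame k e X Y) {x : B} (he : ∀ i, x * e i = e i * x)
    (hX : ∀ i, x * X i = X i * x) (hY : ∀ i, x * Y i = Y i * x) : x ∈ Subalgebra.center k B := by
  rw [Subalgebra.mem_center_iff]
  intro b
  have mem : ∀ p : ZMod 3 × Fin 8, pathWord e X Y p.1 p.2 ∈ Subalgebra.centralizer k {x} := by
    have m_e : ∀ i, e i ∈ Subalgebra.centralizer k {x} := fun i => by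
      rw [Subalgebra.mem_centralizer_iff]; rintro _ rfl; exact he i
    have m_X : ∀ i, X i ∈ Subalgebra.centralizer k {x} := fun i => by
      rw [Subalgebra.mem_centralizer_iff]; rintro _ rfl; exact hX i
    have m_Y : ∀ i, Y i ∈ Subalgebra.centralizer k {x} := fun i => by
      rw [Subalgebra.mem_centralizer_iff]; rintro _ rfl; exact hY i
    rintro ⟨i, n⟩
    fin_cases n
    · exact m_e i
    · exact m_X i
    · exact m_Y i
    · exact mul_mem (m_X i) (m_Y i)
    · exact mul_mem (m_Y i) (m_X i)
    · exact mul_mem (mul_mem (m_X i) (m_Y i)) (m_X i)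
    · exact mul_mem (mul_mem (m_Y i) (m_X i)) (m_Y i)
    · exact mul_mem (mul_mem (mul_mem (m_X i) (m_Y i)) (m_X i)) (m_Y i)
  have hb : b ∈ Submodule.span k (Set.range fun p : ZMod 3 × Fin 8 => pathWord e X Y p.1 p.2) :=
    h.top_le_span trivial
  have : b ∈ Subalgebra.toSubmodule (Subalgebra.centralizer k {x}) :=
    Submodule.span_le.2 (by rintro _ ⟨p, rfl⟩; exact mem p) hb
  rw [Subalgebra.mem_toSubmodule, Subalgebra.mem_centralizer_iff] at this
  exact (this x rfl).symm

theorem mul_eq_zero_of_ne (h : ResidueFrame k e X Y) {i j : ZMod 3} (hij : i ≠ j) {a b : B}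
    (ha : a * e i = a) (hb : e j * b = b) : a * b = 0 := by
  rw [← ha, ← hb, mul_assoc, ← mul_assoc (e i), h.orth i j hij, zero_mul, mul_zero]

/-- The sum of the two-cycles along an edge of the quiver is central. -/
theorem cycle_mem_center (h : ResidueFrame k e X Y) (i : ZMod 3) :
    X i * Y i + Y i * X i ∈ Subalgebra.center k B := by
  obtain ⟨j, l, hc⟩ := exists_cyc i
  have eXY : e i * (X i * Y i) = X i * Y i := by rw [← mul_assoc, h.eX]
  have XYe : (X i * Y i) * e i = X i * Y i := by rw [mul_assoc, h.Ye]
  have eYX : e j * (Y i * X i) = Y i * X i := by rw [← mul_assoc, h.eY i j l hc]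
  have YXe : (Y i * X i) * e j = Y i * X i := by rw [mul_assoc, h.Xe i j l hc]
  obtain ⟨n1, n2, n3⟩ := hc.ne
  have cl := hc.rot.rot
  have cj := hc.rot
  apply h.mem_center
  · intro m
    rcases hc.cases m with rfl | rfl | rfl
    · rw [add_mul, mul_add, XYe, eXY, h.mul_eq_zero_of_ne n1.symm YXe (h.idem m),
        h.mul_eq_zero_of_ne n1 (h.idem m) eYX]
    · rw [add_mul, mul_add, YXe, eYX, h.mul_eq_zero_of_ne n1 XYe (h.idem m),
        h.mul_eq_zero_of_ne n1.symm (h.idem m) eXY]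
    · rw [add_mul, mul_add, h.mul_eq_zero_of_ne n3.symm XYe (h.idem m),
        h.mul_eq_zero_of_ne n3 (h.idem m) eXY, h.mul_eq_zero_of_ne n2 YXe (h.idem m),
        h.mul_eq_zero_of_ne n2.symm (h.idem m) eYX]
  · intro m
    rcases hc.cases m with rfl | rfl | rfl
    · rw [add_mul, mul_add, h.mul_eq_zero_of_ne n1.symm YXe (h.eX m),
        h.mul_eq_zero_of_ne n1.symm (h.Xe m j l hc) eXY, add_zero, zero_add, mul_assoc]
    · rw [add_mul, mul_add, h.mul_eq_zero_of_ne n1 XYe (h.eX m), h.YXX _ _ _ hc,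
        h.mul_eq_zero_of_ne n3 (h.Xe _ _ _ cj) eXY,
        h.mul_eq_zero_of_ne n2.symm (h.Xe _ _ _ cj) eYX]
    · rw [add_mul, mul_add, h.mul_eq_zero_of_ne n3.symm XYe (h.eX m),
        h.mul_eq_zero_of_ne n2 YXe (h.eX m), ← mul_assoc, h.XXY _ _ _ cl,
        h.mul_eq_zero_of_ne n1 (h.Xe _ _ _ cl) eYX]
  · intro m
    rcases hc.cases m with rfl | rfl | rfl
    · rw [add_mul, mul_add, h.mul_eq_zero_of_ne n1 XYe (h.eY _ _ _ hc),
        h.mul_eq_zero_of_ne n1 (h.Ye m) eYX, zero_add, add_zero, mul_assoc]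
    · rw [add_mul, mul_add, h.mul_eq_zero_of_ne n3.symm XYe (h.eY _ _ _ cj),
        h.mul_eq_zero_of_ne n2 YXe (h.eY _ _ _ cj), h.mul_eq_zero_of_ne n1.symm (h.Ye _) eXY,
        ← mul_assoc, h.YYX _ _ _ hc]
    · rw [add_mul, mul_add, h.XYY _ _ _ cl, h.mul_eq_zero_of_ne n1.symm YXe (h.eY _ _ _ cl),
        h.mul_eq_zero_of_ne n3 (h.Ye _) eXY, h.mul_eq_zero_of_ne n2.symm (h.Ye _) eYX]

/-- The socle elements are central. -/
theorem socle_mem_center (h : ResidueFrame k e X Y) (i : ZMod 3) :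
    X i * Y i * X i * Y i ∈ Subalgebra.center k B := by
  obtain ⟨j, l, hc⟩ := exists_cyc i
  obtain ⟨n1, n2, n3⟩ := hc.ne
  have cl := hc.rot.rot
  have cj := hc.rot
  have hl : e i * (X i * Y i * X i * Y i) = X i * Y i * X i * Y i := by
    simp only [← mul_assoc, h.eX]
  have hr : (X i * Y i * X i * Y i) * e i = X i * Y i * X i * Y i := by
    simp only [mul_assoc, h.Ye]
  apply h.mem_center
  · intro m
    by_cases hm : i = m
    · subst hm; rw [hl, hr]
    · rw [h.mul_eq_zero_of_ne hm hr (h.idem m), h.mul_eq_zero_of_ne (Ne.symm hm) (h.idem m) hl]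
  · intro m
    rcases hc.cases m with rfl | rfl | rfl
    · rw [h.XYXYX, h.mul_eq_zero_of_ne n1.symm (h.Xe _ _ _ hc) hl]
    · rw [h.mul_eq_zero_of_ne n1 hr (h.eX m), h.mul_eq_zero_of_ne n3 (h.Xe _ _ _ cj) hl]
    · rw [h.mul_eq_zero_of_ne n3.symm hr (h.eX m), ← mul_assoc, ← mul_assoc, ← mul_assoc,
        h.XXY _ _ _ cl, zero_mul, zero_mul]
  · intro m
    rcases hc.cases m with rfl | rfl | rfl
    · rw [h.mul_eq_zero_of_ne n1 hr (h.eY _ _ _ hc), ← mul_assoc, ← mul_assoc, ← mul_assoc,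
        h.YXYXY]
    · rw [h.mul_eq_zero_of_ne n3.symm hr (h.eY _ _ _ cj), h.mul_eq_zero_of_ne n1.symm (h.Ye _) hl]
    · rw [mul_assoc, mul_assoc, ← mul_assoc (X i) (Y i) (Y m), h.XYY _ _ _ cl, mul_zero,
        h.mul_eq_zero_of_ne n3 (h.Ye _) hl]

end ResidueFrame

namespace TetraRelations

variable {k B : Type*} [CommRing k] [Ring B] [Algebra k B] {I J K Z C : B} {ω t : k}

theorem idemC_mul_eigX (h : TetraRelations I J K Z C) (hω : ω ^ 2 + ω + 1 = 0) {i j l : ZMod 3}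
    (hc : Cyc i j l) : idemC ω t C i * eigX I J K ω = eigX I J K ω * idemC ω t C j := by
  have h1 := h.C_mul_eigX hω
  have h2 : ∀ x, C * (eigX I J K ω * x) = ω ^ 2 • (eigX I J K ω * (C * x)) := fun x => by
    rw [← mul_assoc, h1, smul_mul_assoc, mul_assoc]
  have cases3 : ∀ l : ZMod 3, l = 0 ∨ l = 1 ∨ l = 2 := by decide
  obtain ⟨rfl, -⟩ := hc
  rcases cases3 i with rfl | rfl | rfl
  · rw [show (0 : ZMod 3) + 1 = 1 from rfl, idemC_zero, idemC_one]
    simp only [smul_mul_assoc, mul_smul_comm, add_mul, mul_add, one_mul, mul_one, mul_assoc, h1, h2]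
    match_scalars <;> grind
  · rw [show (1 : ZMod 3) + 1 = 2 from rfl, idemC_one, idemC_two hω]
    simp only [smul_mul_assoc, mul_smul_comm, add_mul, mul_add, one_mul, mul_one, mul_assoc, h1, h2]
    match_scalars <;> grind
  · rw [show (2 : ZMod 3) + 1 = 0 from rfl, idemC_zero, idemC_two hω]
    simp only [smul_mul_assoc, mul_smul_comm, add_mul, mul_add, one_mul, mul_one, mul_assoc, h1, h2]
    match_scalars <;> grind

theorem idemC_mul_eigY (h : TetraRelations I J K Z C) (hω : ω ^ 2 + ω + 1 = 0) {i j l : ZMod 3}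
    (hc : Cyc i j l) : idemC ω t C j * eigY I J K ω = eigY I J K ω * idemC ω t C i := by
  have h1 := h.C_mul_eigY hω
  have h2 : ∀ x, C * (eigY I J K ω * x) = ω • (eigY I J K ω * (C * x)) := fun x => by
    rw [← mul_assoc, h1, smul_mul_assoc, mul_assoc]
  have cases3 : ∀ l : ZMod 3, l = 0 ∨ l = 1 ∨ l = 2 := by decide
  obtain ⟨rfl, -⟩ := hc
  rcases cases3 i with rfl | rfl | rfl
  · rw [show (0 : ZMod 3) + 1 = 1 from rfl, idemC_zero, idemC_one]
    simp only [smul_mul_assoc, mul_smul_comm, add_mul, mul_add, one_mul, mul_one, mul_assoc, h1, h2]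
    match_scalars <;> grind
  · rw [show (1 : ZMod 3) + 1 = 2 from rfl, idemC_one, idemC_two hω]
    simp only [smul_mul_assoc, mul_smul_comm, add_mul, mul_add, one_mul, mul_one, mul_assoc, h1, h2]
    match_scalars <;> grind
  · rw [show (2 : ZMod 3) + 1 = 0 from rfl, idemC_zero, idemC_two hω]
    simp only [smul_mul_assoc, mul_smul_comm, add_mul, mul_add, one_mul, mul_one, mul_assoc, h1, h2]
    match_scalars <;> grind

/-- In characteristic two, the elements `i, j, k` and `-1` lie in the span of the words in the
eigenvectors. -/
theorem mem_span_words (h : TetraRelations I J K Z C) (hω : ω ^ 2 + ω + 1 = 0) (h2 : (2 : k) = 0) :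
    let X := eigX I J K ω
    let Y := eigY I J K ω
    ∀ q ∈ ({1, Z, I, J, K, Z * I, Z * J, Z * K} : Set B), q ∈ Submodule.span k
      ({1, X, Y, X * Y, Y * X, X * Y * X, Y * X * Y, X * Y * X * Y} : Set B) := by
  intro X Y
  set S := Submodule.span k ({1, X, Y, X * Y, Y * X, X * Y * X, Y * X * Y, X * Y * X * Y} : Set B)
  have m1 : 1 ∈ S := Submodule.subset_span (by simp)
  have mX : X ∈ S := Submodule.subset_span (by simp)
  have mY : Y ∈ S := Submodule.subset_span (by simp)
  have mXY : X * Y ∈ S := Submodule.subset_span (by simp)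
  have mYX : Y * X ∈ S := Submodule.subset_span (by simp)
  have mXYX : X * Y * X ∈ S := Submodule.subset_span (by simp)
  have mYXY : Y * X * Y ∈ S := Submodule.subset_span (by simp)
  have mXYXY : X * Y * X * Y ∈ S := Submodule.subset_span (by simp)
  have eXYX : X * Y * X = (5 : k) • (Z * X) - X := by
    rw [h.eigX_eigY_eigX hω, sub_mul, one_mul, Algebra.smul_def, map_ofNat, mul_assoc]
  have eYXY : Y * X * Y = (5 : k) • (Z * Y) - Y := by
    rw [h.eigY_eigX_eigY hω, sub_mul, one_mul, Algebra.smul_def, map_ofNat, mul_assoc]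
  have h5 : (5 : k) = 1 := by grind
  rw [h5, one_smul] at eXYX eYXY
  have mZX : Z * X ∈ S := by rw [show Z * X = X * Y * X + X by rw [eXYX]; abel]; exact add_mem mXYX mX
  have mZY : Z * Y ∈ S := by rw [show Z * Y = Y * X * Y + Y by rw [eYXY]; abel]; exact add_mem mYXY mY
  have eXY : X * Y = _ := h.eigX_mul_eigY hω
  have eYX : Y * X = _ := h.eigY_mul_eigX hω
  set N := I + J + K with hN
  have hNN : Z * (Z * N) = N := h.ZZ_assoc N
  -- the class sums of `Q₈`
  have hV : ω • (X * Y) + ω ^ 2 • (Y * X) = Z + Z * N := by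
    rw [eXY, eYX]; match_scalars <;> grind
  have mV : Z + Z * N ∈ S := by
    rw [← hV]; exact add_mem (S.smul_mem _ mXY) (S.smul_mem _ mYX)
  have eXYXY : X * Y * X * Y = 1 + N + Z + Z * N := by
    rw [eXYX, sub_mul, mul_assoc, eXY]
    simp only [mul_add, mul_smul_comm, h.ZZ, hNN]
    match_scalars <;> grind
  have mN : N ∈ S := by
    rw [show N = X * Y * X * Y - 1 - (Z + Z * N) by rw [eXYXY]; abel]
    exact sub_mem (sub_mem mXYXY m1) mV
  have mZN : Z * N ∈ S := by
    rw [show Z * N = (X * Y + Y * X) - N by rw [eXY, eYX]; match_scalars <;> grind]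
    exact sub_mem (add_mem mXY mYX) mN
  have mZ : Z ∈ S := by
    rw [show Z = (Z + Z * N) - Z * N by abel]; exact sub_mem mV mZN
  have eI : I = N + X + Y := by simp only [X, Y, eigX, eigY, hN]; match_scalars <;> grind
  have eJ : J = N + ω ^ 2 • X + ω • Y := by
    simp only [X, Y, eigX, eigY, hN]; match_scalars <;> grind
  have eK : K = N + ω • X + ω ^ 2 • Y := by
    simp only [X, Y, eigX, eigY, hN]; match_scalars <;> grind
  rintro q (rfl | rfl | hq | hq | hq | hq | hq | hq)
  · exact m1
  · exact mZ
  · rw [hq, eI]; exact add_mem (add_mem mN mX) mY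
  · rw [hq, eJ]; exact add_mem (add_mem mN (S.smul_mem _ mX)) (S.smul_mem _ mY)
  · rw [hq, eK]; exact add_mem (add_mem mN (S.smul_mem _ mX)) (S.smul_mem _ mY)
  · rw [hq, eI, mul_add, mul_add]; exact add_mem (add_mem mZN mZX) mZY
  · rw [hq, eJ, mul_add, mul_add, mul_smul_comm, mul_smul_comm]
    exact add_mem (add_mem mZN (S.smul_mem _ mZX)) (S.smul_mem _ mZY)
  · rw [hq, eK, mul_add, mul_add, mul_smul_comm, mul_smul_comm]
    exact add_mem (add_mem mZN (S.smul_mem _ mZX)) (S.smul_mem _ mZY)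

end TetraRelations

namespace TetraRelations

variable {k B : Type*} [CommRing k] [Ring B] [Algebra k B] {I J K Z C : B} {ω t : k}

variable (I J K C) in
/-- The component of `eigX` starting at the vertex `i`. -/
def arrowX (ω t : k) (i : ZMod 3) : B := idemC ω t C i * eigX I J K ω

variable (I J K C) in
/-- The component of `eigY` ending at the vertex `i`. -/
def arrowY (ω t : k) (i : ZMod 3) : B := idemC ω t C (i + 1) * eigY I J K ω

/-- The products of the eigenvectors in characteristic two. -/
theorem words_of_two_eq_zero (h : TetraRelations I J K Z C) (hω : ω ^ 2 + ω + 1 = 0)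
    (h2 : (2 : k) = 0) :
    let X := eigX I J K ω
    let Y := eigY I J K ω
    X * X * X = X * Y * X * Y ∧ Y * X * X = 0 ∧ X * X * Y = 0 ∧
      Y * Y * X = 0 ∧ X * Y * Y = 0 ∧ X * Y * X * Y * X = 0 ∧ Y * X * Y * X * Y = 0 := by
  intro X Y
  have h2B : (2 : B) = 0 := by
    have := congrArg (algebraMap k B) h2
    rwa [map_ofNat, map_zero] at this
  have h5 : 5 * Z - 1 = 1 + Z := by linear_combination (norm := noncomm_ring) h2B * (2 * Z - 1)
  have hXX : X * X = (1 + Z) * Y := h.eigX_mul_eigX hω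
  have hYY : Y * Y = (1 + Z) * X := h.eigY_mul_eigY hω
  have hXYX : X * Y * X = (1 + Z) * X := by rw [← h5]; exact h.eigX_eigY_eigX hω
  have hYXY : Y * X * Y = (1 + Z) * Y := by rw [← h5]; exact h.eigY_eigX_eigY hω
  have hX : X * (1 + Z) = (1 + Z) * X := by
    rw [mul_add, add_mul, h.Z_mul_eigX ω, mul_one, one_mul]
  have hY : Y * (1 + Z) = (1 + Z) * Y := by
    rw [mul_add, add_mul, h.Z_mul_eigY ω, mul_one, one_mul]
  have hnn : (1 + Z) * (1 + Z) = 0 := by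
    rw [mul_add, add_mul, add_mul, h.ZZ]
    linear_combination (norm := noncomm_ring) h2B * (1 + Z)
  have hnn' : ∀ x, (1 + Z) * ((1 + Z) * x) = 0 := fun x => by rw [← mul_assoc, hnn, zero_mul]
  have hXXX : X * X * X = X * Y * X * Y := by
    rw [hXYX, mul_assoc, hXX, ← mul_assoc, hX, mul_assoc]
  refine ⟨hXXX, ?_, ?_, ?_, ?_, ?_, ?_⟩
  · rw [mul_assoc, hXX, ← mul_assoc, hY, mul_assoc, hYY, hnn']
  · rw [hXX, mul_assoc, hYY, hnn']
  · rw [hYY, mul_assoc, hXX, hnn']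
  · rw [mul_assoc, hYY, ← mul_assoc, hX, mul_assoc, hXX, hnn']
  · rw [hXYX, mul_assoc, mul_assoc, ← mul_assoc X Y X, hXYX, hnn']
  · rw [hYXY, mul_assoc, mul_assoc, ← mul_assoc Y X Y, hYXY, hnn']

/-- An algebra of characteristic two spanned by the products of powers of `C` and the quaternions
satisfies the relations of the group algebra of `Ã₄`. -/
theorem residueFrame (h : TetraRelations I J K Z C) (hω : ω ^ 2 + ω + 1 = 0) (ht : 3 * t = 1)
    (h2 : (2 : k) = 0)
    (hspan : ⊤ ≤ Submodule.span k ({1, C, C * C} : Set B) *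
      Submodule.span k ({1, Z, I, J, K, Z * I, Z * J, Z * K} : Set B)) :
    ResidueFrame k (idemC ω t C) (arrowX I J K C ω t) (arrowY I J K C ω t) := by
  obtain ⟨g1, g3, g4, g5, g6, g7, g8⟩ := h.words_of_two_eq_zero (k := k) hω h2
  set X := eigX I J K ω with hXdef
  set Y := eigY I J K ω with hYdef
  set e := idemC ω t C with he
  have ee : ∀ i j, e j * e i = if j = i then e i else 0 := fun i j =>
    idemC_mul_idemC hω ht h.CCC i j
  have idem : ∀ i, e i * e i = e i := fun i => by rw [ee, if_pos rfl]
  have idem_assoc : ∀ i x, e i * (e i * x) = e i * x := fun i x => by rw [← mul_assoc, idem]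
  have mX : ∀ {i j l}, Cyc i j l → e i * X = X * e j := fun hc => h.idemC_mul_eigX hω hc
  have mY : ∀ {i j l}, Cyc i j l → e j * Y = Y * e i := fun hc => h.idemC_mul_eigY hω hc
  have mX' : ∀ {i j l} (x), Cyc i j l → X * (e j * x) = e i * (X * x) := fun x hc => by
    rw [← mul_assoc, ← mX hc, mul_assoc]
  have mY' : ∀ {i j l} (x), Cyc i j l → Y * (e i * x) = e j * (Y * x) := fun x hc => by
    rw [← mul_assoc, ← mY hc, mul_assoc]
  have aX : ∀ i, arrowX I J K C ω t i = e i * X := fun i => rfl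
  have aY : ∀ {i j l}, Cyc i j l → arrowY I J K C ω t i = e j * Y := fun hc => by
    obtain ⟨rfl, -⟩ := hc; rfl
  have pXY : ∀ i, arrowX I J K C ω t i * arrowY I J K C ω t i = e i * (X * Y) := fun i => by
    have hc := cyc_self i
    rw [aX, aY hc, mul_assoc, mX' _ hc, idem_assoc]
  have pYX : ∀ {i j l}, Cyc i j l →
      arrowY I J K C ω t i * arrowX I J K C ω t i = e j * (Y * X) := fun {i j l} hc => by
    rw [aX, aY hc, mul_assoc, mY' _ hc, idem_assoc]
  have pXX : ∀ {i j l}, Cyc i j l →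
      arrowX I J K C ω t i * arrowX I J K C ω t j = e i * (X * X) := fun {i j l} hc => by
    rw [aX, aX, mul_assoc, mX' _ hc, idem_assoc]
  have pYY : ∀ {i j l}, Cyc i j l →
      arrowY I J K C ω t j * arrowY I J K C ω t i = e l * (Y * Y) := fun {i j l} hc => by
    rw [aY hc, aY hc.rot, mul_assoc, mY' _ hc.rot, idem_assoc]
  have pXYXY : ∀ i, arrowX I J K C ω t i * arrowY I J K C ω t i * arrowX I J K C ω t i *
      arrowY I J K C ω t i = e i * (X * Y * X * Y) := fun i => by
    have hc := cyc_self i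
    rw [mul_assoc, pXY, mul_assoc, mul_assoc, mY' _ hc, mX' _ hc, idem_assoc]
    simp only [mul_assoc]
  have pYXYX : ∀ {i j l}, Cyc i j l → arrowY I J K C ω t i * arrowX I J K C ω t i *
      arrowY I J K C ω t i * arrowX I J K C ω t i = e j * (Y * X * Y * X) := fun {i j l} hc => by
    rw [mul_assoc, pYX hc, mul_assoc, mul_assoc, mX' _ hc, mY' _ hc, idem_assoc]
    simp only [mul_assoc]
  refine
  { idem := idem
    orth := fun i j hij => by rw [ee, if_neg hij]
    eX := fun i => by rw [aX, idem_assoc]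
    Xe := fun i j l hc => by rw [aX, mul_assoc, ← mX hc, idem_assoc]
    eY := fun i j l hc => by rw [aY hc, idem_assoc]
    Ye := fun i => by rw [aY (cyc_self i), mul_assoc, ← mY (cyc_self i), idem_assoc]
    XXX := fun i j l hc => by
      rw [pXX hc, pXYXY, ← g1, aX, mul_assoc, mul_assoc, mX' _ hc.rot, mX' _ hc, idem_assoc]
      simp only [mul_assoc]
    YXX := fun i j l hc => by
      rw [pYX hc, aX, mul_assoc, mul_assoc, mX' _ hc, mY' _ hc, idem_assoc, ← mul_assoc Y, g3,
        mul_zero]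
    XXY := fun i j l hc => by
      rw [mul_assoc, pXY, aX, mul_assoc, mX' _ hc, idem_assoc, ← mul_assoc X, g4, mul_zero]
    YYX := fun i j l hc => by
      rw [mul_assoc, pYX hc, aY hc.rot, mul_assoc, mY' _ hc.rot, idem_assoc, ← mul_assoc Y, g5,
        mul_zero]
    XYY := fun i j l hc => by
      rw [mul_assoc, pYY hc, aX, mul_assoc, mX' _ hc.rot, idem_assoc, ← mul_assoc X, g6, mul_zero]
    XYXYX := fun i => by
      have hc := cyc_self i
      rw [pXYXY, aX, mul_assoc]
      simp only [mul_assoc, mX' _ hc, mY' _ hc]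
      rw [idem_assoc, show X * (Y * (X * (Y * X))) = X * Y * X * Y * X by simp only [mul_assoc], g7,
        mul_zero]
    YXYXY := fun i => by
      have hc := cyc_self i
      rw [pYXYX hc, aY hc, mul_assoc]
      simp only [mul_assoc, mX' _ hc, mY' _ hc]
      rw [idem_assoc, show Y * (X * (Y * (X * Y))) = Y * X * Y * X * Y by simp only [mul_assoc], g8,
        mul_zero]
    top_le_span := ?_ }
  set S := Submodule.span k (Set.range fun p : ZMod 3 × Fin 8 =>
    pathWord e (arrowX I J K C ω t) (arrowY I J K C ω t) p.1 p.2) with hS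
  have hw : ∀ i n, pathWord e (arrowX I J K C ω t) (arrowY I J K C ω t) i n ∈ S := fun i n =>
    Submodule.subset_span ⟨(i, n), rfl⟩
  -- the powers of `C` lie in the span of the idempotents
  have hC : ∀ i, C * e i = ω ^ i.val • e i := fun i => mul_idemC hω h.CCC i
  have hsum : (1 : B) = e 0 + e 1 + e 2 := (idemC_sum hω ht).symm
  have hCspan : Submodule.span k ({1, C, C * C} : Set B) ≤ Submodule.span k (Set.range e) := by
    have me : ∀ i, e i ∈ Submodule.span k (Set.range e) := fun i => Submodule.subset_span ⟨i, rfl⟩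
    have m1 : (1 : B) ∈ Submodule.span k (Set.range e) := by
      rw [hsum]; exact add_mem (add_mem (me 0) (me 1)) (me 2)
    have mC : ∀ x ∈ Submodule.span k (Set.range e), C * x ∈ Submodule.span k (Set.range e) := by
      intro x hx
      induction hx using Submodule.span_induction with
      | mem x hx => obtain ⟨i, rfl⟩ := hx; rw [hC]; exact Submodule.smul_mem _ _ (me i)
      | zero => rw [mul_zero]; exact Submodule.zero_mem _
      | add x y _ _ hx hy => rw [mul_add]; exact add_mem hx hy
      | smul a x _ hx => rw [mul_smul_comm]; exact Submodule.smul_mem _ _ hx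
    rw [Submodule.span_le]
    have mC1 : C ∈ Submodule.span k (Set.range e) := by simpa using mC 1 m1
    rintro x (rfl | rfl | rfl)
    exacts [m1, mC1, mC _ mC1]
  have hQspan : Submodule.span k ({1, Z, I, J, K, Z * I, Z * J, Z * K} : Set B) ≤
      Submodule.span k ({1, X, Y, X * Y, Y * X, X * Y * X, Y * X * Y, X * Y * X * Y} : Set B) :=
    Submodule.span_le.2 fun q hq => h.mem_span_words hω h2 q hq
  refine hspan.trans ((mul_le_mul' hCspan hQspan).trans ?_)
  rw [Submodule.span_mul_span, Submodule.span_le]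
  rintro _ ⟨_, ⟨j, rfl⟩, q, hq, rfl⟩
  obtain ⟨i, l, hc⟩ : ∃ i l, Cyc i j l := ⟨j + 2, j + 1, by revert j; unfold Cyc; decide⟩
  simp only
  rcases hq with rfl | rfl | rfl | rfl | rfl | rfl | rfl | rfl
  · rw [mul_one]; exact hw j 0
  · exact hw j 1
  · rw [← aY hc]; exact hw i 2
  · rw [← pXY]; exact hw j 3
  · rw [← pYX hc]; exact hw i 4
  · have : e j * (X * Y * X) = arrowX I J K C ω t j * arrowY I J K C ω t j *
        arrowX I J K C ω t j := by
      rw [pXY, aX]; simp only [mul_assoc, mY' _ hc.rot, mX' _ hc.rot, idem_assoc]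
    rw [this]; exact hw j 5
  · have : e j * (Y * X * Y) = arrowY I J K C ω t i * arrowX I J K C ω t i *
        arrowY I J K C ω t i := by
      rw [pYX hc, aY hc]; simp only [mul_assoc, mX' _ hc, mY' _ hc, idem_assoc]
    rw [this]; exact hw i 6
  · rw [← pXYXY]; exact hw j 7

end TetraRelations

/-! ### The group algebra of `Ã₄` and its class sums -/

namespace Atilde4

open QuaternionGroup

variable (R : Type*) [CommRing R]

/-- An element of `Q₈` in the group algebra. -/
noncomputable def quat (q : QuaternionGroup 2) : MonoidAlgebra R Atilde4 :=
  MonoidAlgebra.of R Atilde4 (SemidirectProduct.inl q)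

/-- The generator of `C₃` in the group algebra. -/
noncomputable def genC : MonoidAlgebra R Atilde4 :=
  MonoidAlgebra.of R Atilde4 (SemidirectProduct.inr (Multiplicative.ofAdd 1))

theorem tetraRelations :
    TetraRelations (quat R (a 1)) (quat R (xa 0)) (quat R (xa 3)) (quat R (a 2)) (genC R) := by
  constructor
  case ZZ =>
    rw [← map_one (MonoidAlgebra.of R Atilde4)]
    simp only [quat, ← map_mul]; exact congrArg _ (by decide)
  case CCC =>
    rw [← map_one (MonoidAlgebra.of R Atilde4)]
    simp only [genC, ← map_mul]; exact congrArg _ (by decide)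
  all_goals
    simp only [quat, genC, ← map_mul]; exact congrArg _ (by decide)

theorem top_le_span_mul_span :
    (⊤ : Submodule R (MonoidAlgebra R Atilde4)) ≤
      Submodule.span R ({1, genC R, genC R * genC R} : Set (MonoidAlgebra R Atilde4)) *
      Submodule.span R ({1, quat R (a 2), quat R (a 1), quat R (xa 0), quat R (xa 3),
        quat R (a 2) * quat R (a 1), quat R (a 2) * quat R (xa 0),
        quat R (a 2) * quat R (xa 3)} : Set (MonoidAlgebra R Atilde4)) := by
  rw [Submodule.span_mul_span]
  have key : ∀ g : Atilde4, MonoidAlgebra.of R Atilde4 g ∈ Submodule.span R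
      (({1, genC R, genC R * genC R} : Set (MonoidAlgebra R Atilde4)) *
      ({1, quat R (a 2), quat R (a 1), quat R (xa 0), quat R (xa 3),
        quat R (a 2) * quat R (a 1), quat R (a 2) * quat R (xa 0),
        quat R (a 2) * quat R (xa 3)} : Set (MonoidAlgebra R Atilde4))) := by
    intro g
    apply Submodule.subset_span
    have hg : g = SemidirectProduct.inr g.right *
        SemidirectProduct.inl ((Atilde4.action g.right)⁻¹ g.left) := by
      ext
      · simp
      · simp
    rw [hg, map_mul]
    apply Set.mul_mem_mul
    · have : ∀ c : ZMod 3, c = 0 ∨ c = 1 ∨ c = 1 + 1 := by decide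
      rcases this g.right.toAdd with h | h | h <;> rw [← ofAdd_toAdd g.right, h]
      · left; exact map_one (MonoidAlgebra.of R Atilde4)
      · right; left; rfl
      · right; right
        simp only [genC, ← map_mul]; rfl
    · generalize (Atilde4.action g.right)⁻¹ g.left = q
      have : ∀ q : QuaternionGroup 2, q = 1 ∨ q = a 2 ∨ q = a 1 ∨ q = xa 0 ∨ q = xa 3 ∨
        q = a 2 * a 1 ∨ q = a 2 * xa 0 ∨ q = a 2 * xa 3 := by decide
      rcases this q with rfl | rfl | rfl | rfl | rfl | rfl | rfl | rfl <;>
        simp only [quat, map_mul, map_one] <;> simp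
  intro x _
  induction x using MonoidAlgebra.induction_on with
  | of g => exact key g
  | add x y hx hy => exact add_mem (hx trivial) (hy trivial)
  | smul r x hx => exact Submodule.smul_mem _ _ (hx trivial)

variable {R}

/-- Over a ring of characteristic two the group algebra satisfies the relations of
`ResidueFrame`. -/
theorem residueFrame {ω t : R} (hω : ω ^ 2 + ω + 1 = 0) (ht : 3 * t = 1) (h2 : (2 : R) = 0) :
    ResidueFrame R (idemC ω t (genC R))
      (TetraRelations.arrowX (quat R (a 1)) (quat R (xa 0)) (quat R (xa 3)) (genC R) ω t)
      (TetraRelations.arrowY (quat R (a 1)) (quat R (xa 0)) (quat R (xa 3)) (genC R) ω t) :=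
  (tetraRelations R).residueFrame hω ht h2 (top_le_span_mul_span R)

/-- Representatives of the conjugacy classes. -/
def classRep : Fin 7 → Atilde4 :=
  ![⟨a 0, Multiplicative.ofAdd 0⟩, ⟨a 2, Multiplicative.ofAdd 0⟩, ⟨a 1, Multiplicative.ofAdd 0⟩,
    ⟨a 0, Multiplicative.ofAdd 1⟩, ⟨a 2, Multiplicative.ofAdd 1⟩,
    ⟨a 0, Multiplicative.ofAdd 2⟩, ⟨a 2, Multiplicative.ofAdd 2⟩]

/-- The number of the conjugacy class of an element. -/
def classIndex (g : Atilde4) : Fin 7 :=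
  if g.right.toAdd = 0 then (if g.left = a 0 then 0 else if g.left = a 2 then 1 else 2)
  else if g.right.toAdd = 1 then
    (if g.left = a 0 ∨ g.left = a 3 ∨ g.left = xa 2 ∨ g.left = xa 1 then 3 else 4)
  else (if g.left = a 0 ∨ g.left = a 1 ∨ g.left = xa 0 ∨ g.left = xa 3 then 5 else 6)

theorem classIndex_classRep (i : Fin 7) : classIndex (classRep i) = i := by
  revert i; decide

theorem exists_conj (g : Atilde4) : ∃ h : Atilde4, h * g = classRep (classIndex g) * h := by
  obtain ⟨q, c⟩ := g
  have : ∀ (q : QuaternionGroup 2) (c : ZMod 3), ∃ (p : QuaternionGroup 2) (d : ZMod 3),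
      (⟨p, Multiplicative.ofAdd d⟩ * ⟨q, Multiplicative.ofAdd c⟩ : Atilde4) =
        classRep (classIndex ⟨q, Multiplicative.ofAdd c⟩) * ⟨p, Multiplicative.ofAdd d⟩ := by
    decide +kernel
  obtain ⟨p, d, h⟩ := this q c.toAdd
  exact ⟨_, h⟩

instance : Fintype Atilde4 := Fintype.ofEquiv _ SemidirectProduct.equivProd.symm

theorem card_eq : Fintype.card Atilde4 = 24 := rfl

variable (R) in
/-- The sum of the elements of a conjugacy class. -/
noncomputable def classSum (i : Fin 7) : MonoidAlgebra R Atilde4 :=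
  ∑ g : Atilde4, if classIndex g = i then MonoidAlgebra.of R Atilde4 g else 0

theorem eq_sum_of (x : MonoidAlgebra R Atilde4) :
    x = ∑ g : Atilde4, x.coeff g • MonoidAlgebra.of R Atilde4 g := by
  classical
  ext g
  simp [MonoidAlgebra.coeff_sum, MonoidAlgebra.of_apply, Finsupp.single_apply]

/-- A central element is a combination of class sums. -/
theorem eq_sum_classSum {x : MonoidAlgebra R Atilde4}
    (hx : x ∈ Subalgebra.center R (MonoidAlgebra R Atilde4)) :
    x = ∑ i, x.coeff (classRep i) • classSum R i := by
  have h1 : ∀ g, x.coeff g = x.coeff (classRep (classIndex g)) := fun g => by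
    obtain ⟨h, hg⟩ := exists_conj g
    have hh := Subalgebra.mem_center_iff.1 hx (MonoidAlgebra.single h⁻¹ 1)
    have e1 := congrArg (fun y => MonoidAlgebra.coeff y (g * h⁻¹)) hh
    simp only [MonoidAlgebra.coeff_mul_single_apply, MonoidAlgebra.coeff_single_mul_apply,
      inv_inv, one_mul, mul_one, inv_mul_cancel_right] at e1
    rw [← e1, ← mul_assoc, hg, mul_inv_cancel_right]
  conv_lhs => rw [eq_sum_of x]
  simp only [classSum, Finset.smul_sum]
  rw [Finset.sum_comm]
  refine Finset.sum_congr rfl fun g _ => ?_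
  simp only [smul_ite, smul_zero, Finset.sum_ite_eq, Finset.mem_univ, if_true]
  rw [h1 g]

theorem classSum_coeff (i j : Fin 7) :
    (classSum R i).coeff (classRep j) = if i = j then 1 else 0 := by
  classical
  simp only [classSum, MonoidAlgebra.coeff_sum, Finsupp.coe_finsetSum, Finset.sum_apply]
  rw [Finset.sum_eq_single (classRep j)]
  · rw [classIndex_classRep]
    by_cases h : i = j
    · subst h; simp [MonoidAlgebra.of_apply]
    · simp [h, Ne.symm h]
  · intro g _ hg
    split_ifs
    · simp [MonoidAlgebra.of_apply, hg]
    · simp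
  · simp

end Atilde4

/-! ### Central characters -/

/-- The index set of the irreducible characters of `Ã₄`: `inl (some i)` stands for the character of
degree one with value `ω ^ i` at the generator of `C₃`, `inl none` for the character of degree
three, and `inr k` for the character of degree two whose reduction modulo two is the sum of the two
characters of degree one other than that of `k`. -/
abbrev CharIndex : Type := Option (ZMod 3) ⊕ ZMod 3

namespace CharIndex

/-- Whether a character is a constituent of the `i`-th projective indecomposable character. -/
def supp (i : ZMod 3) : CharIndex → Prop
  | .inl (some j) => j = i
  | .inl none => True
  | .inr j => j ≠ i

instance (i : ZMod 3) : DecidablePred (supp i)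
  | .inl (some j) => inferInstanceAs (Decidable (j = i))
  | .inl none => inferInstanceAs (Decidable True)
  | .inr j => inferInstanceAs (Decidable (j ≠ i))

/-- The character of degree two attached to two characters of odd degree. -/
def third : Option (ZMod 3) → Option (ZMod 3) → ZMod 3
  | some i, some j => -(i + j)
  | some i, none => i
  | none, some i => i
  | none, none => 0

/-- The values at the irreducible characters of the central element
`4 (ε a + ε b) + 2 φ (third a b)`. -/
def pairFun (a b : Option (ZMod 3)) : CharIndex → ℤ
  | .inl c => if c = a ∨ c = b then 4 else 0
  | .inr k => if k = third a b then 2 else 0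

/-- The values at the irreducible characters of the central element `8 ε a`. -/
def octFun (a : Option (ZMod 3)) : CharIndex → ℤ
  | .inl c => if c = a then 8 else 0
  | .inr _ => 0

/-- The values of the central element attached to the arrows between `i` and `i + 1`. -/
def edgeFun (i : ZMod 3) : CharIndex → ℤ := pairFun (some (i + 2)) none

/-- On the support of the `i`-th projective indecomposable character the functions `1`,
`edgeFun i`, `edgeFun (i + 2)`, `octFun none` span all the functions in question. -/
theorem exists_comb_of_supp {f : CharIndex → ℤ}
    (hf : f = 1 ∨ (∃ a b, a ≠ b ∧ f = pairFun a b) ∨ ∃ a, f = octFun a) (i : ZMod 3) :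
    ∃ a b c d : ℤ, ∀ t, supp i t →
      f t = a + b * edgeFun i t + c * edgeFun (i + 2) t + d * octFun none t := by
  let b : ℤ := (f (.inr (i + 2)) - f (.inl (some i))) / 2
  let c : ℤ := (f (.inr (i + 1)) - f (.inl (some i))) / 2
  refine ⟨f (.inl (some i)), b, c, (f (.inl none) - f (.inl (some i)) - 4 * b - 4 * c) / 8, ?_⟩
  simp only [b, c]
  rcases hf with rfl | ⟨p, q, hpq, rfl⟩ | ⟨p, rfl⟩
  · revert i; decide
  · revert i p q; decide +kernel
  · revert i p; decide +kernel

/-- On the common support of two neighbouring projective indecomposable characters the functions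
`1`, `edgeFun i` span all the functions in question. -/
theorem exists_comb_of_supp_inter {f : CharIndex → ℤ}
    (hf : f = 1 ∨ (∃ a b, a ≠ b ∧ f = pairFun a b) ∨ ∃ a, f = octFun a) (i : ZMod 3) :
    ∃ a b : ℤ, ∀ t, supp i t → supp (i + 1) t → f t = a + b * edgeFun i t := by
  let b : ℤ := (f (.inl none) - f (.inr (i + 2))) / 2
  refine ⟨f (.inr (i + 2)) - 2 * b, b, ?_⟩
  simp only [b]
  rcases hf with rfl | ⟨p, q, hpq, rfl⟩ | ⟨p, rfl⟩
  · revert i; decide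
  · revert i p q; decide +kernel
  · revert i p; decide +kernel

end CharIndex

open CharIndex

/-- A ring `A` with three orthogonal idempotents `e i`, embedded by `ι` in a ring with a complete
set of orthogonal central idempotents `ε t`, such that `ε t` annihilates `e i` unless `t` belongs to
the support of the `i`-th projective indecomposable character of `Ã₄`. -/
structure CentralFrame {A L : Type*} [Ring A] [Ring L] (e : ZMod 3 → A) (ι : A →+* L)
    (ε : CharIndex → L) : Prop where
  idem : ∀ i, e i * e i = e i
  orth : ∀ i j, i ≠ j → e i * e j = 0
  sum_eq_one : e 0 + e 1 + e 2 = 1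
  inj : Function.Injective ι
  idem' : ∀ t, ε t * ε t = ε t
  orth' : ∀ t u, t ≠ u → ε t * ε u = 0
  sum_eq_one' : ∑ t, ε t = 1
  central : ∀ t x, ε t * x = x * ε t
  vanish : ∀ i t, ¬ supp i t → ε t * ι (e i) = 0

/-- The central element with prescribed integral values at the irreducible characters. -/
def centralSum {L : Type*} [Ring L] (ε : CharIndex → L) (f : CharIndex → ℤ) : L := ∑ t, f t • ε t

namespace CentralFrame

variable {A L : Type*} [Ring A] [Ring L] {e : ZMod 3 → A} {ι : A →+* L} {ε : CharIndex → L}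

theorem centralSum_one (h : CentralFrame e ι ε) : centralSum ε 1 = 1 := by
  simp [centralSum, h.sum_eq_one']

theorem centralSum_mul_idem (h : CentralFrame e ι ε) (f : CharIndex → ℤ) (t : CharIndex) :
    centralSum ε f * ε t = f t • ε t := by
  rw [centralSum, Finset.sum_mul, Finset.sum_eq_single t]
  · rw [smul_mul_assoc, h.idem']
  · intro u _ hu; rw [smul_mul_assoc, h.orth' u t hu, smul_zero]
  · simp

theorem centralSum_mul (h : CentralFrame e ι ε) (f g : CharIndex → ℤ) :
    centralSum ε f * centralSum ε g = centralSum ε (f * g) := by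
  conv_lhs => rw [centralSum.eq_1 ε g, Finset.mul_sum]
  refine Finset.sum_congr rfl fun t _ => ?_
  rw [mul_smul_comm, h.centralSum_mul_idem, smul_smul, mul_comm]; rfl

theorem _root_.centralSum_add (f g : CharIndex → ℤ) :
    centralSum ε (f + g) = centralSum ε f + centralSum ε g := by
  simp [centralSum, add_smul, Finset.sum_add_distrib]

theorem _root_.centralSum_smul (n : ℤ) (f : CharIndex → ℤ) :
    centralSum ε (n • f) = n • centralSum ε f := by
  simp [centralSum, mul_smul, Finset.smul_sum]

/-- Two central elements act in the same way on a Peirce component if they agree on the common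
support of the two projective indecomposable characters. -/
theorem mul_eq_mul (h : CentralFrame e ι ε) {z z' m : A} {i j : ZMod 3} (hl : e i * m = m)
    (hr : m * e j = m) {f g : CharIndex → ℤ} (hz : ι z = centralSum ε f)
    (hz' : ι z' = centralSum ε g) (hfg : ∀ t, supp i t → supp j t → f t = g t) :
    z * m = z' * m := by
  apply h.inj
  rw [map_mul, map_mul, hz, hz', centralSum, centralSum, Finset.sum_mul, Finset.sum_mul]
  refine Finset.sum_congr rfl fun t _ => ?_
  by_cases hi : supp i t
  · by_cases hj : supp j t
    · rw [hfg t hi hj]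
    · have : ε t * ι m = 0 := by
        rw [← hr, map_mul, ← mul_assoc, h.central, mul_assoc, h.vanish j t hj, mul_zero]
      rw [smul_mul_assoc, smul_mul_assoc, this, smul_zero, smul_zero]
  · have : ε t * ι m = 0 := by
      rw [← hl, map_mul, ← mul_assoc, h.vanish i t hi, zero_mul]
    rw [smul_mul_assoc, smul_mul_assoc, this, smul_zero, smul_zero]

end CentralFrame

/-- The canonical structure of an algebra over the center. -/
instance Subalgebra.centerAlgebra (O A : Type*) [CommRing O] [Ring A] [Algebra O A] :
    Algebra (Subalgebra.center O A) A where
  algebraMap := (Subalgebra.center O A).val.toRingHom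
  commutes' c x := (Subalgebra.mem_center_iff.1 c.2 x).symm
  smul_def' _ _ := rfl

/-- An `O`-algebra `A` whose center has the form of the center of `OÃ₄`, and which reduces to the
algebra of `Ã₄` in characteristic two. The elements `pair a b` and `oct a` of the center are
`4 (ε a + ε b) + 2 φ (third a b)` and `8 ε a`. -/
structure CentralLift (O k : Type*) {A B L : Type*} [CommRing O] [IsLocalRing O] [CommRing k]
    [Algebra O k] [Ring A] [Ring B] [Ring L] [Algebra O A] [Algebra k B] [Algebra O B]
    (r : A →ₐ[O] B) (e : ZMod 3 → A) (X Y : ZMod 3 → B) (ι : A →+* L)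
    (ε : CharIndex → L) (pair : Option (ZMod 3) → Option (ZMod 3) → Subalgebra.center O A)
    (oct : Option (ZMod 3) → Subalgebra.center O A) : Prop
    extends CentralFrame e ι ε where
  two_mem : (2 : O) ∈ IsLocalRing.maximalIdeal O
  algebraMap_surj : Function.Surjective (algebraMap O k)
  algebraMap_eq_zero : ∀ x ∈ IsLocalRing.maximalIdeal O, algebraMap O k x = 0
  surj : Function.Surjective r
  mem_of_eq_zero : ∀ x, r x = 0 → x ∈ IsLocalRing.maximalIdeal O • (⊤ : Submodule O A)
  frame : ResidueFrame k (fun i => r (e i)) X Y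
  pair_eq : ∀ a b, a ≠ b → ι (pair a b) = centralSum ε (pairFun a b)
  oct_eq : ∀ a, ι (oct a) = centralSum ε (octFun a)
  center_le : (⊤ : Submodule O (Subalgebra.center O A)) ≤ Submodule.span O
    {z | z = 1 ∨ (∃ a b, a ≠ b ∧ z = pair a b) ∨ ∃ a, z = oct a}
  center_surj : ∀ y ∈ Subalgebra.center k B, ∃ z : Subalgebra.center O A, r z = y

namespace CentralLift

variable {O k A B L : Type*} [CommRing O] [IsLocalRing O] [CommRing k]
    [Algebra O k] [Ring A] [Ring B] [Ring L] [Algebra O A] [Algebra k B] [Algebra O B]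
    {r : A →ₐ[O] B} {e : ZMod 3 → A} {X Y : ZMod 3 → B} {ι : A →+* L}
    {ε : CharIndex → L} {pair : Option (ZMod 3) → Option (ZMod 3) → Subalgebra.center O A}
    {oct : Option (ZMod 3) → Subalgebra.center O A}

theorem eq_centralSum (h : CentralLift O k r e X Y ι ε pair oct) {z : Subalgebra.center O A}
    (hz : z = 1 ∨ (∃ a b, a ≠ b ∧ z = pair a b) ∨ ∃ a, z = oct a) :
    ∃ f : CharIndex → ℤ, (f = 1 ∨ (∃ a b, a ≠ b ∧ f = pairFun a b) ∨ ∃ a, f = octFun a) ∧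
      ι z = centralSum ε f := by
  rcases hz with rfl | ⟨a, b, hab, rfl⟩ | ⟨a, rfl⟩
  · exact ⟨1, Or.inl rfl, by rw [h.toCentralFrame.centralSum_one]; simp⟩
  · exact ⟨_, Or.inr (Or.inl ⟨a, b, hab, rfl⟩), h.pair_eq a b hab⟩
  · exact ⟨_, Or.inr (Or.inr ⟨a, rfl⟩), h.oct_eq a⟩

theorem edge_eq (h : CentralLift O k r e X Y ι ε pair oct) (i : ZMod 3) :
    ι (pair (some (i + 2)) none) = centralSum ε (edgeFun i) :=
  h.pair_eq _ _ (by simp)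

/-- The action of the center on a diagonal Peirce component. -/
theorem exists_center_mul_diag (h : CentralLift O k r e X Y ι ε pair oct) (i : ZMod 3)
    (z : Subalgebra.center O A) : ∃ a b c d : O, ∀ m, e i * m = m → m * e i = m →
    z • m = a • m + b • pair (some (i + 2)) none • m + c • pair (some (i + 2 + 2)) none • m +
      d • oct none • m := by
  have hz := h.center_le (Submodule.mem_top (x := z))
  induction hz using Submodule.span_induction with
  | mem z hz =>
    obtain ⟨f, hf, hzf⟩ := h.eq_centralSum hz
    obtain ⟨a, b, c, d, hfs⟩ := exists_comb_of_supp hf i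
    refine ⟨a, b, c, d, fun m hl hr => ?_⟩
    have key := h.toCentralFrame.mul_eq_mul (z' := a • (1 : A) + b • (pair (some (i + 2)) none : A)
      + c • (pair (some (i + 2 + 2)) none : A) + d • (oct none : A))
      (g := a • 1 + b • edgeFun i + c • edgeFun (i + 2) + d • octFun none) hl hr hzf
      (by simp only [map_add, map_zsmul, h.edge_eq, h.oct_eq, centralSum_add, centralSum_smul,
            h.toCentralFrame.centralSum_one, map_one])
      (fun t ht _ => by simpa using hfs t ht)
    rw [Subalgebra.smul_def, smul_eq_mul, key]
    simp only [add_mul, smul_mul_assoc, one_mul, Int.cast_smul_eq_zsmul]; rfl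
  | zero => exact ⟨0, 0, 0, 0, by simp⟩
  | add x y _ _ hx hy =>
    obtain ⟨a, b, c, d, h1⟩ := hx
    obtain ⟨a', b', c', d', h2⟩ := hy
    exact ⟨a + a', b + b', c + c', d + d', fun m hl hr => by
      rw [add_smul, h1 m hl hr, h2 m hl hr]; module⟩
  | smul u x _ hx =>
    obtain ⟨a, b, c, d, h1⟩ := hx
    exact ⟨u * a, u * b, u * c, u * d, fun m hl hr => by
      rw [smul_assoc, h1 m hl hr]; module⟩

/-- The action of the center on the Peirce components between neighbouring vertices. -/
theorem exists_center_mul_edge (h : CentralLift O k r e X Y ι ε pair oct) (i : ZMod 3)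
    (z : Subalgebra.center O A) : ∃ a b : O, ∀ m,
    (e i * m = m ∧ m * e (i + 1) = m ∨ e (i + 1) * m = m ∧ m * e i = m) →
    z • m = a • m + b • pair (some (i + 2)) none • m := by
  have hz := h.center_le (Submodule.mem_top (x := z))
  induction hz using Submodule.span_induction with
  | mem z hz =>
    obtain ⟨f, hf, hzf⟩ := h.eq_centralSum hz
    obtain ⟨a, b, hfs⟩ := exists_comb_of_supp_inter hf i
    refine ⟨a, b, fun m hm => ?_⟩
    have e1 : ι (a • (1 : A) + b • (pair (some (i + 2)) none : A)) =
        centralSum ε (a • 1 + b • edgeFun i) := by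
      simp only [map_add, map_zsmul, h.edge_eq, centralSum_add, centralSum_smul,
            h.toCentralFrame.centralSum_one, map_one]
    have key : (z : A) * m = (a • (1 : A) + b • (pair (some (i + 2)) none : A)) * m := by
      rcases hm with ⟨hl, hr⟩ | ⟨hl, hr⟩
      · exact h.toCentralFrame.mul_eq_mul hl hr hzf e1 fun t ht ht' => by simpa using hfs t ht ht'
      · exact h.toCentralFrame.mul_eq_mul hl hr hzf e1 fun t ht ht' => by simpa using hfs t ht' ht
    rw [Subalgebra.smul_def, smul_eq_mul, key]
    simp only [add_mul, smul_mul_assoc, one_mul, Int.cast_smul_eq_zsmul]; rfl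
  | zero => exact ⟨0, 0, by simp⟩
  | add x y _ _ hx hy =>
    obtain ⟨a, b, h1⟩ := hx
    obtain ⟨a', b', h2⟩ := hy
    exact ⟨a + a', b + b', fun m hm => by rw [add_smul, h1 m hm, h2 m hm]; module⟩
  | smul u x _ hx =>
    obtain ⟨a, b, h1⟩ := hx
    exact ⟨u * a, u * b, fun m hm => by rw [smul_assoc, h1 m hm]; module⟩

end CentralLift

/-! ### Recovering an order from its center -/

namespace CentralLift

open CharIndex

/-- The family that turns out to be a basis of `A`; here `x i` and `y i` are lifts of the arrows. -/
def frameFamily {A C : Type*} [Ring A] [SMul C A] (e x y : ZMod 3 → A) (z : ZMod 3 → C) (s : C)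
    (p : ZMod 3 × Fin 8) : A :=
  ![e p.1, z p.1 • e p.1, z (p.1 + 2) • e p.1, s • e p.1, x p.1, z p.1 • x p.1, y p.1,
    z p.1 • y p.1] p.2

variable {O k A B L : Type*} [CommRing O] [IsLocalRing O] [CommRing k]
    [Algebra O k] [Ring A] [Ring B] [Ring L] [Algebra O A] [Algebra k B] [Algebra O B]
    {r : A →ₐ[O] B} {e : ZMod 3 → A} {X Y : ZMod 3 → B} {ι : A →+* L}
    {ε : CharIndex → L} {pair : Option (ZMod 3) → Option (ZMod 3) → Subalgebra.center O A}
    {oct : Option (ZMod 3) → Subalgebra.center O A}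

/-- The arrows lift along `r`. -/
theorem exists_arrows (h : CentralLift O k r e X Y ι ε pair oct) :
    ∃ x y : ZMod 3 → A, (∀ i, e i * x i = x i) ∧ (∀ i, x i * e (i + 1) = x i) ∧
      (∀ i, e (i + 1) * y i = y i) ∧ (∀ i, y i * e i = y i) ∧ (∀ i, r (x i) = X i) ∧
      ∀ i, r (y i) = Y i := by
  choose x hx using fun i => h.surj (X i)
  choose y hy using fun i => h.surj (Y i)
  refine ⟨fun i => e i * x i * e (i + 1), fun i => e (i + 1) * y i * e i, ?_, ?_, ?_, ?_, ?_, ?_⟩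
  · intro i; simp only [← mul_assoc, h.idem]
  · intro i; simp only [mul_assoc, h.idem]
  · intro i; simp only [← mul_assoc, h.idem]
  · intro i; simp only [mul_assoc, h.idem]
  · intro i; rw [map_mul, map_mul, hx, h.frame.eX, h.frame.Xe i _ _ (cyc_self i)]
  · intro i; rw [map_mul, map_mul, hy, h.frame.eY i _ _ (cyc_self i), h.frame.Ye]

variable [IsScalarTower O k B] [Module.Finite O A] {x y : ZMod 3 → A}

/-- By Nakayama's lemma the family `frameFamily` spans `A`. -/
theorem top_le_span (h : CentralLift O k r e X Y ι ε pair oct)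
    (ex : ∀ i, e i * x i = x i) (xe : ∀ i, x i * e (i + 1) = x i)
    (ey : ∀ i, e (i + 1) * y i = y i) (ye : ∀ i, y i * e i = y i)
    (hx : ∀ i, r (x i) = X i) (hy : ∀ i, r (y i) = Y i) :
    ⊤ ≤ Submodule.span O (Set.range
      (frameFamily e x y (fun i => pair (some (i + 2)) none) (oct none))) := by
  set z : ZMod 3 → Subalgebra.center O A := fun i => pair (some (i + 2)) none with hz
  set v := frameFamily e x y z (oct none) with hv
  set N := Submodule.span O (Set.range v) with hN
  have mem : ∀ p, v p ∈ N := fun p => Submodule.subset_span ⟨p, rfl⟩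
  have m_e : ∀ (i : ZMod 3) (c : Subalgebra.center O A), c • e i ∈ N := fun i c => by
    obtain ⟨a, b, c', d, hc⟩ := h.exists_center_mul_diag i c
    rw [hc (e i) (h.idem i) (h.idem i)]
    exact add_mem (add_mem (add_mem (N.smul_mem _ (mem (i, 0))) (N.smul_mem _ (mem (i, 1))))
      (N.smul_mem _ (mem (i, 2)))) (N.smul_mem _ (mem (i, 3)))
  have m_x : ∀ (i : ZMod 3) (c : Subalgebra.center O A), c • x i ∈ N := fun i c => by
    obtain ⟨a, b, hc⟩ := h.exists_center_mul_edge i c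
    rw [hc (x i) (Or.inl ⟨ex i, xe i⟩)]
    exact add_mem (N.smul_mem _ (mem (i, 4))) (N.smul_mem _ (mem (i, 5)))
  have m_y : ∀ (i : ZMod 3) (c : Subalgebra.center O A), c • y i ∈ N := fun i c => by
    obtain ⟨a, b, hc⟩ := h.exists_center_mul_edge i c
    rw [hc (y i) (Or.inr ⟨ey i, ye i⟩)]
    exact add_mem (N.smul_mem _ (mem (i, 6))) (N.smul_mem _ (mem (i, 7)))
  have im : ∀ {w : A} {c : Subalgebra.center O A} {b b' : B}, (∀ c : Subalgebra.center O A,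
      c • w ∈ N) → r c = b → b * r w = b' → b' ∈ N.map r.toLinearMap := by
    rintro w c b b' hw rfl rfl
    exact ⟨c • w, hw c, by simp [Subalgebra.smul_def]⟩
  have hmap : (⊤ : Submodule O B) ≤ N.map r.toLinearMap := by
    have h1 := Submodule.restrictScalars_mono (S := O) h.frame.top_le_span
    rw [Submodule.restrictScalars_top, Submodule.restrictScalars_span _ _ h.algebraMap_surj] at h1
    refine h1.trans (Submodule.span_le.2 ?_)
    rintro _ ⟨⟨i, n⟩, rfl⟩
    have hc := cyc_self i
    obtain ⟨c, hC⟩ := h.center_surj _ (h.frame.cycle_mem_center i)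
    obtain ⟨d, hD⟩ := h.center_surj _ (h.frame.socle_mem_center i)
    have XYe : X i * Y i * r (e i) = X i * Y i := by rw [mul_assoc, h.frame.Ye]
    have YXe : Y i * X i * r (e (i + 1)) = Y i * X i := by rw [mul_assoc, h.frame.Xe i _ _ hc]
    have z1 : Y i * X i * r (e i) = 0 :=
      h.frame.mul_eq_zero_of_ne hc.ne.1.symm YXe (h.frame.idem i)
    have z2 : X i * Y i * r (e (i + 1)) = 0 :=
      h.frame.mul_eq_zero_of_ne hc.ne.1 XYe (h.frame.idem _)
    have z3 : Y i * X i * X i = 0 := h.frame.mul_eq_zero_of_ne hc.ne.1.symm YXe (h.frame.eX i)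
    have z4 : X i * Y i * Y i = 0 :=
      h.frame.mul_eq_zero_of_ne hc.ne.1 XYe (h.frame.eY i _ _ hc)
    change pathWord _ X Y i n ∈ _
    fin_cases n
    · exact ⟨e i, mem (i, 0), rfl⟩
    · exact ⟨x i, mem (i, 4), hx i⟩
    · exact ⟨y i, mem (i, 6), hy i⟩
    · refine im (m_e i) hC ?_
      rw [add_mul, z1, XYe, add_zero]; rfl
    · refine im (m_e (i + 1)) hC ?_
      rw [add_mul, z2, YXe, zero_add]; rfl
    · refine im (m_x i) hC ?_
      rw [add_mul, hx, z3, add_zero]; rfl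
    · refine im (m_y i) hC ?_
      rw [add_mul, hy, z4, zero_add]; rfl
    · refine im (m_e i) hD ?_
      rw [mul_assoc, h.frame.Ye]; rfl
  refine Submodule.le_of_le_smul_of_le_jacobson_bot Module.Finite.fg_top
    (IsLocalRing.maximalIdeal_le_jacobson ⊥) fun a _ => ?_
  obtain ⟨n, hn, hna⟩ := hmap (Submodule.mem_top (x := r a))
  have : a = n + (a - n) := by abel
  rw [this]
  exact Submodule.add_mem_sup hn (h.mem_of_eq_zero _ (by
    rw [map_sub, sub_eq_zero]; exact hna.symm))

theorem linearIndependent (h : CentralLift O k r e X Y ι ε pair oct)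
    (ex : ∀ i, e i * x i = x i) (xe : ∀ i, x i * e (i + 1) = x i)
    (ey : ∀ i, e (i + 1) * y i = y i) (ye : ∀ i, y i * e i = y i)
    (hx : ∀ i, r (x i) = X i) (hy : ∀ i, r (y i) = Y i) [Module.Free O A]
    (hrank : Module.finrank O A = 24) : LinearIndependent O
      (frameFamily e x y (fun i => pair (some (i + 2)) none) (oct none)) :=
  linearIndependent_of_top_le_span_of_card_eq_finrank (h.top_le_span ex xe ey ye hx hy)
    (by rw [hrank]; rfl)

/-- The Peirce components of an element of `frameFamily`. -/
theorem peirce_frameFamily {C : Type*} [CommRing C] [Algebra C A]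
    (h : CentralFrame e ι ε) (z : ZMod 3 → C) (s : C)
    (ex : ∀ i, e i * x i = x i) (xe : ∀ i, x i * e (i + 1) = x i)
    (ey : ∀ i, e (i + 1) * y i = y i) (ye : ∀ i, y i * e i = y i) (i j : ZMod 3)
    (p : ZMod 3 × Fin 8) :
    e i * frameFamily e x y z s p * e j =
      if (if p.2 = 6 ∨ p.2 = 7 then p.1 + 1 else p.1) = i ∧
        (if p.2 = 4 ∨ p.2 = 5 then p.1 + 1 else p.1) = j then frameFamily e x y z s p else 0 := by
  have key : ∀ {m : A} {a b : ZMod 3}, e a * m = m → m * e b = m →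
      e i * m * e j = if a = i ∧ b = j then m else 0 := by
    intro m a b hl hr
    split_ifs with hab
    · obtain ⟨rfl, rfl⟩ := hab; rw [hl, hr]
    · rw [not_and_or] at hab
      rcases hab with hab | hab
      · rw [← hl, ← mul_assoc, h.orth i a (Ne.symm hab), zero_mul, zero_mul]
      · rw [← hr, mul_assoc, mul_assoc, h.orth b j hab, mul_zero, mul_zero]
  obtain ⟨l, n⟩ := p
  fin_cases n
  · exact key (h.idem l) (h.idem l)
  · exact key (a := l) (b := l) (by simp [frameFamily, h.idem]) (by simp [frameFamily, h.idem])
  · exact key (a := l) (b := l) (by simp [frameFamily, h.idem]) (by simp [frameFamily, h.idem])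
  · exact key (a := l) (b := l) (by simp [frameFamily, h.idem]) (by simp [frameFamily, h.idem])
  · exact key (ex l) (xe l)
  · exact key (a := l) (b := l + 1) (by simp [frameFamily, ex]) (by simp [frameFamily, xe])
  · exact key (ey l) (ye l)
  · exact key (a := l + 1) (b := l) (by simp [frameFamily, ey]) (by simp [frameFamily, ye])

end CentralLift

namespace CentralFrame

open CharIndex

variable {A L : Type*} [Ring A] [Ring L] {e : ZMod 3 → A} {ι : A →+* L} {ε : CharIndex → L}

/-- `centralSum` as a ring homomorphism. -/
def sumHom (h : CentralFrame e ι ε) : (CharIndex → ℤ) →+* L where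
  toFun := centralSum ε
  map_one' := h.centralSum_one
  map_mul' f g := (h.centralSum_mul f g).symm
  map_zero' := by simp [centralSum]
  map_add' := centralSum_add

theorem smul_eq_smul {C : Type*} [CommRing C] [Algebra C A] (h : CentralFrame e ι ε)
    {c c' : C} {m : A} {i j : ZMod 3} (hl : e i * m = m)
    (hr : m * e j = m) {f g : CharIndex → ℤ} (hc : ι.comp (algebraMap C A) c = h.sumHom f)
    (hc' : ι.comp (algebraMap C A) c' = h.sumHom g)
    (hfg : ∀ t, supp i t → supp j t → f t = g t) : c • m = c' • m := by
  rw [Algebra.smul_def, Algebra.smul_def]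
  exact h.mul_eq_mul hl hr hc hc' hfg

theorem eq_of_sumHom {C : Type*} [CommRing C] [Algebra C A] (h : CentralFrame e ι ε)
    (hinj : Function.Injective (algebraMap C A))
    {c c' : C} {f g : CharIndex → ℤ} (hc : ι.comp (algebraMap C A) c = h.sumHom f)
    (hc' : ι.comp (algebraMap C A) c' = h.sumHom g) (hfg : f = g) : c = c' :=
  hinj (h.inj (by rw [hfg] at hc; exact hc.trans hc'.symm))

end CentralFrame

namespace CentralLift

open CharIndex

variable {O k A B L : Type*} [CommRing O] [IsLocalRing O] [CommRing k]
    [Algebra O k] [Ring A] [Ring B] [Ring L] [Algebra O A] [Algebra k B] [Algebra O B]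
    {r : A →ₐ[O] B} {e : ZMod 3 → A} {X Y : ZMod 3 → B} {ι : A →+* L}
    {ε : CharIndex → L} {pair : Option (ZMod 3) → Option (ZMod 3) → Subalgebra.center O A}
    {oct : Option (ZMod 3) → Subalgebra.center O A}

/-- An element of a Peirce component is a combination of the members of `frameFamily` in this
component. -/
theorem exists_eq_sum [IsScalarTower O k B] [Module.Finite O A] {x y : ZMod 3 → A}
    (h : CentralLift O k r e X Y ι ε pair oct)
    (ex : ∀ i, e i * x i = x i) (xe : ∀ i, x i * e (i + 1) = x i)
    (ey : ∀ i, e (i + 1) * y i = y i) (ye : ∀ i, y i * e i = y i)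
    (hx : ∀ i, r (x i) = X i) (hy : ∀ i, r (y i) = Y i) {i j : ZMod 3} {m : A}
    (hl : e i * m = m) (hr : m * e j = m) (S : Finset (ZMod 3 × Fin 8))
    (hS : Finset.univ.filter (fun p : ZMod 3 × Fin 8 =>
      (if p.2 = 6 ∨ p.2 = 7 then p.1 + 1 else p.1) = i ∧
        (if p.2 = 4 ∨ p.2 = 5 then p.1 + 1 else p.1) = j) = S) :
    ∃ c : ZMod 3 × Fin 8 → O, m = ∑ p ∈ S, c p •
      frameFamily e x y (fun i => pair (some (i + 2)) none) (oct none) p := by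
  obtain ⟨c, hc⟩ := Submodule.mem_span_range_iff_exists_fun O |>.1
    (h.top_le_span ex xe ey ye hx hy (Submodule.mem_top (x := m)))
  refine ⟨c, ?_⟩
  have hm : m = e i * m * e j := by rw [hl, hr]
  rw [hm, ← hc, Finset.mul_sum, Finset.sum_mul, ← hS, Finset.sum_filter]
  refine Finset.sum_congr rfl fun p _ => ?_
  rw [mul_smul_comm, smul_mul_assoc, peirce_frameFamily h.toCentralFrame _ _ ex xe ey ye]
  split_ifs <;> simp

variable [IsDomain O] [CharZero O]

/-- The lifts of the arrows form a frame. -/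
theorem peirceFrame [IsScalarTower O k B] [Module.Finite O A] [Module.Free O A] {x y : ZMod 3 → A}
    (h : CentralLift O k r e X Y ι ε pair oct)
    (ex : ∀ i, e i * x i = x i) (xe : ∀ i, x i * e (i + 1) = x i)
    (ey : ∀ i, e (i + 1) * y i = y i) (ye : ∀ i, y i * e i = y i)
    (hx : ∀ i, r (x i) = X i) (hy : ∀ i, r (y i) = Y i) (hrank : Module.finrank O A = 24) :
    PeirceFrame O (Subalgebra.center O A) e x y (fun i => pair (some (i + 2)) none) (oct none) := by
  have hli := h.linearIndependent ex xe ey ye hx hy hrank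
  have hz : ∀ i, ι.comp (algebraMap (Subalgebra.center O A) A) (pair (some (i + 2)) none) =
    h.toCentralFrame.sumHom (edgeFun i) := h.edge_eq
  have hs : ι.comp (algebraMap (Subalgebra.center O A) A) (oct none) =
    h.toCentralFrame.sumHom (octFun none) := h.oct_eq none
  have hz2 : ∀ i, ι.comp (algebraMap (Subalgebra.center O A) A) (pair (some (i + 2)) none - 2) =
      h.toCentralFrame.sumHom (edgeFun i - 2) := fun i => by
    rw [map_sub h.toCentralFrame.sumHom, ← hz, map_ofNat]
    refine eq_sub_of_add_eq ?_
    rw [← map_ofNat (ι.comp (algebraMap (Subalgebra.center O A) A)) 2, ← map_add, sub_add_cancel]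
  have hinj : Function.Injective (algebraMap (Subalgebra.center O A) A) :=
    Subtype.coe_injective
  refine ⟨h.idem, h.orth, h.sum_eq_one, ex, ?_, ?_, ye, ?_, ?_, ?_, ?_, ?_, ?_, ?_, ?_, ?_, ?_, ?_,
    ?_, ?_, ?_⟩
  · rintro i _ _ ⟨rfl, rfl⟩; exact xe i
  · rintro i _ _ ⟨rfl, rfl⟩; exact ey i
  · intro i
    refine h.toCentralFrame.smul_eq_smul (h.idem i) (h.idem i) (f := edgeFun i * edgeFun i)
      (g := 2 * edgeFun i + octFun none) (by simp only [map_mul, hz])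
      (by simp only [map_mul, map_add, map_ofNat, hz, hs]) ?_
    revert i; decide +kernel
  · rintro i _ _ ⟨rfl, rfl⟩
    refine h.toCentralFrame.smul_eq_smul (h.idem _) (h.idem _) (f := edgeFun i * edgeFun i)
      (g := 2 * edgeFun i + octFun none) (by simp only [map_mul, hz])
      (by simp only [map_mul, map_add, map_ofNat, hz, hs]) ?_
    revert i; decide +kernel
  · intro i j hij
    refine h.toCentralFrame.eq_of_sumHom hinj (f := edgeFun i * edgeFun j)
      (g := 2 * octFun none) (by simp only [map_mul, hz])
      (by simp only [map_mul, map_add, map_ofNat, hz, hs]) ?_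
    revert i j; decide +kernel
  · intro i
    refine h.toCentralFrame.eq_of_sumHom hinj (f := edgeFun i * octFun none)
      (g := 4 * octFun none) (by simp only [map_mul, hz, hs])
      (by simp only [map_mul, map_add, map_ofNat, hz, hs]) ?_
    revert i; decide +kernel
  · refine h.toCentralFrame.eq_of_sumHom hinj (f := octFun none * octFun none)
      (g := 8 * octFun none) (by simp only [map_mul, hz, hs])
      (by simp only [map_mul, map_add, map_ofNat, hz, hs]) ?_
    decide +kernel
  · rintro i _ _ ⟨rfl, rfl⟩ m hl hr
    refine h.toCentralFrame.smul_eq_smul hl hr (f := octFun none) (g := 4 * (edgeFun i - 2)) hs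
      (by rw [map_mul, map_mul, map_ofNat, map_ofNat]; exact congrArg (4 * ·) (hz2 i)) ?_
    clear hl hr m; revert i; decide +kernel
  · rintro i _ _ ⟨rfl, rfl⟩ m hl hr
    refine h.toCentralFrame.smul_eq_smul hl hr (f := octFun none) (g := 4 * (edgeFun i - 2)) hs
      (by rw [map_mul, map_mul, map_ofNat, map_ofNat]; exact congrArg (4 * ·) (hz2 i)) ?_
    clear hl hr m; revert i; decide +kernel
  · intro m hm
    have : (2 : O) • m = 0 := by
      rw [← hm, Algebra.smul_def, Algebra.smul_def, map_ofNat, map_ofNat]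
    exact (smul_eq_zero.1 this).resolve_left two_ne_zero
  · rintro i _ _ ⟨rfl, rfl⟩ m hl hr
    obtain ⟨c, hc⟩ := h.exists_eq_sum ex xe ey ye hx hy hl hr {(i, 0), (i, 1), (i, 2), (i, 3)}
      (by clear hl hr m; revert i; decide +kernel)
    refine ⟨c (i, 0), c (i, 1), c (i, 2), c (i, 3), ?_⟩
    rw [hc]
    simp [Finset.sum_insert, frameFamily, add_assoc]
  · rintro i _ _ ⟨rfl, rfl⟩ a b c d habcd
    have := Fintype.linearIndependent_iff.1 (hli.comp (fun n : Fin 4 => (i, ![0, 1, 2, 3] n))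
      (by intro n m; revert n m; simp only [Prod.mk.injEq]; decide)) ![a, b, c, d]
      (by rw [Fin.sum_univ_four]; exact habcd)
    exact ⟨this 0, this 1, this 2, this 3⟩
  · rintro i _ _ ⟨rfl, rfl⟩ m hl hr
    obtain ⟨c, hc⟩ := h.exists_eq_sum ex xe ey ye hx hy hl hr {(i, 4), (i, 5)}
      (by clear hl hr m; revert i; decide +kernel)
    refine ⟨c (i, 4), c (i, 5), ?_⟩
    rw [hc]
    simp [Finset.sum_insert, frameFamily]
  · intro i a b hab
    have := Fintype.linearIndependent_iff.1 (hli.comp (fun n : Fin 2 => (i, ![4, 5] n))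
      (by intro n m; revert n m; simp only [Prod.mk.injEq]; decide)) ![a, b]
      (by rw [Fin.sum_univ_two]; exact hab)
    exact ⟨this 0, this 1⟩
  · rintro i _ _ ⟨rfl, rfl⟩ m hl hr
    obtain ⟨c, hc⟩ := h.exists_eq_sum ex xe ey ye hx hy hl hr {(i, 6), (i, 7)}
      (by clear hl hr m; revert i; decide +kernel)
    refine ⟨c (i, 6), c (i, 7), ?_⟩
    rw [hc]
    simp [Finset.sum_insert, frameFamily]
  · intro i a b hab
    have := Fintype.linearIndependent_iff.1 (hli.comp (fun n : Fin 2 => (i, ![6, 7] n))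
      (by intro n m; revert n m; simp only [Prod.mk.injEq]; decide)) ![a, b]
      (by rw [Fin.sum_univ_two]; exact hab)
    exact ⟨this 0, this 1⟩

/-- An order whose center and whose reduction modulo two have the form of those of the group ring
of `Ã₄` is isomorphic to the algebra given by generators and relations. -/
theorem nonempty_algEquiv {k B : Type*} [Field k] [Algebra O k] [Ring B] [Algebra k B]
    [Algebra O B] [IsScalarTower O k B]
    {r : A →ₐ[O] B} {X Y : ZMod 3 → B} [Module.Finite O A] [Module.Free O A]
    (h : CentralLift O k r e X Y ι ε pair oct) (hrank : Module.finrank O A = 24)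
    (hrank' : Module.finrank k B = 24) {t : O} (ht : 3 * t = 1) :
    Nonempty (A ≃ₐ[O] PresAlgebra O) := by
  obtain ⟨x, y, ex, xe, ey, ye, hx, hy⟩ := h.exists_arrows
  have hF := h.peirceFrame ex xe ey ye hx hy hrank
  have hli : LinearIndependent k
      (fun p : ZMod 3 × Fin 8 => pathWord (fun i => r (e i)) X Y p.1 p.2) :=
    linearIndependent_of_top_le_span_of_card_eq_finrank h.frame.top_le_span (by rw [hrank']; rfl)
  have hXYXY : ∀ i, X i * Y i * X i * Y i ≠ 0 := fun i => hli.ne_zero (i, 7)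
  have unit_of : ∀ {a : O}, algebraMap O k a ≠ 0 → IsUnit a := fun {a} ha => by
    by_contra hu
    exact ha (h.algebraMap_eq_zero a ((IsLocalRing.mem_maximalIdeal a).2 hu))
  have rsmul : ∀ (a : O) (c : Subalgebra.center O A) (m : A),
      r (a • c • m) = algebraMap O k a • (r c * r m) := fun a c m => by
    rw [map_smul, algebraMap_smul, ← map_mul]; rfl
  have h2k : (2 : k) = 0 := by
    have := h.algebraMap_eq_zero 2 h.two_mem
    rwa [map_ofNat] at this
  have h8 : r (oct none) * r (oct none) = 0 := by
    have := congrArg (fun c => r (algebraMap (Subalgebra.center O A) A c)) hF.ss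
    have h8 : (8 : B) = 0 := by
      have := congrArg (algebraMap k B) h2k
      rw [map_ofNat, map_zero] at this
      rw [show (8 : B) = 4 * 2 by norm_num, this, mul_zero]
    simp only [map_mul, map_ofNat, h8, zero_mul] at this
    exact this
  obtain ⟨x', y', hF', hxy, hxxx⟩ := hF.exists_normalized (fun i b d hbd => by
      have hb : IsUnit b := by
        apply unit_of
        intro hb
        apply hXYXY i
        have h1 := congrArg r hbd
        rw [map_mul, hx, hy, map_add, rsmul, rsmul, hb, zero_smul, zero_add] at h1
        have comm : r (e i) * r (oct none) = r (oct none) * r (e i) := by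
          rw [← map_mul, ← map_mul]
          exact congrArg r (Subalgebra.mem_center_iff.1 (oct none).2 (e i))
        rw [mul_assoc, h1, smul_mul_smul_comm, mul_assoc, ← mul_assoc (r (e i)), comm,
          mul_assoc, ← mul_assoc, h8, zero_mul, smul_zero]
      refine ⟨hb, ?_⟩
      apply unit_of
      rw [map_add, map_mul, map_ofNat, h2k, zero_mul, add_zero]
      exact (hb.map (algebraMap O k)).ne_zero)
    (fun d hd => by
      apply unit_of
      intro hd'
      apply hXYXY 0
      have h1 := congrArg r hd
      rw [map_mul, map_mul, hx, hx, hx, rsmul, hd', zero_smul] at h1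
      rw [← h.frame.XXX 0 1 2 (by unfold Cyc; decide), h1])
  exact PresAlgebra.nonempty_algEquiv (hF'.quiverRelations hxy hxxx) ht
    (hF'.adjoin_eq_top hxy hxxx) (Module.finBasis O A) (by simp [hrank])

end CentralLift

/-! ### The irreducible representations of `Ã₄` -/

namespace TetraRelations

open QuaternionGroup

variable {R B : Type*} [CommRing R] [Ring B] [Algebra R B] {I J K Z C : B}

variable (I J K Z) in
/-- The image of an element of `Q₈` under the homomorphism with `i ↦ I`, `j ↦ J`. -/
def quatFun : QuaternionGroup 2 → B
  | a n => if n = 0 then 1 else if n = 1 then I else if n = 2 then Z else Z * I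
  | xa n => if n = 0 then J else if n = 1 then Z * K else if n = 2 then Z * J else K

theorem quatFun_mul (h : TetraRelations I J K Z C) (p q : QuaternionGroup 2) :
    quatFun I J K Z (p * q) = quatFun I J K Z p * quatFun I J K Z q := by
  have cases : ∀ n : ZMod (2 * 2), n = 0 ∨ n = 1 ∨ n = 2 ∨ n = 3 := by decide
  have h4 : ((2 : ℕ) : ZMod (2 * 2)) = 2 := by decide
  rcases p with n | n <;> rcases q with m | m <;>
    rcases cases n with rfl | rfl | rfl | rfl <;> rcases cases m with rfl | rfl | rfl | rfl <;>
    simp (decide := true) only [a_mul_a, a_mul_xa, xa_mul_a, xa_mul_xa, quatFun, if_true, if_false,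
      mul_assoc, one_mul, mul_one, h.II, h.JJ, h.KK, h.IJ, h.JK, h.KI, h.JI, h.KJ, h.IK, h.IZ, h.JZ,
      h.KZ, h.ZZ, h.ZZ_assoc, h.IZ_assoc, h.JZ_assoc, h.KZ_assoc]

theorem C_mul_quatFun (h : TetraRelations I J K Z C) (p : QuaternionGroup 2) :
    C * quatFun I J K Z p = quatFun I J K Z (Atilde4.rot p) * C := by
  have cases : ∀ n : ZMod (2 * 2), n = 0 ∨ n = 1 ∨ n = 2 ∨ n = 3 := by decide
  have CZ' : ∀ x, C * (Z * x) = Z * (C * x) := fun x => by rw [← mul_assoc, h.CZ, mul_assoc]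
  change C * quatFun I J K Z p = quatFun I J K Z (Atilde4.rotFun p) * C
  rcases p with n | n <;>
    rcases cases n with rfl | rfl | rfl | rfl <;>
    simp (decide := true) only [quatFun, Atilde4.rotFun, CZ', h.CZ, h.CI, h.CJ, h.CK, if_true,
      if_false, mul_assoc, one_mul, mul_one]

theorem C_pow_mul_quatFun (h : TetraRelations I J K Z C) (n : ℕ) (p : QuaternionGroup 2) :
    C ^ n * quatFun I J K Z p = quatFun I J K Z ((Atilde4.rot ^ n) p) * C ^ n := by
  induction n with
  | zero => simp
  | succ n ih =>
    rw [pow_succ', mul_assoc, ih, ← mul_assoc, h.C_mul_quatFun, mul_assoc]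
    congr 2
    rw [pow_succ']; rfl

/-- The homomorphism from `Ã₄` given by elements with the relations of its generators. -/
def monoidHom (h : TetraRelations I J K Z C) : Atilde4 →* B where
  toFun g := quatFun I J K Z g.left * C ^ g.right.toAdd.val
  map_one' := by
    change quatFun I J K Z (a 0) * C ^ (0 : ZMod 3).val = 1
    simp [quatFun]
  map_mul' g g' := by
    have hC : C ^ 3 = 1 := by rw [pow_succ', pow_two, h.CCC]
    rw [SemidirectProduct.mul_left, SemidirectProduct.mul_right, h.quatFun_mul, toAdd_mul,
      ZMod.val_add, ← pow_eq_pow_mod _ hC, pow_add, mul_assoc, mul_assoc, ← mul_assoc (C ^ _),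
      h.C_pow_mul_quatFun, mul_assoc]
    rfl

/-- The algebra homomorphism from the group algebra of `Ã₄` given by elements with the relations of
its generators. -/
noncomputable def algHom (h : TetraRelations I J K Z C) : MonoidAlgebra R Atilde4 →ₐ[R] B :=
  MonoidAlgebra.lift R B Atilde4 h.monoidHom

theorem algHom_of (h : TetraRelations I J K Z C) (g : Atilde4) :
    h.algHom (MonoidAlgebra.of R Atilde4 g) = quatFun I J K Z g.left * C ^ g.right.toAdd.val := by
  simp [algHom, monoidHom, MonoidAlgebra.lift_of]

theorem algHom_genC (h : TetraRelations I J K Z C) : h.algHom (Atilde4.genC R) = C := by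
  rw [Atilde4.genC, algHom_of]
  change quatFun I J K Z (a 0) * C ^ (1 : ZMod 3).val = C
  simp [quatFun, show (1 : ZMod 3).val = 1 from rfl]

end TetraRelations

namespace CharIndex

/-- The degree of an irreducible character. -/
def dim : CharIndex → ℕ
  | .inl (some _) => 1
  | .inl none => 3
  | .inr _ => 2

variable {R : Type*} [CommRing R] (ω t : R)

/-- The square matrices of the size of an irreducible representation. -/
abbrev Mat (R : Type*) (τ : CharIndex) : Type _ := Matrix (Fin (dim τ)) (Fin (dim τ)) R

/-- The image of `i`. -/
def matI : (τ : CharIndex) → Mat R τ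
  | .inl (some _) => 1
  | .inl none => !![1, 0, 0; 0, -1, 0; 0, 0, -1]
  | .inr _ => !![t * (ω ^ 2 - ω), 1; -2 * t, -(t * (ω ^ 2 - ω))]

/-- The image of `j`. -/
def matJ : (τ : CharIndex) → Mat R τ
  | .inl (some _) => 1
  | .inl none => !![-1, 0, 0; 0, 1, 0; 0, 0, -1]
  | .inr _ => !![t * (ω ^ 2 - ω), ω ^ 2; -2 * t * ω, -(t * (ω ^ 2 - ω))]

/-- The image of `k`. -/
def matK : (τ : CharIndex) → Mat R τ
  | .inl (some _) => 1
  | .inl none => !![-1, 0, 0; 0, -1, 0; 0, 0, 1]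
  | .inr _ => !![t * (ω ^ 2 - ω), ω; -2 * t * ω ^ 2, -(t * (ω ^ 2 - ω))]

/-- The image of `-1`. -/
def matZ : (τ : CharIndex) → Mat R τ
  | .inl (some _) => 1
  | .inl none => 1
  | .inr _ => -1

/-- The image of the generator of `C₃`. -/
def matC : (τ : CharIndex) → Mat R τ
  | .inl (some i) => !![ω ^ i.val]
  | .inl none => !![0, 0, 1; 1, 0, 0; 0, 1, 0]
  | .inr k => !![ω ^ (k.val + 1), 0; 0, ω ^ (k.val + 2)]

theorem tetraRelations_two {ω t : R} (hω : ω ^ 2 + ω + 1 = 0) (ht : 3 * t = 1) (n : ℕ) :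
    TetraRelations (!![t * (ω ^ 2 - ω), 1; -2 * t, -(t * (ω ^ 2 - ω))] : Matrix (Fin 2) (Fin 2) R)
      !![t * (ω ^ 2 - ω), ω ^ 2; -2 * t * ω, -(t * (ω ^ 2 - ω))]
      !![t * (ω ^ 2 - ω), ω; -2 * t * ω ^ 2, -(t * (ω ^ 2 - ω))] (-1)
      !![ω ^ (n + 1), 0; 0, ω ^ (n + 2)] := by
  have h3 : ω ^ 3 = 1 := by linear_combination (ω - 1) * hω
  have h1 : (ω ^ n) ^ 3 = 1 := by rw [← pow_mul, mul_comm, pow_mul, h3, one_pow]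
  constructor <;> ext a b <;> fin_cases a <;> fin_cases b <;>
    simp [pow_add, Matrix.mul_apply, Fin.sum_univ_two, Matrix.one_apply] <;> grind

theorem tetraRelations_three :
    TetraRelations (!![1, 0, 0; 0, -1, 0; 0, 0, -1] : Matrix (Fin 3) (Fin 3) R)
      !![-1, 0, 0; 0, 1, 0; 0, 0, -1] !![-1, 0, 0; 0, -1, 0; 0, 0, 1] 1
      !![0, 0, 1; 1, 0, 0; 0, 1, 0] := by
  constructor <;> ext a b <;> fin_cases a <;> fin_cases b <;>
    simp [Matrix.mul_apply, Fin.sum_univ_three, Matrix.one_apply]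

theorem tetraRelations_one {ω : R} (hω : ω ^ 2 + ω + 1 = 0) (n : ℕ) :
    TetraRelations (1 : Matrix (Fin 1) (Fin 1) R) 1 1 1 !![ω ^ n] := by
  have h3 : ω ^ 3 = 1 := by linear_combination (ω - 1) * hω
  have h1 : (ω ^ n) ^ 3 = 1 := by rw [← pow_mul, mul_comm, pow_mul, h3, one_pow]
  constructor <;> ext a b <;> fin_cases a <;> fin_cases b <;>
    simp [Matrix.mul_apply, Matrix.one_apply]
  linear_combination h1

/-- The matrices of each irreducible representation satisfy the relations of `Ã₄`. -/
theorem matRelations {ω t : R} (hω : ω ^ 2 + ω + 1 = 0) (ht : 3 * t = 1) : ∀ τ : CharIndex,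
    TetraRelations (matI ω t τ) (matJ ω t τ) (matK ω t τ) (matZ τ) (matC ω τ)
  | .inl (some i) => tetraRelations_one hω i.val
  | .inl none => tetraRelations_three
  | .inr k => tetraRelations_two hω ht k.val

end CharIndex

/-! ### The character table of `Ã₄` -/

namespace TetraRelations

open QuaternionGroup Atilde4

variable {R B : Type*} [CommRing R] [Ring B] [Algebra R B] {I J K Z C : B}

theorem quatFun_eq (I J K Z : B) : quatFun I J K Z (a 0) = 1 ∧ quatFun I J K Z (a 1) = I ∧
    quatFun I J K Z (a 2) = Z ∧ quatFun I J K Z (a 3) = Z * I ∧ quatFun I J K Z (xa 0) = J ∧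
    quatFun I J K Z (xa 1) = Z * K ∧ quatFun I J K Z (xa 2) = Z * J ∧
    quatFun I J K Z (xa 3) = K := by
  simp (decide := true) only [quatFun, if_true, if_false, and_true]

theorem algHom_classRep (h : TetraRelations I J K Z C) (i : Fin 7) :
    h.algHom (MonoidAlgebra.of R Atilde4 (classRep i)) =
      ![1, Z, I, C, Z * C, C * C, Z * (C * C)] i := by
  obtain ⟨q0, q1, q2, -, -, -, -, -⟩ := quatFun_eq I J K Z
  have v0 : (0 : ZMod 3).val = 0 := rfl
  have v1 : (1 : ZMod 3).val = 1 := rfl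
  have v2 : (2 : ZMod 3).val = 2 := rfl
  rw [algHom_of]
  have q0' : quatFun I J K Z 1 = 1 := q0
  fin_cases i <;> simp [classRep, q0', q1, q2, v0, v1, v2, pow_two]

theorem algHom_classSum (h : TetraRelations I J K Z C) (i : Fin 7) :
    h.algHom (classSum R i) =
      ![1, Z, (1 + Z) * (I + J + K), (1 + Z * I + Z * J + Z * K) * C,
        (Z + I + J + K) * C, (1 + I + J + K) * (C * C),
        (Z + Z * I + Z * J + Z * K) * (C * C)] i := by
  obtain ⟨q0, q1, q2, q3, q4, q5, q6, q7⟩ := quatFun_eq I J K Z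
  have v0 : (0 : ZMod 3).val = 0 := rfl
  have v1 : (1 : ZMod 3).val = 1 := rfl
  have v2 : (2 : ZMod 3).val = 2 := rfl
  let m (q : QuaternionGroup 2) (c : ZMod 3) : Atilde4 := ⟨q, Multiplicative.ofAdd c⟩
  have hm : ∀ q c, h.algHom (MonoidAlgebra.of R Atilde4 (m q c)) =
      quatFun I J K Z q * C ^ c.val := fun q c => h.algHom_of _
  have key : ∀ S : Finset Atilde4, (Finset.univ.filter fun g => classIndex g = i) = S →
      h.algHom (classSum R i) = ∑ g ∈ S, h.algHom (MonoidAlgebra.of R Atilde4 g) := by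
    rintro S rfl
    rw [classSum, map_sum, Finset.sum_filter]
    refine Finset.sum_congr rfl fun g _ => ?_
    split_ifs <;> simp
  fin_cases i
  · rw [key {m (a 0) 0} (by decide +kernel), Finset.sum_singleton, hm, q0]
    simp [v0]
  · rw [key {m (a 2) 0} (by decide +kernel), Finset.sum_singleton, hm]
    simp [q2, v0]
  · rw [key {m (a 1) 0, m (a 3) 0, m (xa 0) 0, m (xa 1) 0, m (xa 2) 0, m (xa 3) 0}
      (by decide +kernel)]
    repeat rw [Finset.sum_insert (by decide)]
    rw [Finset.sum_singleton]
    simp only [hm, q1, q3, q4, q5, q6, q7, v0, pow_zero, mul_one]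
    change _ = (1 + Z) * (I + J + K)
    noncomm_ring
  · rw [key {m (a 0) 1, m (a 3) 1, m (xa 2) 1, m (xa 1) 1} (by decide +kernel)]
    repeat rw [Finset.sum_insert (by decide)]
    rw [Finset.sum_singleton]
    simp only [hm, q0, q3, q5, q6, v1, pow_one]
    change _ = (1 + Z * I + Z * J + Z * K) * C
    noncomm_ring
  · rw [key {m (a 2) 1, m (a 1) 1, m (xa 0) 1, m (xa 3) 1} (by decide +kernel)]
    repeat rw [Finset.sum_insert (by decide)]
    rw [Finset.sum_singleton]
    simp only [hm, q1, q2, q4, q7, v1, pow_one]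
    change _ = (Z + I + J + K) * C
    noncomm_ring
  · rw [key {m (a 0) 2, m (a 1) 2, m (xa 0) 2, m (xa 3) 2} (by decide +kernel)]
    repeat rw [Finset.sum_insert (by decide)]
    rw [Finset.sum_singleton]
    simp only [hm, q0, q1, q4, q7, v2, pow_two]
    change _ = (1 + I + J + K) * (C * C)
    noncomm_ring
  · rw [key {m (a 2) 2, m (a 3) 2, m (xa 2) 2, m (xa 1) 2} (by decide +kernel)]
    repeat rw [Finset.sum_insert (by decide)]
    rw [Finset.sum_singleton]
    simp only [hm, q2, q3, q5, q6, v2, pow_two]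
    change _ = (Z + Z * I + Z * J + Z * K) * (C * C)
    noncomm_ring

end TetraRelations

namespace CharIndex

open Atilde4

variable {R : Type*} [CommRing R]

/-- The character table. -/
def charTable (ω : R) : CharIndex → Fin 7 → R
  | .inl (some i) => ![1, 1, 1, ω ^ i.val, ω ^ i.val, (ω ^ i.val) ^ 2, (ω ^ i.val) ^ 2]
  | .inl none => ![3, 3, -1, 0, 0, 0, 0]
  | .inr k => ![2, -2, 0, -ω ^ k.val, ω ^ k.val, -(ω ^ k.val) ^ 2, (ω ^ k.val) ^ 2]

/-- The scalars by which the class sums act on the irreducible representations. -/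
def centralTable (ω : R) : CharIndex → Fin 7 → R
  | .inl (some i) =>
    ![1, 1, 6, 4 * ω ^ i.val, 4 * ω ^ i.val, 4 * (ω ^ i.val) ^ 2, 4 * (ω ^ i.val) ^ 2]
  | .inl none => ![1, 1, -2, 0, 0, 0, 0]
  | .inr k => ![1, -1, 0, -2 * ω ^ k.val, 2 * ω ^ k.val, -2 * (ω ^ k.val) ^ 2, 2 * (ω ^ k.val) ^ 2]

/-- The irreducible representations of `Ã₄`. -/
noncomputable def rep {ω t : R} (hω : ω ^ 2 + ω + 1 = 0) (ht : 3 * t = 1) (τ : CharIndex) :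
    MonoidAlgebra R Atilde4 →ₐ[R] Mat R τ :=
  (matRelations hω ht τ).algHom

variable {ω t : R} (hω : ω ^ 2 + ω + 1 = 0) (ht : 3 * t = 1)

theorem trace_classRep_two {ω t : R} (hω : ω ^ 2 + ω + 1 = 0) (n : ℕ) (i : Fin 7) :
    Matrix.trace ((![1, -1, !![t * (ω ^ 2 - ω), 1; -2 * t, -(t * (ω ^ 2 - ω))],
      !![ω ^ (n + 1), 0; 0, ω ^ (n + 2)], -1 * !![ω ^ (n + 1), 0; 0, ω ^ (n + 2)],
      !![ω ^ (n + 1), 0; 0, ω ^ (n + 2)] * !![ω ^ (n + 1), 0; 0, ω ^ (n + 2)],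
      -1 * (!![ω ^ (n + 1), 0; 0, ω ^ (n + 2)] * !![ω ^ (n + 1), 0; 0, ω ^ (n + 2)])] :
        Fin 7 → Matrix (Fin 2) (Fin 2) R) i) =
    (![2, -2, 0, -ω ^ n, ω ^ n, -(ω ^ n) ^ 2, (ω ^ n) ^ 2] : Fin 7 → R) i := by
  fin_cases i <;> simp [Matrix.trace, Fin.sum_univ_two, pow_add, Matrix.one_apply] <;> grind

theorem trace_classRep_three (i : Fin 7) :
    Matrix.trace ((![1, 1, !![1, 0, 0; 0, -1, 0; 0, 0, -1], !![0, 0, 1; 1, 0, 0; 0, 1, 0],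
      1 * !![0, 0, 1; 1, 0, 0; 0, 1, 0],
      !![0, 0, 1; 1, 0, 0; 0, 1, 0] * !![0, 0, 1; 1, 0, 0; 0, 1, 0],
      1 * (!![0, 0, 1; 1, 0, 0; 0, 1, 0] * !![0, 0, 1; 1, 0, 0; 0, 1, 0])] :
        Fin 7 → Matrix (Fin 3) (Fin 3) R) i) =
    (![3, 3, -1, 0, 0, 0, 0] : Fin 7 → R) i := by
  fin_cases i <;> simp [Matrix.trace, Fin.sum_univ_three, Matrix.one_apply]

theorem trace_classRep_one (n : ℕ) (i : Fin 7) :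
    Matrix.trace ((![1, 1, 1, !![ω ^ n], 1 * !![ω ^ n], !![ω ^ n] * !![ω ^ n],
      1 * (!![ω ^ n] * !![ω ^ n])] : Fin 7 → Matrix (Fin 1) (Fin 1) R) i) =
    (![1, 1, 1, ω ^ n, ω ^ n, (ω ^ n) ^ 2, (ω ^ n) ^ 2] : Fin 7 → R) i := by
  fin_cases i <;> simp [Matrix.trace, pow_two]

theorem trace_rep_classRep (τ : CharIndex) (i : Fin 7) :
    Matrix.trace (rep hω ht τ (MonoidAlgebra.of R Atilde4 (classRep i))) = charTable ω τ i := by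
  rw [rep, TetraRelations.algHom_classRep]
  rcases τ with (_ | j) | k
  · exact trace_classRep_three i
  · exact trace_classRep_one j.val i
  · exact trace_classRep_two hω k.val i

theorem trace_rep_of (τ : CharIndex) (g : Atilde4) :
    Matrix.trace (rep hω ht τ (MonoidAlgebra.of R Atilde4 g)) = charTable ω τ (classIndex g) := by
  obtain ⟨x, hx⟩ := exists_conj g
  have : g = x⁻¹ * (classRep (classIndex g) * x) := by rw [← hx, inv_mul_cancel_left]
  rw [← trace_rep_classRep hω ht]
  conv_lhs => rw [this]
  rw [map_mul, map_mul, map_mul, map_mul, Matrix.trace_mul_comm, mul_assoc, ← map_mul (rep hω ht τ),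
    ← map_mul (MonoidAlgebra.of R Atilde4), mul_inv_cancel, map_one, map_one, mul_one]

/-- The scalars of the class sums in the three types of representations. -/
theorem classSum_two {ω t : R} (hω : ω ^ 2 + ω + 1 = 0) (ht : 3 * t = 1) (n : ℕ) (i : Fin 7) :
    let I : Matrix (Fin 2) (Fin 2) R := !![t * (ω ^ 2 - ω), 1; -2 * t, -(t * (ω ^ 2 - ω))]
    let J : Matrix (Fin 2) (Fin 2) R := !![t * (ω ^ 2 - ω), ω ^ 2; -2 * t * ω, -(t * (ω ^ 2 - ω))]
    let K : Matrix (Fin 2) (Fin 2) R := !![t * (ω ^ 2 - ω), ω; -2 * t * ω ^ 2, -(t * (ω ^ 2 - ω))]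
    let Z : Matrix (Fin 2) (Fin 2) R := -1
    let C : Matrix (Fin 2) (Fin 2) R := !![ω ^ (n + 1), 0; 0, ω ^ (n + 2)]
    (![1, Z, (1 + Z) * (I + J + K), (1 + Z * I + Z * J + Z * K) * C,
        (Z + I + J + K) * C, (1 + I + J + K) * (C * C),
        (Z + Z * I + Z * J + Z * K) * (C * C)] : Fin 7 → Matrix (Fin 2) (Fin 2) R) i =
    (![1, -1, 0, -2 * ω ^ n, 2 * ω ^ n, -2 * (ω ^ n) ^ 2, 2 * (ω ^ n) ^ 2] : Fin 7 → R) i •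
      (1 : Matrix (Fin 2) (Fin 2) R) := by
  intro I J K Z C
  have h1 : I + J + K = !![ω ^ 2 - ω, 0; 0, -(ω ^ 2 - ω)] := by
    ext a b; fin_cases a <;> fin_cases b <;> simp [I, J, K] <;> grind
  have e1 : 1 + Z * I + Z * J + Z * K = 1 - (I + J + K) := by simp only [Z]; noncomm_ring
  have e2 : Z + I + J + K = - (1 - (I + J + K)) := by simp only [Z]; noncomm_ring
  have e3 : 1 + I + J + K = 1 + (I + J + K) := by abel
  have e4 : Z + Z * I + Z * J + Z * K = - (1 + (I + J + K)) := by simp only [Z]; noncomm_ring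
  rw [e1, e2, e3, e4, h1]
  fin_cases i
  · simp
  · simp [Z]
  · simp [Z]
  all_goals
    ext a b; fin_cases a <;> fin_cases b <;>
      simp [C, Matrix.mul_apply, Fin.sum_univ_two, pow_add, Matrix.one_apply] <;> grind

theorem classSum_three (i : Fin 7) :
    let I : Matrix (Fin 3) (Fin 3) R := !![1, 0, 0; 0, -1, 0; 0, 0, -1]
    let J : Matrix (Fin 3) (Fin 3) R := !![-1, 0, 0; 0, 1, 0; 0, 0, -1]
    let K : Matrix (Fin 3) (Fin 3) R := !![-1, 0, 0; 0, -1, 0; 0, 0, 1]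
    let Z : Matrix (Fin 3) (Fin 3) R := 1
    let C : Matrix (Fin 3) (Fin 3) R := !![0, 0, 1; 1, 0, 0; 0, 1, 0]
    (![1, Z, (1 + Z) * (I + J + K), (1 + Z * I + Z * J + Z * K) * C,
        (Z + I + J + K) * C, (1 + I + J + K) * (C * C),
        (Z + Z * I + Z * J + Z * K) * (C * C)] : Fin 7 → Matrix (Fin 3) (Fin 3) R) i =
    (![1, 1, -2, 0, 0, 0, 0] : Fin 7 → R) i • (1 : Matrix (Fin 3) (Fin 3) R) := by
  intro I J K Z C
  have h1 : I + J + K = -1 := by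
    ext a b; fin_cases a <;> fin_cases b <;> simp [I, J, K]
  have e1 : 1 + Z * I + Z * J + Z * K = 1 + (I + J + K) := by simp only [Z]; noncomm_ring
  have e2 : Z + I + J + K = 1 + (I + J + K) := by simp only [Z]; abel
  rw [e1, e2, h1]
  fin_cases i <;> simp [Z]
  rw [two_smul, neg_add]

theorem classSum_one (n : ℕ) (i : Fin 7) :
    let C : Matrix (Fin 1) (Fin 1) R := !![ω ^ n]
    (![1, 1, (1 + 1) * (1 + 1 + 1), (1 + 1 * 1 + 1 * 1 + 1 * 1) * C,
        (1 + 1 + 1 + 1) * C, (1 + 1 + 1 + 1) * (C * C),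
        (1 + 1 * 1 + 1 * 1 + 1 * 1) * (C * C)] : Fin 7 → Matrix (Fin 1) (Fin 1) R) i =
    (![1, 1, 6, 4 * ω ^ n, 4 * ω ^ n, 4 * (ω ^ n) ^ 2, 4 * (ω ^ n) ^ 2] : Fin 7 → R) i •
      (1 : Matrix (Fin 1) (Fin 1) R) := by
  intro C
  fin_cases i <;> ext a b <;> fin_cases a <;> fin_cases b <;>
    simp [C, Matrix.mul_apply, Matrix.one_apply] <;> ring

theorem rep_classSum (τ : CharIndex) (i : Fin 7) :
    rep hω ht τ (classSum R i) = centralTable ω τ i • (1 : Mat R τ) := by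
  rw [rep, TetraRelations.algHom_classSum]
  rcases τ with (_ | j) | k
  · exact classSum_three i
  · exact classSum_one j.val i
  · exact classSum_two hω ht k.val i

end CharIndex

/-! ### Orthogonality of characters -/

namespace CharIndex

open Atilde4

theorem _root_.ZMod.sum_univ_three {M : Type*} [AddCommMonoid M] (f : ZMod 3 → M) :
    ∑ i, f i = f 0 + f 1 + f 2 := Fin.sum_univ_three f

theorem sum_univ {M : Type*} [AddCommMonoid M] (f : CharIndex → M) :
    ∑ τ, f τ = (f (.inl none) + (f (.inl (some 0)) + f (.inl (some 1)) + f (.inl (some 2)))) +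
      (f (.inr 0) + f (.inr 1) + f (.inr 2)) := by
  rw [Fintype.sum_sum_type, Fintype.sum_option, ZMod.sum_univ_three, ZMod.sum_univ_three]

section Orthogonality

variable {R : Type*} [CommRing R] {ω t : R} (hω : ω ^ 2 + ω + 1 = 0) (ht : 3 * t = 1)

theorem val_zmod : (0 : ZMod 3).val = 0 ∧ (1 : ZMod 3).val = 1 ∧ (2 : ZMod 3).val = 2 :=
  ⟨rfl, rfl, rfl⟩

theorem sum_dim_mul_charTable {ω : R} (hω : ω ^ 2 + ω + 1 = 0) (i : Fin 7) :
    ∑ τ, (dim τ : R) * charTable ω τ i = if i = 0 then 24 else 0 := by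
  obtain ⟨v0, v1, v2⟩ := val_zmod
  rw [sum_univ]
  fin_cases i <;> simp [dim, charTable, v0, v1, v2] <;> grind

/-- The coefficient of `1` is recovered from the regular character. -/
theorem sum_dim_mul_trace_rep (x : MonoidAlgebra R Atilde4) :
    ∑ τ, (dim τ : R) * Matrix.trace (rep hω ht τ x) = 24 * x.coeff 1 := by
  have h1 : ∀ g : Atilde4, classIndex g = 0 ↔ g = 1 := by
    rintro ⟨q, c⟩
    revert q c
    decide +kernel
  conv_lhs => rw [eq_sum_of x]
  simp only [map_sum, map_smul, Matrix.trace_sum, Matrix.trace_smul, trace_rep_of, smul_eq_mul,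
    Finset.mul_sum]
  rw [Finset.sum_comm, Finset.sum_eq_single 1]
  · have := sum_dim_mul_charTable hω (classIndex (1 : Atilde4))
    rw [if_pos ((h1 1).2 rfl)] at this
    rw [← this, Finset.sum_mul]
    exact Finset.sum_congr rfl fun τ _ => by ring
  · intro g _ hg
    have := sum_dim_mul_charTable hω (classIndex g)
    rw [if_neg (mt (h1 g).1 hg)] at this
    calc _ = (∑ τ, (dim τ : R) * charTable ω τ (classIndex g)) * x.coeff g := by
          rw [Finset.sum_mul]
          exact Finset.sum_congr rfl fun τ _ => by ring
      _ = 0 := by rw [this, zero_mul]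
  · simp

/-- In characteristic zero the irreducible representations separate the elements of the group
algebra. -/
theorem eq_of_rep_eq [IsDomain R] [CharZero R] {x y : MonoidAlgebra R Atilde4}
    (h : ∀ τ, rep hω ht τ x = rep hω ht τ y) : x = y := by
  rw [← sub_eq_zero]
  have h0 : ∀ τ, rep hω ht τ (x - y) = 0 := fun τ => by rw [map_sub, h, sub_self]
  generalize x - y = z at h0
  ext g
  have := sum_dim_mul_trace_rep hω ht (z * MonoidAlgebra.of R Atilde4 g⁻¹)
  simp only [map_mul, h0, zero_mul, Matrix.trace_zero, mul_zero, Finset.sum_const_zero,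
    MonoidAlgebra.of_apply, MonoidAlgebra.coeff_mul_single_apply, inv_inv, one_mul, mul_one] at this
  simpa using this.symm

theorem rep_sum_classSum (τ : CharIndex) (c : Fin 7 → R) :
    rep hω ht τ (∑ i, c i • classSum R i) = (∑ i, c i * centralTable ω τ i) • (1 : Mat R τ) := by
  simp only [map_sum, map_smul, rep_classSum, smul_smul, Finset.sum_smul]

/-- The coefficients of the central element with values `octFun`. -/
def octCoeff (ω t : R) : Option (ZMod 3) → Fin 7 → R
  | some i => ![t, t, t, t * (ω ^ i.val) ^ 2, t * (ω ^ i.val) ^ 2, t * ω ^ i.val, t * ω ^ i.val]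
  | none => ![9 * t, 9 * t, -3 * t, 0, 0, 0, 0]

/-- The coefficients of the central element with values `pairFun`. -/
def pairCoeff (ω t : R) : Option (ZMod 3) → Option (ZMod 3) → Fin 7 → R
  | some i, none | none, some i =>
    ![6 * t, 4 * t, -t, 0, t * (ω ^ i.val) ^ 2, 0, t * ω ^ i.val]
  | some i, some j => ![2 * t, 0, t, -t * (ω ^ (-(i + j)).val) ^ 2, 0, -t * ω ^ (-(i + j)).val, 0]
  | none, none => 0

theorem zmod_cases : ∀ i : ZMod 3, i = 0 ∨ i = 1 ∨ i = 2 := by decide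

/-- The central element with coefficients `octCoeff` takes the values `octFun`. -/
theorem sum_octCoeff {ω t : R} (hω : ω ^ 2 + ω + 1 = 0) (ht : 3 * t = 1) (τ : CharIndex)
    (a : Option (ZMod 3)) :
    ∑ i, octCoeff ω t a i * centralTable ω τ i = (octFun a τ : R) := by
  obtain ⟨v0, v1, v2⟩ := val_zmod
  have h3 : ω ^ 3 = 1 := by linear_combination (ω - 1) * hω
  rcases a with _ | i <;> rcases τ with (_ | j) | j
  all_goals try rcases zmod_cases i with rfl | rfl | rfl
  all_goals try rcases zmod_cases j with rfl | rfl | rfl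
  all_goals
    simp (decide := true) [Fin.sum_univ_succ, octCoeff, centralTable, octFun, v0, v1, v2] <;> grind

theorem sum_pairCoeff_none {ω t : R} (hω : ω ^ 2 + ω + 1 = 0) (ht : 3 * t = 1) (τ : CharIndex)
    (i : ZMod 3) :
    ∑ l, pairCoeff ω t (some i) none l * centralTable ω τ l = (pairFun (some i) none τ : R) := by
  obtain ⟨v0, v1, v2⟩ := val_zmod
  have h3 : ω ^ 3 = 1 := by linear_combination (ω - 1) * hω
  rcases τ with (_ | k) | k <;> rcases zmod_cases i with rfl | rfl | rfl
  all_goals try rcases zmod_cases k with rfl | rfl | rfl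
  all_goals
    simp (decide := true) [Fin.sum_univ_succ, pairCoeff, centralTable, pairFun, third, v0, v1,
        v2] <;> grind

set_option maxHeartbeats 1000000 in
theorem sum_pairCoeff_some {ω t : R} (hω : ω ^ 2 + ω + 1 = 0) (ht : 3 * t = 1) (τ : CharIndex)
    (i j : ZMod 3) (hij : i ≠ j) :
    ∑ l, pairCoeff ω t (some i) (some j) l * centralTable ω τ l =
      (pairFun (some i) (some j) τ : R) := by
  obtain ⟨v0, v1, v2⟩ := val_zmod
  have h3 : ω ^ 3 = 1 := by linear_combination (ω - 1) * hω
  have n1 : (-1 : ZMod 3) = 2 := by decide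
  have n2 : (-2 : ZMod 3) = 1 := by decide
  have s12 : (1 + 2 : ZMod 3) = 0 := by decide
  have s21 : (2 + 1 : ZMod 3) = 0 := by decide
  have cases : ∀ i j : ZMod 3, i ≠ j → (i = 0 ∧ j = 1) ∨ (i = 0 ∧ j = 2) ∨ (i = 1 ∧ j = 0) ∨
      (i = 1 ∧ j = 2) ∨ (i = 2 ∧ j = 0) ∨ (i = 2 ∧ j = 1) := by decide
  rcases τ with (_ | k) | k
  all_goals try rcases zmod_cases k with rfl | rfl | rfl
  all_goals
    rcases cases i j hij with ⟨rfl, rfl⟩ | ⟨rfl, rfl⟩ | ⟨rfl, rfl⟩ | ⟨rfl, rfl⟩ | ⟨rfl, rfl⟩ |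
      ⟨rfl, rfl⟩ <;>
    simp (decide := true) [Fin.sum_univ_succ, pairCoeff, centralTable, pairFun, third, v0, v1,
        v2, n1, n2, s12, s21] <;> grind

/-- The central element with coefficients `pairCoeff` takes the values `pairFun`. -/
theorem sum_pairCoeff {ω t : R} (hω : ω ^ 2 + ω + 1 = 0) (ht : 3 * t = 1) (τ : CharIndex)
    (a b : Option (ZMod 3)) (hab : a ≠ b) :
    ∑ i, pairCoeff ω t a b i * centralTable ω τ i = (pairFun a b τ : R) := by
  rcases a with _ | i <;> rcases b with _ | j
  · exact absurd rfl hab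
  · rw [show pairFun none (some j) = pairFun (some j) none by revert j; decide]
    exact sum_pairCoeff_none hω ht τ j
  · exact sum_pairCoeff_none hω ht τ i
  · exact sum_pairCoeff_some hω ht τ i j fun h => hab (by rw [h])

end Orthogonality

end CharIndex

/-! ### The center of the group ring of `Ã₄` -/

namespace CharIndex

open Atilde4

section Center

variable {R : Type*} [CommRing R] [IsDomain R] [CharZero R] {ω t : R} (hω : ω ^ 2 + ω + 1 = 0)
  (ht : 3 * t = 1)

/-- An element that acts by scalars in every irreducible representation is central. -/
theorem mem_center_of_rep {x : MonoidAlgebra R Atilde4} {c : CharIndex → R}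
    (hx : ∀ τ, rep hω ht τ x = c τ • (1 : Mat R τ)) :
    x ∈ Subalgebra.center R (MonoidAlgebra R Atilde4) := by
  rw [Subalgebra.mem_center_iff]
  intro y
  refine eq_of_rep_eq hω ht fun τ => ?_
  rw [map_mul, map_mul, hx]
  simp

/-- The class sums as central elements. -/
noncomputable def centralClassSum (i : Fin 7) : Subalgebra.center R (MonoidAlgebra R Atilde4) :=
  ⟨classSum R i, mem_center_of_rep hω ht fun τ => rep_classSum hω ht τ i⟩

/-- The central element with values `octFun a`. -/
noncomputable def octElt (a : Option (ZMod 3)) : Subalgebra.center R (MonoidAlgebra R Atilde4) :=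
  ∑ i, octCoeff ω t a i • centralClassSum hω ht i

/-- The central element with values `pairFun a b`. -/
noncomputable def pairElt (a b : Option (ZMod 3)) :
    Subalgebra.center R (MonoidAlgebra R Atilde4) :=
  ∑ i, pairCoeff ω t a b i • centralClassSum hω ht i

theorem rep_octElt (τ : CharIndex) (a : Option (ZMod 3)) :
    rep hω ht τ (octElt hω ht a) = (octFun a τ : R) • (1 : Mat R τ) := by
  rw [← sum_octCoeff hω ht, ← rep_sum_classSum hω ht]
  simp [octElt, centralClassSum]

theorem rep_pairElt (τ : CharIndex) {a b : Option (ZMod 3)} (hab : a ≠ b) :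
    rep hω ht τ (pairElt hω ht a b) = (pairFun a b τ : R) • (1 : Mat R τ) := by
  rw [← sum_pairCoeff hω ht τ a b hab, ← rep_sum_classSum hω ht]
  simp [pairElt, centralClassSum]

theorem eq_sum_centralClassSum (z : Subalgebra.center R (MonoidAlgebra R Atilde4)) :
    z = ∑ i, (z : MonoidAlgebra R Atilde4).coeff (classRep i) • centralClassSum hω ht i := by
  apply Subtype.ext
  conv_lhs => rw [eq_sum_classSum z.2]
  simp [centralClassSum]

/-- The class sums in terms of the elements `pairElt` and `octElt`. -/
theorem centralClassSum_eq (i : Fin 7) :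
    let P := fun j => pairElt hω ht (some j) none
    let Q := octElt hω ht
    centralClassSum hω ht i =
    ![1, P 0 + P 1 + P 2 - Q none - (3 : R) • 1,
      (3 : R) • (P 0 + P 1 + P 2) - (4 : R) • Q none - (6 : R) • 1,
      (Q (some 0) - P 0) + ω • (Q (some 1) - P 1) + ω ^ 2 • (Q (some 2) - P 2),
      P 0 + ω • P 1 + ω ^ 2 • P 2,
      (Q (some 0) - P 0) + ω ^ 2 • (Q (some 1) - P 1) + ω • (Q (some 2) - P 2),
      P 0 + ω ^ 2 • P 1 + ω • P 2] i := by
  intro P Q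
  obtain ⟨v0, v1, v2⟩ := val_zmod
  apply Subtype.ext
  refine eq_of_rep_eq hω ht fun τ => ?_
  have hP : ∀ j, rep hω ht τ (P j) = (pairFun (some j) none τ : R) • (1 : Mat R τ) := fun j =>
    rep_pairElt hω ht τ (by simp)
  have hQ : ∀ j, rep hω ht τ (Q j) = (octFun j τ : R) • (1 : Mat R τ) := rep_octElt hω ht τ
  change rep hω ht τ (classSum R i) = _
  rw [rep_classSum]
  have h3 : ω ^ 3 = 1 := by linear_combination (ω - 1) * hω
  fin_cases i
  · change centralTable ω τ 0 • (1 : Mat R τ) = rep hω ht τ 1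
    rw [map_one]
    rcases τ with (_ | j) | j <;> simp [centralTable]
  all_goals
    simp only [Fin.mk_zero, Fin.mk_one, Fin.reduceFinMk, Matrix.cons_val, AddSubgroupClass.coe_sub,
      AddMemClass.coe_add, SetLike.val_smul, OneMemClass.coe_one, Subalgebra.coe_add,
      Subalgebra.coe_smul, Subalgebra.coe_sub, Subalgebra.coe_one,
      map_add, map_sub, map_smul, map_one, hP, hQ, smul_smul, ← add_smul, ← sub_smul]
    rw [← sub_eq_zero]
    simp only [smul_add, smul_sub, smul_smul, ← add_smul, ← sub_smul]
    convert zero_smul R (1 : Mat R τ)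
    rcases τ with (_ | j) | j
    all_goals try rcases zmod_cases j with rfl | rfl | rfl
    all_goals
      simp (decide := true) [centralTable, pairFun, octFun, third, v0, v1, v2] <;> grind

/-- The center of the group ring is spanned by the elements with values `1`, `pairFun`, `octFun`. -/
theorem top_le_span_center :
    (⊤ : Submodule R (Subalgebra.center R (MonoidAlgebra R Atilde4))) ≤ Submodule.span R
      {z | z = 1 ∨ (∃ a b, a ≠ b ∧ z = pairElt hω ht a b) ∨ ∃ a, z = octElt hω ht a} := by
  intro z _
  set N := Submodule.span R
      {z | z = 1 ∨ (∃ a b, a ≠ b ∧ z = pairElt hω ht a b) ∨ ∃ a, z = octElt hω ht a}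
  have h1 : 1 ∈ N := Submodule.subset_span (Or.inl rfl)
  have hP : ∀ j, pairElt hω ht (some j) none ∈ N := fun j =>
    Submodule.subset_span (Or.inr (Or.inl ⟨_, _, by simp, rfl⟩))
  have hQ : ∀ j, octElt hω ht j ∈ N := fun j => Submodule.subset_span (Or.inr (Or.inr ⟨_, rfl⟩))
  rw [eq_sum_centralClassSum hω ht z]
  refine sum_mem fun i _ => N.smul_mem _ ?_
  rw [centralClassSum_eq]
  fin_cases i
  · exact h1
  · exact sub_mem (sub_mem (add_mem (add_mem (hP 0) (hP 1)) (hP 2)) (hQ none)) (N.smul_mem _ h1)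
  · exact sub_mem (sub_mem (N.smul_mem _ (add_mem (add_mem (hP 0) (hP 1)) (hP 2)))
      (N.smul_mem _ (hQ none))) (N.smul_mem _ h1)
  · exact add_mem (add_mem (sub_mem (hQ _) (hP _)) (N.smul_mem _ (sub_mem (hQ _) (hP _))))
      (N.smul_mem _ (sub_mem (hQ _) (hP _)))
  · exact add_mem (add_mem (hP _) (N.smul_mem _ (hP _))) (N.smul_mem _ (hP _))
  · exact add_mem (add_mem (sub_mem (hQ _) (hP _)) (N.smul_mem _ (sub_mem (hQ _) (hP _))))
      (N.smul_mem _ (sub_mem (hQ _) (hP _)))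
  · exact add_mem (add_mem (hP _) (N.smul_mem _ (hP _))) (N.smul_mem _ (hP _))

end Center

section BaseChange

variable {R S : Type*} [CommRing R] [CommRing S] (f : R →+* S)

theorem map_quatFun {B B' : Type*} [Ring B] [Ring B'] (φ : B →+* B') (I J K Z : B)
    (q : QuaternionGroup 2) :
    φ (TetraRelations.quatFun I J K Z q) =
      TetraRelations.quatFun (φ I) (φ J) (φ K) (φ Z) q := by
  cases q <;> simp only [TetraRelations.quatFun] <;> split_ifs <;> simp

theorem mapMatrix_mat (ω t : R) (τ : CharIndex) :
    f.mapMatrix (matI ω t τ) = matI (f ω) (f t) τ ∧ f.mapMatrix (matJ ω t τ) = matJ (f ω) (f t) τ ∧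
    f.mapMatrix (matK ω t τ) = matK (f ω) (f t) τ ∧ f.mapMatrix (matZ τ) = (matZ τ : Mat S τ) ∧
    f.mapMatrix (matC ω τ) = matC (f ω) τ := by
  have f2 : f 2 = 2 := map_ofNat f 2
  have h2 : ∀ a b c d : R, (!![a, b; c, d] : Matrix (Fin 2) (Fin 2) R).map f =
      !![f a, f b; f c, f d] := fun a b c d => by
    ext i j; fin_cases i <;> fin_cases j <;> rfl
  have h3 : ∀ a b c d a' b' c' d' x : R,
      (!![a, b, c; d, a', b'; c', d', x] : Matrix (Fin 3) (Fin 3) R).map f =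
      !![f a, f b, f c; f d, f a', f b'; f c', f d', f x] := fun a b c d a' b' c' d' x => by
    ext i j; fin_cases i <;> fin_cases j <;> rfl
  rcases τ with (_ | j) | k
  · refine ⟨(h3 _ _ _ _ _ _ _ _ _).trans ?_, (h3 _ _ _ _ _ _ _ _ _).trans ?_,
      (h3 _ _ _ _ _ _ _ _ _).trans ?_, map_one _, (h3 _ _ _ _ _ _ _ _ _).trans ?_⟩ <;>
      simp [matI, matJ, matK, matC]
  · refine ⟨map_one _, map_one _, map_one _, map_one _, ?_⟩
    ext a b
    fin_cases a; fin_cases b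
    exact map_pow f ω _
  · refine ⟨(h2 _ _ _ _).trans ?_, (h2 _ _ _ _).trans ?_, (h2 _ _ _ _).trans ?_,
      (map_neg _ _).trans (congrArg _ (map_one _)), (h2 _ _ _ _).trans ?_⟩ <;>
      simp [matI, matJ, matK, matC, f2]

/-- The irreducible representations commute with base change. -/
theorem rep_mapRingHom {ω t : R} (hω : ω ^ 2 + ω + 1 = 0) (ht : 3 * t = 1)
    (hω' : f ω ^ 2 + f ω + 1 = 0) (ht' : 3 * f t = 1) (τ : CharIndex)
    (x : MonoidAlgebra R Atilde4) :
    rep hω' ht' τ (MonoidAlgebra.mapRingHom Atilde4 f x) = f.mapMatrix (rep hω ht τ x) := by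
  obtain ⟨hI, hJ, hK, hZ, hC⟩ := mapMatrix_mat f ω t τ
  induction x using MonoidAlgebra.induction_on with
  | of g =>
    have : MonoidAlgebra.mapRingHom Atilde4 f (MonoidAlgebra.of R Atilde4 g) =
      MonoidAlgebra.of S Atilde4 g := by simp [MonoidAlgebra.of_apply]
    rw [this, rep, rep, TetraRelations.algHom_of, TetraRelations.algHom_of, map_mul, map_pow,
      map_quatFun, hI, hJ, hK, hZ, hC]
  | add x y hx hy => rw [map_add, map_add, map_add, map_add, hx, hy]
  | smul r x hx =>
    have : MonoidAlgebra.mapRingHom Atilde4 f (r • x) =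
        f r • MonoidAlgebra.mapRingHom Atilde4 f x := by
      ext g; simp
    rw [this, map_smul, map_smul, hx]
    ext a b
    simp

end BaseChange

end CharIndex

/-! ### The group ring of `Ã₄` over a local ring -/

namespace CharIndex

open Atilde4

theorem finrank_monoidAlgebra {R : Type*} [CommRing R] [Nontrivial R] :
    Module.finrank R (MonoidAlgebra R Atilde4) = 24 := by
  rw [(MonoidAlgebra.coeffLinearEquiv R).finrank_eq]
  simp [card_eq]

theorem finrank_pi_mat {K : Type*} [Field K] :
    Module.finrank K ((τ : CharIndex) → Mat K τ) = 24 := by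
  rw [Module.finrank_pi_fintype]
  simp only [Module.finrank_matrix, Module.finrank_self, Fintype.card_fin]
  rw [sum_univ]; rfl

section Field

variable {K : Type*} [Field K] [CharZero K] {ω t : K} (hω : ω ^ 2 + ω + 1 = 0) (ht : 3 * t = 1)

/-- Over a field of characteristic zero the irreducible representations split the group algebra: the
map is injective by orthogonality, and both sides have dimension `24`. -/
theorem bijective_rep :
    Function.Bijective (AlgHom.pi (rep hω ht) :
      MonoidAlgebra K Atilde4 →ₐ[K] ((τ : CharIndex) → Mat K τ)) := by
  have inj : Function.Injective (AlgHom.pi (rep hω ht)) := fun x y hxy =>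
    eq_of_rep_eq hω ht fun τ => congrFun hxy τ
  refine ⟨inj, ?_⟩
  have := LinearMap.injective_iff_surjective_of_finrank_eq_finrank
    (f := (AlgHom.pi (rep hω ht)).toLinearMap) (finrank_monoidAlgebra.trans finrank_pi_mat.symm)
  exact this.1 inj

end Field

section Tensor

variable {O : Type*} (K : Type*) [CommRing O] [Field K] [Algebra O K]
  {ω t : O} (hω : ω ^ 2 + ω + 1 = 0) (ht : 3 * t = 1)

theorem map_root {O S : Type*} [CommRing O] [CommRing S] (f : O →+* S) {ω : O}
    (hω : ω ^ 2 + ω + 1 = 0) : f ω ^ 2 + f ω + 1 = 0 := by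
  have := congrArg f hω
  simpa using this

theorem map_third {O S : Type*} [CommRing O] [CommRing S] (f : O →+* S) {t : O}
    (ht : 3 * t = 1) : 3 * f t = 1 := by
  have := congrArg f ht
  rwa [map_mul, map_ofNat, map_one] at this

theorem idemC_matC_two {R : Type*} [CommRing R] {ω t : R} (hω : ω ^ 2 + ω + 1 = 0) (i : ZMod 3) :
    idemC ω t (!![ω ^ (i.val + 1), 0; 0, ω ^ (i.val + 2)] : Matrix (Fin 2) (Fin 2) R) i = 0 := by
  obtain ⟨v0, v1, v2⟩ := val_zmod
  rcases zmod_cases i with rfl | rfl | rfl <;> ext a b <;> fin_cases a <;> fin_cases b <;>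
    simp [idemC, v0, v1, v2, Matrix.one_apply] <;> grind

theorem idemC_matC_one {R : Type*} [CommRing R] {ω t : R} (hω : ω ^ 2 + ω + 1 = 0) {i j : ZMod 3}
    (hij : j ≠ i) :
    idemC ω t (!![ω ^ j.val] : Matrix (Fin 1) (Fin 1) R) i = 0 := by
  obtain ⟨v0, v1, v2⟩ := val_zmod
  rcases zmod_cases i with rfl | rfl | rfl <;> rcases zmod_cases j with rfl | rfl | rfl <;>
    first
    | exact absurd rfl hij
    | (ext a b; fin_cases a; fin_cases b; simp [idemC, v0, v1, v2, Matrix.one_apply]; grind)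

theorem map_idemC {R B B' : Type*} [CommRing R] [Ring B] [Ring B'] [Algebra R B] [Algebra R B']
    (f : B →ₐ[R] B') (ω t : R) (c : B) (i : ZMod 3) :
    f (idemC ω t c i) = idemC ω t (f c) i := by
  simp [idemC]

theorem rep_idemC {τ : CharIndex} {i : ZMod 3} (hτ : ¬ supp i τ) :
    rep hω ht τ (idemC ω t (genC O) i) = 0 := by
  rw [map_idemC, rep, TetraRelations.algHom_genC]
  rcases τ with (_ | j) | k
  · exact absurd trivial hτ
  · exact idemC_matC_one hω hτ
  · rw [show k = i from not_not.1 hτ]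
    exact idemC_matC_two hω i

/-- The irreducible representations of `K ⊗ O[Ã₄]`. -/
noncomputable def tensorHom :
    K ⊗[O] MonoidAlgebra O Atilde4 →ₐ[K] ((τ : CharIndex) → Mat K τ) :=
  Algebra.TensorProduct.lift (Algebra.ofId K _)
    (AlgHom.pi fun τ => ((Algebra.ofId O K).mapMatrix.comp (rep hω ht τ)))
    fun x _ => Algebra.commutes x _

theorem tensorHom_tmul (c : K) (x : MonoidAlgebra O Atilde4) (τ : CharIndex) :
    tensorHom K hω ht (c ⊗ₜ x) τ = c • (algebraMap O K).mapMatrix (rep hω ht τ x) :=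
  (congrFun (Algebra.TensorProduct.lift_tmul _ _ _ c x) τ).trans
    ((Algebra.smul_def c ((algebraMap O K).mapMatrix (rep hω ht τ x))).symm)

variable [CharZero K]

theorem bijective_tensorHom [Nontrivial O] : Function.Bijective (tensorHom K hω ht) := by
  have surj : Function.Surjective (tensorHom K hω ht) := fun y => by
    obtain ⟨x, rfl⟩ := (bijective_rep (map_root (algebraMap O K) hω)
      (map_third (algebraMap O K) ht)).2 y
    refine ⟨∑ g : Atilde4, x.coeff g ⊗ₜ MonoidAlgebra.of O Atilde4 g, ?_⟩
    funext τ
    rw [map_sum, Finset.sum_apply]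
    conv_rhs => rw [eq_sum_of x]
    simp only [tensorHom_tmul, map_sum, map_smul, Finset.sum_apply, Pi.smul_apply]
    refine Finset.sum_congr rfl fun g _ => ?_
    rw [← rep_mapRingHom (algebraMap O K) hω ht (map_root (algebraMap O K) hω)
      (map_third (algebraMap O K) ht)]
    have : MonoidAlgebra.mapRingHom Atilde4 (algebraMap O K) (MonoidAlgebra.of O Atilde4 g) =
      MonoidAlgebra.of K Atilde4 g := by simp [MonoidAlgebra.of_apply]
    rw [this]; rfl
  have h2 : Module.finrank K ((τ : CharIndex) → Mat K τ) = 24 := finrank_pi_mat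
  have h1 : Module.finrank K (K ⊗[O] MonoidAlgebra O Atilde4) = 24 := by
    rw [Module.finrank_baseChange, finrank_monoidAlgebra]
  have := Module.Finite.of_basis ((Module.Free.chooseBasis O (MonoidAlgebra O Atilde4)).baseChange K)
  exact ⟨(LinearMap.injective_iff_surjective_of_finrank_eq_finrank
    (f := (tensorHom K hω ht).toLinearMap) (h1.trans h2.symm)).2 surj, surj⟩

/-- The decomposition of `K ⊗ O[Ã₄]` as a product of matrix algebras. -/
noncomputable def tensorEquiv [Nontrivial O] :
    K ⊗[O] MonoidAlgebra O Atilde4 ≃ₐ[K] ((τ : CharIndex) → Mat K τ) :=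
  AlgEquiv.ofBijective _ (bijective_tensorHom K hω ht)

theorem tensorEquiv_one_tmul [Nontrivial O] (x : MonoidAlgebra O Atilde4) (τ : CharIndex) :
    tensorEquiv K hω ht (1 ⊗ₜ x) τ = (algebraMap O K).mapMatrix (rep hω ht τ x) :=
  (tensorHom_tmul K hω ht 1 x τ).trans (one_smul _ _)

variable [IsDomain O]

/-- The primitive central idempotents of `K ⊗ O[Ã₄]`. -/
noncomputable def centralIdem (τ : CharIndex) : K ⊗[O] MonoidAlgebra O Atilde4 :=
  (tensorEquiv K hω ht).symm (Pi.single τ 1)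

theorem tensorEquiv_centralSum (f : CharIndex → ℤ) (τ : CharIndex) :
    tensorEquiv K hω ht (centralSum (centralIdem K hω ht) f) τ = (f τ : K) • (1 : Mat K τ) := by
  rw [centralSum, map_sum, Finset.sum_apply, Finset.sum_eq_single τ]
  · rw [map_zsmul, centralIdem, AlgEquiv.apply_symm_apply, Pi.smul_apply, Pi.single_eq_same,
      Int.cast_smul_eq_zsmul]
  · intro u _ hu
    rw [map_zsmul, centralIdem, AlgEquiv.apply_symm_apply, Pi.smul_apply,
      Pi.single_eq_of_ne hu.symm, smul_zero]
  · simp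

theorem one_tmul_eq_centralSum {x : MonoidAlgebra O Atilde4} {f : CharIndex → ℤ}
    (hx : ∀ τ, rep hω ht τ x = (f τ : O) • (1 : Mat O τ)) :
    (1 : K) ⊗ₜ[O] x = centralSum (centralIdem K hω ht) f := by
  apply (tensorEquiv K hω ht).injective
  funext τ
  rw [tensorEquiv_one_tmul, tensorEquiv_centralSum, hx]
  ext a b
  simp [Matrix.one_apply, apply_ite (algebraMap O K)]

/-- `x ↦ 1 ⊗ x` -/
noncomputable abbrev inclusion (O K A : Type*) [CommRing O] [Field K] [Algebra O K] [Ring A]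
    [Algebra O A] : A →+* K ⊗[O] A :=
  (Algebra.TensorProduct.includeRight : A →ₐ[O] K ⊗[O] A).toRingHom

theorem inclusion_injective {O K A : Type*} [CommRing O] [IsDomain O] [Field K] [Algebra O K]
    [IsFractionRing O K] [Ring A] [Algebra O A] [Module.Free O A] :
    Function.Injective (inclusion O K A) :=
  Algebra.TensorProduct.includeRight_injective (IsFractionRing.injective O K)

/-- The spectral idempotents of the element of order three are a lift of the primitive idempotents;
the representations in which they vanish are read off from the matrices. -/
theorem groupAlgebra_centralFrame [IsFractionRing O K] :
    CentralFrame (fun i => idemC ω t (genC O) i) (inclusion O K (MonoidAlgebra O Atilde4))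
      (centralIdem K hω ht) where
  idem i := by rw [idemC_mul_idemC hω ht (tetraRelations O).CCC, if_pos rfl]
  orth i j hij := by rw [idemC_mul_idemC hω ht (tetraRelations O).CCC, if_neg hij]
  sum_eq_one := idemC_sum hω ht
  inj := inclusion_injective
  idem' τ := by
    rw [centralIdem, ← map_mul, ← Pi.single_mul, one_mul]
  orth' τ u hτ := by
    rw [centralIdem, centralIdem, ← map_mul]
    refine (congrArg _ ?_).trans (map_zero (tensorEquiv K hω ht).symm)
    funext v
    by_cases h : v = τ
    · subst h; simp [Pi.single_eq_of_ne hτ]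
    · simp [Pi.single_eq_of_ne h]
  sum_eq_one' := by
    simp only [centralIdem]
    rw [← map_sum, Finset.univ_sum_single, ← map_one (tensorEquiv K hω ht).symm]; rfl
  central τ x := by
    apply (tensorEquiv K hω ht).injective
    rw [map_mul, map_mul, centralIdem, AlgEquiv.apply_symm_apply]
    funext u
    by_cases h : u = τ
    · subst h; simp
    · simp [Pi.single_eq_of_ne h]
  vanish i τ hτ := by
    apply (tensorEquiv K hω ht).injective
    rw [map_mul, centralIdem, AlgEquiv.apply_symm_apply, map_zero]
    funext u
    change _ * tensorEquiv K hω ht (1 ⊗ₜ idemC ω t (genC O) i) u = _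
    rw [tensorEquiv_one_tmul]
    by_cases h : u = τ
    · subst h; rw [rep_idemC hω ht hτ, map_zero, mul_zero]; rfl
    · rw [Pi.single_eq_of_ne h, zero_mul]; rfl

end Tensor

end CharIndex

/-! ### Reduction of the group ring modulo the maximal ideal -/

namespace CharIndex

open Atilde4 IsLocalRing

variable {O : Type*} [CommRing O] [IsLocalRing O]

variable (O) in
/-- Reduction modulo the maximal ideal. -/
noncomputable def reduction :
    MonoidAlgebra O Atilde4 →ₐ[O] MonoidAlgebra (ResidueField O) Atilde4 :=
  MonoidAlgebra.mapAlgHom Atilde4 (Algebra.ofId O (ResidueField O))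

theorem reduction_coeff (x : MonoidAlgebra O Atilde4) (g : Atilde4) :
    (reduction O x).coeff g = residue O (x.coeff g) := by
  simp [reduction]

theorem reduction_of (g : Atilde4) :
    reduction O (MonoidAlgebra.of O Atilde4 g) = MonoidAlgebra.of (ResidueField O) Atilde4 g := by
  simp [reduction, MonoidAlgebra.of_apply]

theorem reduction_classSum (i : Fin 7) :
    reduction O (classSum O i) = classSum (ResidueField O) i := by
  simp only [classSum, map_sum]
  refine Finset.sum_congr rfl fun g _ => ?_
  split_ifs
  · exact reduction_of g
  · exact map_zero _

theorem reduction_surjective : Function.Surjective (reduction O) := fun y => by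
  choose c hc using fun g => residue_surjective (y.coeff g)
  refine ⟨∑ g, c g • MonoidAlgebra.of O Atilde4 g, ?_⟩
  rw [map_sum]
  conv_rhs => rw [eq_sum_of y]
  refine Finset.sum_congr rfl fun g _ => ?_
  rw [map_smul, reduction_of, ← hc]; rfl

theorem mem_of_reduction_eq_zero {x : MonoidAlgebra O Atilde4} (hx : reduction O x = 0) :
    x ∈ maximalIdeal O • (⊤ : Submodule O (MonoidAlgebra O Atilde4)) := by
  rw [eq_sum_of x]
  refine sum_mem fun g _ => Submodule.smul_mem_smul ?_ trivial
  rw [← residue_eq_zero_iff, ← reduction_coeff, hx]; rfl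

theorem map_idemC_semilinear {O k B B' : Type*} [CommRing O] [CommRing k] [Algebra O k] [Ring B]
    [Ring B'] [Algebra O B] [Algebra k B'] [Algebra O B'] [IsScalarTower O k B']
    (f : B →ₐ[O] B') (ω t : O) (c : B) (i : ZMod 3) :
    f (idemC ω t c i) = idemC (algebraMap O k ω) (algebraMap O k t) (f c) i := by
  simp only [idemC, map_smul, map_add, map_one, map_mul, ← map_pow, algebraMap_smul]

variable [IsDomain O] [CharZero O] (K : Type*) [Field K] [CharZero K] [Algebra O K]
  [IsFractionRing O K] {ω t : O} (hω : ω ^ 2 + ω + 1 = 0) (ht : 3 * t = 1)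

theorem two_eq_zero {O : Type*} [CommRing O] [IsLocalRing O] (h2 : (2 : O) ∈ maximalIdeal O) :
    (2 : ResidueField O) = 0 := by
  rw [← residue_eq_zero_iff, map_ofNat] at h2
  exact h2

/-- The group ring of `Ã₄` has the structure of `CentralLift`. -/
theorem groupAlgebra_centralLift (h2 : (2 : O) ∈ maximalIdeal O) :
    CentralLift O (ResidueField O) (reduction O) (fun i => idemC ω t (genC O) i)
      (TetraRelations.arrowX (quat _ (.a 1)) (quat _ (.xa 0)) (quat _ (.xa 3)) (genC _)
        (residue O ω) (residue O t))
      (TetraRelations.arrowY (quat _ (.a 1)) (quat _ (.xa 0)) (quat _ (.xa 3)) (genC _)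
        (residue O ω) (residue O t))
      (inclusion O K (MonoidAlgebra O Atilde4)) (centralIdem K hω ht) (pairElt hω ht)
      (octElt hω ht) where
  toCentralFrame := groupAlgebra_centralFrame K hω ht
  two_mem := h2
  algebraMap_surj := residue_surjective
  algebraMap_eq_zero x hx := (residue_eq_zero_iff x).2 hx
  surj := reduction_surjective
  mem_of_eq_zero _ := mem_of_reduction_eq_zero
  frame := by
    have hC : reduction O (genC O) = genC (ResidueField O) := reduction_of _
    simp only [map_idemC_semilinear (k := ResidueField O) (reduction O), hC]
    exact residueFrame (map_root (residue O) hω) (map_third (residue O) ht) (two_eq_zero h2)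
  pair_eq a b hab := one_tmul_eq_centralSum K hω ht fun τ => rep_pairElt hω ht τ hab
  oct_eq a := one_tmul_eq_centralSum K hω ht fun τ => rep_octElt hω ht τ a
  center_le := top_le_span_center hω ht
  center_surj y hy := by
    choose c hc using fun i => residue_surjective (y.coeff (classRep i))
    refine ⟨∑ i, c i • centralClassSum hω ht i, ?_⟩
    conv_rhs => rw [eq_sum_classSum hy]
    simp only [AddSubmonoidClass.coe_finsetSum, SetLike.val_smul, map_sum, map_smul,
      centralClassSum, reduction_classSum, ← hc]
    rfl

/-- The group ring of `Ã₄` is isomorphic to the algebra given by generators and relations. -/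
theorem groupAlgebra_nonempty_algEquiv (K : Type*) [Field K] [CharZero K] [Algebra O K]
    [IsFractionRing O K] {ω t : O} (hω : ω ^ 2 + ω + 1 = 0) (ht : 3 * t = 1) (h2 : (2 : O) ∈ maximalIdeal O) :
    Nonempty (MonoidAlgebra O Atilde4 ≃ₐ[O] PresAlgebra O) :=
  (groupAlgebra_centralLift K hω ht h2).nonempty_algEquiv finrank_monoidAlgebra
    finrank_monoidAlgebra ht

end CharIndex

/-! ### Characters of a product of matrix algebras -/

namespace SplitAlgebra

variable {K B ι : Type*} [Field K] [Ring B] [Algebra K B]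
  {n : ι → ℕ} (φ : B ≃ₐ[K] ((i : ι) → Matrix (Fin (n i)) (Fin (n i)) K))

/-- The character of the `i`-th factor. -/
def chi (i : ι) : B →ₗ[K] K :=
  Matrix.traceLinearMap (Fin (n i)) K K ∘ₗ LinearMap.proj i ∘ₗ φ.toLinearMap

theorem chi_apply (i : ι) (b : B) : chi φ i b = (φ b i).trace := rfl

/-- The column vectors of the `i`-th factor as a module over the product. -/
def Column (_ : B ≃ₐ[K] ((i : ι) → Matrix (Fin (n i)) (Fin (n i)) K)) (i : ι) : Type _ :=
  Fin (n i) → K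

namespace Column

variable (i : ι)

instance : AddCommGroup (Column φ i) := inferInstanceAs (AddCommGroup (Fin (n i) → K))

instance : Module K (Column φ i) := inferInstanceAs (Module K (Fin (n i) → K))

/-- The action of the algebra on column vectors. -/
def action : B →ₐ[K] Module.End K (Fin (n i) → K) :=
  (Matrix.toLinAlgEquiv' : Matrix (Fin (n i)) (Fin (n i)) K ≃ₐ[K] _).toAlgHom.comp
    ((Pi.evalAlgHom K (fun i => Matrix (Fin (n i)) (Fin (n i)) K) i).comp φ.toAlgHom)

instance : Module B (Column φ i) := Module.compHom (Fin (n i) → K) (action φ i).toRingHom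

theorem smul_eq (b : B) (v : Column φ i) : b • v = (φ b i).mulVec v := rfl

instance : IsScalarTower K B (Column φ i) where
  smul_assoc c b v := by
    rw [smul_eq, smul_eq, map_smul]
    exact Matrix.smul_mulVec c (φ b i) v

theorem moduleCharacter_eq : moduleCharacter K B (Column φ i) = chi φ i := by
  ext b
  exact Matrix.trace_toLin'_eq (φ b i)

theorem isSimpleModule [DecidableEq ι] (hn : n i ≠ 0) : IsSimpleModule B (Column φ i) := by
  have : NeZero (n i) := ⟨hn⟩
  rw [isSimpleModule_iff_toSpanSingleton_surjective]
  refine ⟨inferInstanceAs (Nontrivial (Fin (n i) → K)), fun v hv w => ?_⟩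
  obtain ⟨a, ha⟩ : ∃ a, v a ≠ 0 := Function.ne_iff.1 hv
  refine ⟨φ.symm (Pi.single i (Matrix.vecMulVec w (Pi.single a (v a)⁻¹))), ?_⟩
  rw [LinearMap.toSpanSingleton_apply, smul_eq, AlgEquiv.apply_symm_apply, Pi.single_eq_same]
  have h1 : ∀ v w : Fin (n i) → K, v a ≠ 0 →
      (Matrix.vecMulVec w (Pi.single a (v a)⁻¹)).mulVec v = w := fun v w ha => by
    rw [Matrix.vecMulVec_mulVec]
    ext j
    simp [ha]
  exact h1 v w ha

end Column

theorem moduleCharacter_congr {V W : Type*} [AddCommGroup V] [Module K V] [Module B V]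
    [IsScalarTower K B V] [AddCommGroup W] [Module K W] [Module B W] [IsScalarTower K B W]
    (f : V ≃ₗ[B] W) : moduleCharacter K B V = moduleCharacter K B W := by
  ext b
  let g : V ≃ₗ[K] W := f.restrictScalars K
  change LinearMap.trace K V (Algebra.lsmul K K V b) = LinearMap.trace K W (Algebra.lsmul K K W b)
  rw [← LinearMap.trace_conj' _ g]
  congr 1
  ext w
  change g (b • g.symm w) = b • w
  exact (f.map_smul b _).trans (by rw [show f (g.symm w) = w from f.apply_symm_apply w])

variable [DecidableEq ι]

theorem chi_mem (hn : ∀ i, n i ≠ 0) (i : ι) : chi φ i ∈ irrCharacters K B := by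
  have : IsSimpleModule B (Column φ i) := Column.isSimpleModule φ i (hn i)
  obtain ⟨m, -, ⟨f⟩⟩ := isSimpleModule_iff_quot_maximal.1 this
  exact ⟨m, IsSimpleModule.congr f.symm,
    by rw [← moduleCharacter_congr f, Column.moduleCharacter_eq]⟩

/-- Every irreducible character is one of the characters `chi`. -/
theorem exists_eq_chi [Fintype ι] (hn : ∀ i, n i ≠ 0) {χ : B →ₗ[K] K}
    (hχ : χ ∈ irrCharacters K B) : ∃ i, χ = chi φ i := by
  obtain ⟨m, hm, rfl⟩ := hχ
  have := IsSimpleModule.nontrivial B (B ⧸ m)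
  obtain ⟨v, hv⟩ := exists_ne (0 : B ⧸ m)
  -- some diagonal matrix unit does not annihilate `v`
  obtain ⟨i, a, ha⟩ : ∃ i, ∃ a : Fin (n i),
      φ.symm (Pi.single i (Matrix.single a a 1)) • v ≠ 0 := by
    by_contra! h0
    apply hv
    have h1 : (1 : B) = ∑ i, ∑ a : Fin (n i), φ.symm (Pi.single i (Matrix.single a a 1)) := by
      apply φ.injective
      simp only [map_sum, AlgEquiv.apply_symm_apply, map_one]
      funext j
      rw [Finset.sum_apply, Finset.sum_eq_single j]
      · simp only [Finset.sum_apply, Pi.single_eq_same]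
        ext b c
        rw [Matrix.sum_apply, Finset.sum_eq_single b]
        · simp [Matrix.single_apply, Matrix.one_apply]
        · intro d _ hd; simp [Matrix.single_apply, hd]
        · simp
      · intro l _ hl; simp [Pi.single_eq_of_ne hl.symm]
      · simp
    rw [← one_smul B v, h1, Finset.sum_smul]
    exact Finset.sum_eq_zero fun i _ => by
      rw [Finset.sum_smul]; exact Finset.sum_eq_zero fun a _ => h0 i a
  refine ⟨i, ?_⟩
  have key : ∀ (M : Matrix (Fin (n i)) (Fin (n i)) K) (b : B),
      b * φ.symm (Pi.single i M) = φ.symm (Pi.single i (φ b i * M)) := fun M b => by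
    apply φ.injective
    rw [map_mul, AlgEquiv.apply_symm_apply, AlgEquiv.apply_symm_apply]
    funext j
    by_cases h : j = i
    · subst h; simp
    · simp [Pi.single_eq_of_ne h]
  let F : Column φ i →ₗ[B] B ⧸ m :=
    { toFun := fun x => φ.symm (Pi.single i (Matrix.vecMulVec (x : Fin (n i) → K)
        (Pi.single a 1))) • v
      map_add' := fun x y =>
        (congrArg (fun M => φ.symm (Pi.single i M) • v) (Matrix.add_vecMulVec _ _ _)).trans
          (by rw [Pi.single_add, map_add, add_smul])
      map_smul' := fun b x =>
        (congrArg (fun M => φ.symm (Pi.single i M) • v) (Matrix.mul_vecMulVec (φ b i) _ _).symm).trans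
          (by rw [← key, mul_smul]; rfl) }
  have hF : F ≠ 0 := fun h0 => by
    apply ha
    have h1 := LinearMap.congr_fun h0 (Pi.single a 1 : Fin (n i) → K)
    have h2 : Matrix.vecMulVec (Pi.single a 1 : Fin (n i) → K) (Pi.single a 1) =
      Matrix.single a a 1 := by
      ext b c; simp [Matrix.vecMulVec_apply, Matrix.single_apply, Pi.single_apply]; grind
    rw [← h2]; exact h1
  have := Column.isSimpleModule φ i (hn i)
  rw [← Column.moduleCharacter_eq]
  exact (moduleCharacter_congr
    (LinearEquiv.ofBijective F (LinearMap.bijective_of_ne_zero hF))).symm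

/-- The irreducible characters are in bijection with the factors. -/
def irr (hn : ∀ i, n i ≠ 0) (i : ι) : irrCharacters K B := ⟨chi φ i, chi_mem φ hn i⟩

/-- An element on which only the `i`-th irreducible character does not vanish. -/
def unitElt (hn : ∀ i, n i ≠ 0) (i : ι) : B :=
  φ.symm (Pi.single i (Matrix.single ⟨0, Nat.pos_of_ne_zero (hn i)⟩
    ⟨0, Nat.pos_of_ne_zero (hn i)⟩ 1))

theorem chi_unitElt (hn : ∀ i, n i ≠ 0) (i j : ι) :
    chi φ j (unitElt φ hn i) = if j = i then 1 else 0 := by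
  rw [chi_apply, unitElt, AlgEquiv.apply_symm_apply]
  split_ifs with h
  · subst h; rw [Pi.single_eq_same, Matrix.trace_single_eq_same]
  · rw [Pi.single_eq_of_ne h, Matrix.trace_zero]

theorem irr_injective (hn : ∀ i, n i ≠ 0) : Function.Injective (irr φ hn) := fun i j hij => by
  have h1 := chi_unitElt φ hn i j
  rw [← show chi φ i = chi φ j from congrArg Subtype.val hij, chi_unitElt, if_pos rfl] at h1
  by_contra hne
  rw [if_neg (Ne.symm hne)] at h1
  exact one_ne_zero h1

theorem irr_surjective [Fintype ι] (hn : ∀ i, n i ≠ 0) : Function.Surjective (irr φ hn) :=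
  fun χ => by
    obtain ⟨i, hi⟩ := exists_eq_chi φ hn χ.2
    exact ⟨i, Subtype.ext hi.symm⟩

/-- The value of a generalised character at `unitElt` is its multiplicity. -/
theorem toLinearForm_unitElt [Fintype ι] (hn : ∀ i, n i ≠ 0) (f : CharGroup K B) (i : ι) :
    f.toLinearForm (unitElt φ hn i) = (f (irr φ hn i) : K) := by
  rw [CharGroup.toLinearForm, Finsupp.sum, LinearMap.sum_apply,
    Finset.sum_eq_single (irr φ hn i)]
  · change f _ • chi φ i (unitElt φ hn i) = _
    rw [chi_unitElt, if_pos rfl, zsmul_one]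
  · intro χ _ hχ
    obtain ⟨j, rfl⟩ := irr_surjective φ hn χ
    change f _ • chi φ j (unitElt φ hn i) = _
    rw [chi_unitElt, if_neg (fun h => hχ (by rw [h])), smul_zero]
  · intro h
    rw [Finsupp.notMem_support_iff.1 h, zero_smul]; rfl

end SplitAlgebra

/-! ### Idempotents and their characters -/

namespace SplitAlgebra

variable {K B ι : Type*} [Field K] [Ring B] [Algebra K B] {n : ι → ℕ}
  (φ : B ≃ₐ[K] ((i : ι) → Matrix (Fin (n i)) (Fin (n i)) K))

section

variable [Fintype ι] [DecidableEq ι]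

/-- The trace of `x ↦ a x b` on a product of matrix algebras. -/
theorem trace_mulLeftRight_pi (a b : (i : ι) → Matrix (Fin (n i)) (Fin (n i)) K) :
    LinearMap.trace K ((i : ι) → Matrix (Fin (n i)) (Fin (n i)) K)
      (LinearMap.mulLeft K a ∘ₗ LinearMap.mulRight K b) = ∑ i, (a i).trace * (b i).trace := by
  let bas := Pi.basis fun i => Matrix.stdBasis K (Fin (n i)) (Fin (n i))
  rw [LinearMap.trace_eq_matrix_trace K bas, Matrix.trace, Fintype.sum_sigma]
  refine Finset.sum_congr rfl fun i _ => ?_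
  rw [Fintype.sum_prod_type, Matrix.trace, Matrix.trace, Finset.sum_mul_sum]
  refine Finset.sum_congr rfl fun p _ => Finset.sum_congr rfl fun q _ => ?_
  have h1 : bas ⟨i, p, q⟩ = Pi.single i (Matrix.single p q 1) := by
    simp [bas, Pi.basis_apply, Matrix.stdBasis_eq_single]
  rw [Matrix.diag_apply, LinearMap.toMatrix_apply, h1, LinearMap.comp_apply,
    LinearMap.mulRight_apply, LinearMap.mulLeft_apply]
  change (bas.repr _) ⟨i, (p, q)⟩ = _
  rw [Pi.basis_repr]
  have h2 : ∀ M : Matrix (Fin (n i)) (Fin (n i)) K,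
      (Matrix.stdBasis K (Fin (n i)) (Fin (n i))).repr M (p, q) = M p q := fun M => by
    simp [Matrix.stdBasis]
  rw [h2, Pi.mul_apply, Pi.mul_apply, Pi.single_eq_same, ← Matrix.mul_assoc]
  simp only [Matrix.mul_apply, Matrix.single_apply]
  rw [Finset.sum_eq_single q, Finset.sum_eq_single p]
  · simp
  · intro x _ hx; simp [Ne.symm hx]
  · simp
  · intro x _ hx; simp [Ne.symm hx]
  · simp

theorem trace_mulLeftRight (a b : B) :
    LinearMap.trace K B (LinearMap.mulLeft K a ∘ₗ LinearMap.mulRight K b) =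
      ∑ i, chi φ i a * chi φ i b := by
  simp only [chi_apply]
  rw [← trace_mulLeftRight_pi, ← LinearMap.trace_conj' _ φ.toLinearEquiv]
  congr 1
  refine LinearMap.ext fun x => ?_
  change φ (a * (φ.symm x * b)) = φ a * (x * φ b)
  rw [map_mul, map_mul, AlgEquiv.apply_symm_apply]

/-- The character of the left ideal generated by an idempotent. -/
theorem moduleCharacter_span_idem {e : B} (he : IsIdempotentElem e) :
    moduleCharacter K B (Submodule.span B {e}) = ∑ i, chi φ i e • chi φ i := by
  have : Module.Finite K B := Module.Finite.equiv φ.symm.toLinearEquiv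
  ext b
  have h1 := trace_mulLeftRight φ b e
  let N : Submodule K B := (Submodule.span B {e}).restrictScalars K
  have hN : ∀ x, (LinearMap.mulLeft K b ∘ₗ LinearMap.mulRight K e) x ∈ N := fun x => by
    change b * (x * e) ∈ Submodule.span B {e}
    rw [← mul_assoc]
    exact Submodule.smul_mem _ _ (Submodule.mem_span_singleton_self e)
  have h2 := LinearMap.trace_restrict_eq_of_forall_mem N _ hN
  rw [h1] at h2
  have h3 : moduleCharacter K B (Submodule.span B {e}) b = ∑ i, chi φ i b * chi φ i e := by
    rw [← h2]
    change LinearMap.trace K N (Algebra.lsmul K K (Submodule.span B {e}) b) = _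
    congr 1
    ext ⟨x, hx⟩
    obtain ⟨y, rfl⟩ := Submodule.mem_span_singleton.1 hx
    change b * (y * e) = b * (y * e * e)
    rw [mul_assoc y, he.eq]
  rw [h3, LinearMap.sum_apply]
  exact Finset.sum_congr rfl fun i _ => mul_comm _ _

end

/-- The trace of an idempotent matrix is a natural number, at most the size of the matrix, and it
is zero only for the zero matrix. -/
theorem exists_trace_eq [CharZero K] {m : ℕ} {M : Matrix (Fin m) (Fin m) K}
    (hM : IsIdempotentElem M) : ∃ r : ℕ, r ≤ m ∧ M.trace = r ∧ (r = 0 → M = 0) := by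
  have h1 : IsIdempotentElem (Matrix.toLin' M) := by
    rw [IsIdempotentElem, Module.End.mul_eq_comp, ← Matrix.toLin'_mul, hM.eq]
  have h2 := (LinearMap.IsIdempotentElem.isProj_range _ h1).trace
  rw [Matrix.trace_toLin'_eq] at h2
  refine ⟨_, ?_, h2, fun h0 => ?_⟩
  · exact (Submodule.finrank_le _).trans (by simp)
  · rw [h0, Nat.cast_zero, ← Matrix.trace_toLin'_eq,
      LinearMap.IsIdempotentElem.trace_eq_zero_iff h1] at h2
    exact (LinearEquiv.map_eq_zero_iff _).1 h2

variable {φ} in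
/-- The values of the irreducible characters at an idempotent are multiplicities, and a multiplicity
vanishes only if the corresponding component does. -/
theorem exists_chi_eq [CharZero K] {e : B} (he : IsIdempotentElem e) :
    ∃ r : ι → ℕ, (∀ i, chi φ i e = r i) ∧ ∀ i, r i = 0 → φ e i = 0 := by
  choose r h1 h2 h3 using fun i => exists_trace_eq (M := φ e i) (by
    rw [IsIdempotentElem, ← Pi.mul_apply, ← map_mul, he.eq])
  exact ⟨r, h2, h3⟩

variable [DecidableEq ι]

/-- The central idempotent of the `i`-th factor. -/
def centralIdem (i : ι) : Subalgebra.center K B :=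
  ⟨φ.symm (Pi.single i 1), by
    rw [Subalgebra.mem_center_iff]
    intro b
    apply φ.injective
    rw [map_mul, map_mul, AlgEquiv.apply_symm_apply]
    funext j
    by_cases h : j = i
    · subst h; simp
    · simp [Pi.single_eq_of_ne h]⟩

theorem isPrimitiveIdempotent_centralIdem (hn : ∀ i, n i ≠ 0) (i : ι) :
    IsPrimitiveIdempotent (centralIdem φ i) := by
  have : NeZero (n i) := ⟨hn i⟩
  have hne : (1 : Matrix (Fin (n i)) (Fin (n i)) K) ≠ 0 := one_ne_zero
  refine ⟨?_, ?_, ?_⟩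
  · apply Subtype.ext
    change φ.symm _ * φ.symm _ = φ.symm _
    rw [← map_mul, ← Pi.single_mul, one_mul]
  · intro h
    have h1 : φ.symm (Pi.single i 1) = 0 := congrArg Subtype.val h
    rw [map_eq_zero_iff _ φ.symm.injective] at h1
    exact hne (by simpa using congrFun h1 i)
  · intro f g hf hg hfg hgf hsum
    have hs : φ (f : B) + φ (g : B) = Pi.single i 1 := by
      rw [← map_add]
      have := congrArg (fun z : Subalgebra.center K B => φ (z : B)) hsum
      simpa [centralIdem] using this
    have hff : ∀ z : Subalgebra.center K B, IsIdempotentElem z →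
        ∀ j, φ (z : B) j = 0 ∨ φ (z : B) j = 1 := fun z hz j => by
      have hz' : φ (z : B) * φ (z : B) = φ (z : B) := by
        rw [← map_mul]; exact congrArg (fun z : Subalgebra.center K B => φ (z : B)) hz
      have hc : φ (z : B) j ∈ Set.center (Matrix (Fin (n j)) (Fin (n j)) K) := by
        rw [Semigroup.mem_center_iff]
        intro M
        have := congrArg (fun x => φ x j) (Subalgebra.mem_center_iff.1 z.2
          (φ.symm (Pi.single j M)))
        simpa using this
      rw [Matrix.center_eq_range] at hc
      obtain ⟨c, hc⟩ := hc
      have h1 : φ (z : B) j * φ (z : B) j = φ (z : B) j := congrFun hz' j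
      have : NeZero (n j) := ⟨hn j⟩
      rw [← hc, ← map_mul] at h1
      have h2 : c * c = c := Matrix.scalar_inj.1 h1
      rcases IsIdempotentElem.iff_eq_zero_or_one.1 h2 with h | h
      · left; rw [← hc, h, map_zero]
      · right; rw [← hc, h, map_one]
    have hprod : φ (f : B) * φ (g : B) = 0 := by
      rw [← map_mul]
      have := congrArg (fun z : Subalgebra.center K B => φ (z : B)) hfg
      simpa using this
    have hz : ∀ z : Subalgebra.center K B, φ (z : B) = 0 → z = 0 := fun z h =>
      Subtype.ext (φ.injective (h.trans (map_zero φ).symm))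
    -- away from `i` both vanish, because `f + g` and `f g` do
    have hoff : ∀ j, j ≠ i → φ (f : B) j = 0 ∧ φ (g : B) j = 0 := fun j hj => by
      have e1 := congrFun hs j
      have e2 := congrFun hprod j
      have e3 : φ (f : B) j * φ (f : B) j = φ (f : B) j := by
        rcases hff f hf j with h | h <;> rw [h] <;> simp
      rw [Pi.add_apply, Pi.single_eq_of_ne hj] at e1
      rw [Pi.mul_apply, eq_neg_of_add_eq_zero_right e1, Pi.zero_apply, mul_neg, e3,
        neg_eq_zero] at e2
      rw [e2, zero_add] at e1
      exact ⟨e2, e1⟩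
    rcases hff f hf i with h | h
    · left; apply hz; funext j
      by_cases hj : j = i
      · subst hj; exact h
      · exact (hoff j hj).1
    · right; apply hz; funext j
      by_cases hj : j = i
      · subst hj
        have e1 := congrFun hs j
        rw [Pi.add_apply, h, Pi.single_eq_same] at e1
        exact add_eq_left.1 e1
      · exact (hoff j hj).2

/-- The central idempotent of a factor belongs to every nonzero multiple of its character; the
multiples by `1` and `-1` are needed. -/
theorem isCentralIdempotentOf [CharZero K] (hn : ∀ i, n i ≠ 0) (i : ι) {c : ℤ} (hc : c ≠ 0) :
    CharGroup.IsCentralIdempotentOf (Finsupp.single (irr φ hn i) c) (centralIdem φ i) := by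
  refine ⟨isPrimitiveIdempotent_centralIdem φ hn i, ?_⟩
  rw [CharGroup.toLinearForm, Finsupp.sum_single_index (by rw [zero_smul])]
  change c • chi φ i (φ.symm (Pi.single i 1)) ≠ 0
  rw [chi_apply, AlgEquiv.apply_symm_apply, Pi.single_eq_same, Matrix.trace_one, Fintype.card_fin]
  exact smul_ne_zero hc (Nat.cast_ne_zero.2 (hn i))

end SplitAlgebra

/-! ### Isometries of character groups -/

theorem Finsupp.sum_single_mul {Z : Type*} (z : Z) (c : ℤ) (f : Z →₀ ℤ) :
    ((single z c).sum fun y n => n * f y) = c * f z :=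
  sum_single_index (zero_mul _)

/-- An isometry of free abelian groups with orthonormal bases is given by a bijection of the bases
and signs. -/
theorem Finsupp.exists_equiv_of_isometry {X Y : Type*} (Φ : (X →₀ ℤ) ≃+ (Y →₀ ℤ))
    (h : ∀ f g, ((Φ f).sum fun y n => n * Φ g y) = f.sum fun x n => n * g x) :
    ∃ (θ : X ≃ Y) (s : X → ℤ), (∀ x, s x = 1 ∨ s x = -1) ∧
      (∀ x, Φ (single x 1) = single (θ x) (s x)) ∧ ∀ f x, Φ f (θ x) = s x * f x := by
  classical
  -- a vector of norm one has exactly one nonzero coordinate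
  have unit : ∀ f : Y →₀ ℤ, (f.sum fun y n => n * f y) = 1 →
      ∃ y s, (s = 1 ∨ s = -1) ∧ f = single y s := by
    intro f hf
    have hpos : ∀ y ∈ f.support, 1 ≤ f y * f y := fun y hy => by
      have := mem_support_iff.1 hy
      have : 0 < f y * f y := mul_self_pos.2 this
      exact this
    have hcard : (f.support.card : ℤ) ≤ 1 := by
      rw [← hf, Finsupp.sum]
      calc (f.support.card : ℤ) = ∑ y ∈ f.support, 1 := by simp
        _ ≤ _ := Finset.sum_le_sum hpos
    have hne : f ≠ 0 := fun h0 => by simp [h0] at hf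
    obtain ⟨y, b, hb, hfy⟩ := Finsupp.card_support_eq_one'.1 (le_antisymm (by exact_mod_cast hcard)
      (Nat.one_le_iff_ne_zero.2 (by simpa using hne)))
    refine ⟨y, b, ?_, hfy⟩
    rw [hfy, sum_single_mul, single_eq_same] at hf
    exact Int.eq_one_or_neg_one_of_mul_eq_one hf
  choose θ s hs hθ using fun x => unit (Φ (single x 1)) (by
    rw [h, sum_single_mul, single_eq_same, one_mul])
  have ss : ∀ x, s x * s x = 1 := fun x => by rcases hs x with h | h <;> rw [h] <;> rfl
  have hval : ∀ f x, Φ f (θ x) = s x * f x := fun f x => by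
    have h1 := h (single x 1) f
    rw [hθ, sum_single_mul, sum_single_mul, one_mul] at h1
    rw [← h1, ← mul_assoc, ss, one_mul]
  have hinj : Function.Injective θ := fun x x' hx => by
    by_contra hne
    have h1 := hval (single x' 1) x
    rw [hx, hθ, single_eq_same, single_eq_of_ne hne, mul_zero] at h1
    have := ss x'
    rw [h1] at this
    exact absurd this (by decide)
  have hsurj : Function.Surjective θ := fun y => by
    by_contra! hy
    obtain ⟨f, hf⟩ := Φ.surjective (single y 1)
    have : f = 0 := by
      ext x
      have h1 := hval f x
      rw [hf, single_eq_of_ne (hy x)] at h1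
      rcases hs x with h | h <;> rw [h] at h1 <;> simpa using h1.symm
    rw [this, map_zero] at hf
    exact one_ne_zero (single_eq_zero.1 hf.symm)
  exact ⟨Equiv.ofBijective θ ⟨hinj, hsurj⟩, s, hs, hθ, hval⟩

/-! ### Projective characters of the group ring -/

namespace CharIndex

open Atilde4 IsLocalRing

/-- An idempotent matrix of size two has trace `0`, `1` or `2` according to its determinant. -/
theorem trace_idem_two {R : Type*} [CommRing R] [IsDomain R] {M : Matrix (Fin 2) (Fin 2) R}
    (hM : IsIdempotentElem M) : (M.det = 1 ∧ M.trace = 2) ∨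
      (M.det = 0 ∧ (M.trace = 0 ∨ M.trace = 1)) := by
  have h00 := congrFun (congrFun hM.eq 0) 0
  have h01 := congrFun (congrFun hM.eq 0) 1
  have h10 := congrFun (congrFun hM.eq 1) 0
  have h11 := congrFun (congrFun hM.eq 1) 1
  simp only [Matrix.mul_apply, Fin.sum_univ_two] at h00 h01 h10 h11
  have hd : IsIdempotentElem M.det := by rw [IsIdempotentElem, ← Matrix.det_mul, hM.eq]
  rw [Matrix.trace_fin_two]
  rcases IsIdempotentElem.iff_eq_zero_or_one.1 hd with h | h
  · right
    refine ⟨h, ?_⟩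
    rw [Matrix.det_fin_two] at h
    -- by the Cayley–Hamilton theorem `(1 - tr M) M = 0`
    have h1 : (M 0 0 + M 1 1) * (M 0 0 + M 1 1 - 1) = 0 := by
      linear_combination h00 + h11 + 2 * h
    rcases mul_eq_zero.1 h1 with h2 | h2
    · exact Or.inl h2
    · exact Or.inr (sub_eq_zero.1 h2)
  · left
    refine ⟨h, ?_⟩
    have hu : IsUnit M := (Matrix.isUnit_iff_isUnit_det M).2 (by rw [h]; exact isUnit_one)
    have : M = 1 := by
      have := hM.eq
      exact hu.mul_left_cancel (this.trans (mul_one M).symm)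
    rw [this]; simp; norm_num

section

variable {R : Type*} [CommRing R] {ω t : R} (hω : ω ^ 2 + ω + 1 = 0) (ht : 3 * t = 1)

/-- In characteristic two the elements of `Q₈` act on the representations of degree two by
unitriangular matrices. -/
theorem quatFun_two_triangular (hω : ω ^ 2 + ω + 1 = 0) (ht : 3 * t = 1) (h2 : (2 : R) = 0)
    (q : QuaternionGroup 2) :
    let M := TetraRelations.quatFun
      (!![t * (ω ^ 2 - ω), 1; -2 * t, -(t * (ω ^ 2 - ω))] : Matrix (Fin 2) (Fin 2) R)
      !![t * (ω ^ 2 - ω), ω ^ 2; -2 * t * ω, -(t * (ω ^ 2 - ω))]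
      !![t * (ω ^ 2 - ω), ω; -2 * t * ω ^ 2, -(t * (ω ^ 2 - ω))] (-1) q
    M 1 0 = 0 ∧ M 0 0 = 1 ∧ M 1 1 = 1 := by
  have cases : ∀ n : ZMod (2 * 2), n = 0 ∨ n = 1 ∨ n = 2 ∨ n = 3 := by decide
  have e1 : t * (ω ^ 2 - ω) = 1 := by linear_combination t * hω + ht + (-2 * t - t * ω) * h2
  have e2 : (-1 : R) = 1 := by linear_combination -h2
  rcases q with n | n <;> rcases cases n with rfl | rfl | rfl | rfl <;>
    simp (decide := true) [TetraRelations.quatFun, e1, e2, h2]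

theorem diagonal_pow_two (a b : R) (n : ℕ) : (!![a, 0; 0, b] : Matrix (Fin 2) (Fin 2) R) ^ n =
    !![a ^ n, 0; 0, b ^ n] := by
  induction n with
  | zero => ext i j; fin_cases i <;> fin_cases j <;> simp
  | succ n ih =>
    rw [pow_succ, ih]; ext i j; fin_cases i <;> fin_cases j <;> simp [pow_succ]

theorem triangular_mul_diagonal_pow {M : Matrix (Fin 2) (Fin 2) R}
    (hM : M 1 0 = 0 ∧ M 0 0 = 1 ∧ M 1 1 = 1) (a b : R) (n : ℕ) :
    (M * !![a, 0; 0, b] ^ n) 1 0 = 0 ∧ (M * !![a, 0; 0, b] ^ n) 0 0 = a ^ n ∧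
      (M * !![a, 0; 0, b] ^ n) 1 1 = b ^ n := by
  obtain ⟨h1, h2, h3⟩ := hM
  rw [diagonal_pow_two]
  simp [Matrix.mul_apply, Fin.sum_univ_two, h1, h2, h3]

theorem trace_rep_one_of (i : ZMod 3) (g : Atilde4) :
    Matrix.trace (rep hω ht (.inl (some i)) (MonoidAlgebra.of R Atilde4 g)) =
      (ω ^ i.val) ^ g.right.toAdd.val := by
  rw [rep, TetraRelations.algHom_of]
  have key : ∀ q, TetraRelations.quatFun (1 : Matrix (Fin 1) (Fin 1) R) 1 1 1 q = 1 := by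
    intro q
    rcases q with n | n <;> simp [TetraRelations.quatFun]
  have h1 : ∀ (q) (n : ℕ), Matrix.trace (TetraRelations.quatFun (1 : Matrix (Fin 1) (Fin 1) R)
      1 1 1 q * !![ω ^ i.val] ^ n) = (ω ^ i.val) ^ n := fun q n => by
    rw [key, one_mul, Matrix.trace_fin_one]
    clear key
    induction n with
    | zero => simp
    | succ n ih => rw [pow_succ, pow_succ, ← ih, Matrix.mul_apply, Fin.sum_univ_one]; rfl
  exact h1 _ _

/-- In characteristic two the representations of degree two are triangular, with two
representations of degree one on the diagonal. -/
theorem rep_two_triangular (h2 : (2 : R) = 0) (k : ZMod 3) (x : MonoidAlgebra R Atilde4) :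
    let M : Matrix (Fin 2) (Fin 2) R := rep hω ht (.inr k) x
    M 1 0 = 0 ∧ M 0 0 = Matrix.trace (rep hω ht (.inl (some (k + 1))) x) ∧
      M 1 1 = Matrix.trace (rep hω ht (.inl (some (k + 2))) x) := by
  have h3 : ω ^ 3 = 1 := by linear_combination (ω - 1) * hω
  have hp1 : ω ^ (k + 1).val = ω ^ (k.val + 1) := by
    rw [ZMod.val_add, ← pow_eq_pow_mod _ h3]; rfl
  have hp2 : ω ^ (k + 2).val = ω ^ (k.val + 2) := by
    rw [ZMod.val_add, ← pow_eq_pow_mod _ h3]; rfl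
  have hg : ∀ g : Atilde4,
      let M : Matrix (Fin 2) (Fin 2) R := rep hω ht (.inr k) (MonoidAlgebra.of R Atilde4 g)
      M 1 0 = 0 ∧ M 0 0 = (ω ^ (k + 1).val) ^ g.right.toAdd.val ∧
        M 1 1 = (ω ^ (k + 2).val) ^ g.right.toAdd.val := by
    intro g
    rw [rep, TetraRelations.algHom_of, hp1, hp2]
    exact triangular_mul_diagonal_pow (quatFun_two_triangular hω ht h2 g.left) _ _ _
  let entry (i j : Fin 2) : MonoidAlgebra R Atilde4 →ₗ[R] R :=
    Matrix.entryLinearMap R R i j ∘ₗ (rep hω ht (.inr k)).toLinearMap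
  let tr (i : ZMod 3) : MonoidAlgebra R Atilde4 →ₗ[R] R :=
    Matrix.traceLinearMap _ R R ∘ₗ (rep hω ht (.inl (some i))).toLinearMap
  have lin : ∀ f g : MonoidAlgebra R Atilde4 →ₗ[R] R,
      (∀ a, f (MonoidAlgebra.of R Atilde4 a) = g (MonoidAlgebra.of R Atilde4 a)) → f x = g x := by
    intro f g h
    rw [eq_sum_of x, map_sum, map_sum]
    exact Finset.sum_congr rfl fun a _ => by rw [map_smul, map_smul, h]
  refine ⟨lin (entry 1 0) 0 fun g => (hg g).1, lin (entry 0 0) (tr (k + 1)) fun g => ?_,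
    lin (entry 1 1) (tr (k + 2)) fun g => ?_⟩
  · exact (hg g).2.1.trans (trace_rep_one_of hω ht (k + 1) g).symm
  · exact (hg g).2.2.trans (trace_rep_one_of hω ht (k + 2) g).symm

/-- The representation of degree three and the sum of the representations of degree one differ by a
multiple of `4`. -/
theorem trace_rep_three_sub (x : MonoidAlgebra R Atilde4) : ∃ y : R,
    Matrix.trace (rep hω ht (.inl none) x) - ∑ i, Matrix.trace (rep hω ht (.inl (some i)) x) =
      4 * y := by
  have hg : ∀ g : Atilde4, ∃ y : R, charTable ω (.inl none) (classIndex g) -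
      ∑ i, charTable ω (.inl (some i)) (classIndex g) = 4 * y := fun g => by
    generalize classIndex g = j
    refine ⟨if j = 2 then -1 else 0, ?_⟩
    rw [ZMod.sum_univ_three]
    fin_cases j <;> simp [charTable, val_zmod] <;> grind
  choose y hy using hg
  refine ⟨∑ g, x.coeff g * y g, ?_⟩
  have h1 : ∀ τ, Matrix.trace (rep hω ht τ x) = ∑ g, x.coeff g * charTable ω τ (classIndex g) := by
    intro τ
    conv_lhs => rw [eq_sum_of x, map_sum, Matrix.trace_sum]
    exact Finset.sum_congr rfl fun g _ => by
      rw [map_smul, Matrix.trace_smul, trace_rep_of, smul_eq_mul]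
  simp only [h1]
  rw [Finset.sum_comm, ← Finset.sum_sub_distrib, Finset.mul_sum]
  exact Finset.sum_congr rfl fun g _ => by
    rw [← Finset.mul_sum, ← mul_sub, hy]; ring

end

end CharIndex

namespace CharIndex

open Atilde4 IsLocalRing

variable {O : Type*} [CommRing O] [IsLocalRing O] [IsDomain O] [CharZero O]

/-- The linear relations between the multiplicities in a projective character. -/
structure ProjRelation (m : CharIndex → ℤ) : Prop where
  three : m (.inl none) = ∑ i, m (.inl (some i))
  two : ∀ k, m (.inr k) = m (.inl (some (k + 1))) + m (.inl (some (k + 2)))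

theorem ProjRelation.add {m m' : CharIndex → ℤ} (h : ProjRelation m) (h' : ProjRelation m') :
    ProjRelation (m + m') :=
  ⟨by simp [h.three, h'.three, Finset.sum_add_distrib],
    fun k => by simp [h.two, h'.two]; ring⟩

theorem ProjRelation.neg {m : CharIndex → ℤ} (h : ProjRelation m) : ProjRelation (-m) :=
  ⟨by simp [h.three, Finset.sum_neg_distrib], fun k => by simp [h.two]; ring⟩

theorem ProjRelation.zero : ProjRelation 0 := ⟨by simp, by simp⟩

/-- The trace of an idempotent matrix over a domain of characteristic zero. -/
theorem exists_trace_eq_of_isDomain {R : Type*} [CommRing R] [IsDomain R] [CharZero R] {n : ℕ}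
    {M : Matrix (Fin n) (Fin n) R} (hM : IsIdempotentElem M) : ∃ r : ℕ, r ≤ n ∧ M.trace = r := by
  have : CharZero (FractionRing R) :=
    charZero_of_injective_algebraMap (IsFractionRing.injective R (FractionRing R))
  have hM' : IsIdempotentElem ((algebraMap R (FractionRing R)).mapMatrix M) := by
    rw [IsIdempotentElem, ← map_mul, hM.eq]
  obtain ⟨r, h1, h2, -⟩ := SplitAlgebra.exists_trace_eq hM'
  refine ⟨r, h1, IsFractionRing.injective R (FractionRing R) ?_⟩
  rw [map_natCast, ← h2, RingHom.mapMatrix_apply, AddMonoidHom.map_trace]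

theorem one_notMem (O : Type*) [CommRing O] [IsLocalRing O] : (1 : O) ∉ maximalIdeal O :=
  (Ideal.ne_top_iff_one _).1 (Ideal.IsPrime.ne_top')

theorem eq_add_of_one_eq_mul {F : Type*} [Field F] {a b c : ℕ} (ha : a ≤ 1) (hb : b ≤ 1)
    (hc : c = 2) (h : (1 : F) = a * b) : c = a + b := by
  subst hc
  interval_cases a <;> interval_cases b <;> simp at h ⊢

theorem eq_add_of_zero_eq_mul {F : Type*} [Field F] {a b c : ℕ} (ha : a ≤ 1)
    (hb : b ≤ 1) (hc : c ≤ 1) (h : (0 : F) = a * b) (h' : (c : F) = a + b) : c = a + b := by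
  interval_cases a <;> interval_cases b <;> interval_cases c <;> simp at h h' ⊢

variable {ω t : O} (hω : ω ^ 2 + ω + 1 = 0) (ht : 3 * t = 1)

/-- The multiplicities of the irreducible characters in the projective character of an idempotent of
the group ring satisfy the relations of the rows of the decomposition matrix. -/
theorem exists_trace_rep (h2 : (2 : O) ∈ maximalIdeal O) {e : MonoidAlgebra O Atilde4}
    (he : IsIdempotentElem e) : ∃ r : CharIndex → ℕ,
      (∀ τ, Matrix.trace (rep hω ht τ e) = r τ) ∧ ProjRelation fun τ => r τ := by
  have hrep : ∀ τ, IsIdempotentElem (rep hω ht τ e) := fun τ => by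
    rw [IsIdempotentElem, ← map_mul, he.eq]
  choose r hr hr' using fun τ => exists_trace_eq_of_isDomain (hrep τ)
  have hone : ∀ i, r (.inl (some i)) ≤ 1 := fun i => hr (.inl (some i))
  have hthree : r (.inl none) ≤ 3 := hr (.inl none)
  refine ⟨r, hr', ?_, fun k => ?_⟩
  · obtain ⟨y, hy⟩ := trace_rep_three_sub hω ht e
    simp only [hr', ZMod.sum_univ_three] at hy ⊢
    have b0 := hone 0
    have b1 := hone 1
    have b2 := hone 2
    by_contra hne
    -- a nonzero integer of absolute value at most three is not divisible by four
    have h1 : ∃ n : ℤ, (n = 1 ∨ n = 3 ∨ n = 2) ∧ ∃ z : O, (n : O) = 4 * z := by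
      rcases lt_or_gt_of_ne hne with hlt | hlt
      · exact ⟨(r (.inl (some 0)) + r (.inl (some 1)) + r (.inl (some 2))) - r (.inl none), by omega,
          -y, by rw [mul_neg, ← hy]; push_cast; ring⟩
      · exact ⟨r (.inl none) - (r (.inl (some 0)) + r (.inl (some 1)) + r (.inl (some 2))), by omega,
          y, by rw [← hy]; push_cast; ring⟩
    obtain ⟨n, hn, z, hz⟩ := h1
    apply one_notMem O
    rcases hn with rfl | rfl | rfl
    · rw [show (1 : O) = 2 * (2 * z) by push_cast at hz; rw [hz]; ring]
      exact Ideal.mul_mem_right _ _ h2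
    · rw [show (1 : O) = 2 * (2 * z - 1) by push_cast at hz; linear_combination hz]
      exact Ideal.mul_mem_right _ _ h2
    · have : (2 : O) * 1 = 2 * (2 * z) := by push_cast at hz; linear_combination hz
      rw [mul_left_cancel₀ two_ne_zero this]
      exact Ideal.mul_mem_right _ _ h2
  · have hk2 := two_eq_zero h2
    let M : Matrix (Fin 2) (Fin 2) O := rep hω ht (.inr k) e
    let M' : Matrix (Fin 2) (Fin 2) (ResidueField O) :=
      rep (map_root (residue O) hω) (map_third (residue O) ht) (.inr k) (reduction O e)
    obtain ⟨t1, t2, t3⟩ := rep_two_triangular (map_root (residue O) hω)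
      (map_third (residue O) ht) hk2 k (reduction O e)
    have hred : ∀ τ, rep (map_root (residue O) hω) (map_third (residue O) ht) τ (reduction O e) =
        (residue O).mapMatrix (rep hω ht τ e) := fun τ => by
      rw [← rep_mapRingHom (residue O) hω ht (map_root (residue O) hω) (map_third (residue O) ht)]
      rfl
    have htr : ∀ i, Matrix.trace (rep (map_root (residue O) hω) (map_third (residue O) ht)
        (.inl (some i)) (reduction O e)) = (r (.inl (some i)) : ResidueField O) := fun i => by
      rw [hred, RingHom.mapMatrix_apply, ← AddMonoidHom.map_trace, hr']
      exact map_natCast _ _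
    rw [htr] at t2 t3
    have hM' : M' = (residue O).mapMatrix M := hred _
    have hdet : residue O M.det = r (.inl (some (k + 1))) * r (.inl (some (k + 2))) := by
      rw [RingHom.map_det, ← hM', Matrix.det_fin_two]
      change M' 0 0 * M' 1 1 - M' 0 1 * M' 1 0 = _
      rw [show M' 1 0 = 0 from t1, show M' 0 0 = _ from t2, show M' 1 1 = _ from t3, mul_zero,
        sub_zero]
    have htrace : residue O M.trace = r (.inl (some (k + 1))) + r (.inl (some (k + 2))) := by
      have : residue O M.trace = M'.trace := by
        rw [hM', RingHom.mapMatrix_apply, ← AddMonoidHom.map_trace]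
      rw [this, Matrix.trace_fin_two, show M' 0 0 = _ from t2, show M' 1 1 = _ from t3]
    have b1 := hone (k + 1)
    have b2 := hone (k + 2)
    have hMr : M.trace = r (.inr k) := hr' _
    rcases trace_idem_two (M := M) (hrep (.inr k)) with ⟨d, tr⟩ | ⟨d, tr⟩
    · rw [d, map_one] at hdet
      have h3 : (r (.inr k) : O) = (2 : ℕ) := by rw [← hMr, tr]; rfl
      exact_mod_cast eq_add_of_one_eq_mul b1 b2 (Nat.cast_injective h3) hdet
    · rw [d, map_zero] at hdet
      have h3 : r (.inr k) ≤ 1 := by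
        have : r (.inr k) = 0 ∨ r (.inr k) = 1 := by
          rw [hMr] at tr
          exact_mod_cast tr
        omega
      rw [hMr, map_natCast] at htrace
      exact_mod_cast eq_add_of_zero_eq_mul b1 b2 h3 hdet htrace

/-- The multiplicities of the irreducible characters in a projective character of the group ring. -/
theorem projRelation_of_mem (K : Type*) [Field K] [CharZero K] [Algebra O K] [IsFractionRing O K]
    (h2 : (2 : O) ∈ maximalIdeal O) (hd : ∀ τ, dim τ ≠ 0)
    {f : CharGroup K (K ⊗[O] MonoidAlgebra O Atilde4)}
    (hf : f ∈ projCharacters O K (MonoidAlgebra O Atilde4)) :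
    ProjRelation fun τ => f (SplitAlgebra.irr (tensorEquiv K hω ht) hd τ) := by
  induction hf using AddSubgroup.closure_induction with
  | mem f hf =>
    obtain ⟨e, he, hfe⟩ := hf
    obtain ⟨r, hr, hrel⟩ := exists_trace_rep hω ht h2 he.1
    have hid : IsIdempotentElem ((1 : K) ⊗ₜ[O] e) := by
      rw [IsIdempotentElem, Algebra.TensorProduct.tmul_mul_tmul, he.1.eq, one_mul]
    rw [SplitAlgebra.moduleCharacter_span_idem (tensorEquiv K hω ht) hid] at hfe
    have key : ∀ τ, f (SplitAlgebra.irr (tensorEquiv K hω ht) hd τ) = r τ := fun τ => by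
      have h1 := SplitAlgebra.toLinearForm_unitElt (tensorEquiv K hω ht) hd f τ
      rw [hfe, LinearMap.sum_apply, Finset.sum_eq_single τ] at h1
      · rw [LinearMap.smul_apply, SplitAlgebra.chi_unitElt, if_pos rfl, smul_eq_mul, mul_one,
          SplitAlgebra.chi_apply, tensorEquiv_one_tmul, RingHom.mapMatrix_apply,
          ← AddMonoidHom.map_trace, hr] at h1
        have h3 : ((r τ : ℤ) : K) = (f (SplitAlgebra.irr (tensorEquiv K hω ht) hd τ) : K) := by
          rw [← h1]; simp
        exact_mod_cast h3.symm
      · intro u _ hu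
        rw [LinearMap.smul_apply, SplitAlgebra.chi_unitElt, if_neg hu, smul_zero]
      · simp
    simpa only [key] using hrel
  | zero => exact ProjRelation.zero
  | add x y _ _ hx hy => exact hx.add hy
  | neg x _ hx => exact hx.neg

end CharIndex

/-! ### Triples of roots -/

namespace CharIndex

/-- The multiplicities attached to the root `a - b` of the root system of type `A₃` realised on the
four characters of odd degree. Up to sign, the projective indecomposable characters are of this
form. -/
def rootFun (a b : Option (ZMod 3)) : CharIndex → ℤ
  | .inl none => (if none = b then 1 else 0) - (if none = a then 1 else 0)
  | .inl (some i) => (if some i = a then 1 else 0) - (if some i = b then 1 else 0)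
  | .inr k => ((if some (k + 1) = a then 1 else 0) - (if some (k + 1) = b then 1 else 0)) +
      ((if some (k + 2) = a then 1 else 0) - (if some (k + 2) = b then 1 else 0))

/-- The vectors of norm four which satisfy the relations of projective characters are roots. -/
theorem ProjRelation.exists_root {m : CharIndex → ℤ} (h : ProjRelation m)
    (hm : ∑ t, m t * m t = 4) : ∃ a b, m = rootFun a b := by
  have hz := fun k => h.two k
  have h0 := hz 0
  have h1 := hz 1
  have h2 := hz 2
  have h3 := h.three
  rw [show (0 : ZMod 3) + 1 = 1 from rfl, show (0 : ZMod 3) + 2 = 2 from rfl] at h0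
  rw [show (1 : ZMod 3) + 1 = 2 from rfl, show (1 : ZMod 3) + 2 = 0 from rfl] at h1
  rw [show (2 : ZMod 3) + 1 = 0 from rfl, show (2 : ZMod 3) + 2 = 1 from rfl] at h2
  rw [ZMod.sum_univ_three] at h3
  rw [sum_univ, h0, h1, h2, h3] at hm
  have key : ∀ a b, (m (.inl (some 0)) = rootFun a b (.inl (some 0))) →
      (m (.inl (some 1)) = rootFun a b (.inl (some 1))) →
      (m (.inl (some 2)) = rootFun a b (.inl (some 2))) →
      m (.inl (some 0)) + m (.inl (some 1)) + m (.inl (some 2)) = rootFun a b (.inl none) →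
      ∃ a b, m = rootFun a b := by
    intro a b e0 e1 e2 e3
    refine ⟨a, b, funext fun t => ?_⟩
    rcases t with (_ | i) | k
    · rw [h3, e3]
    · rcases zmod_cases i with rfl | rfl | rfl <;> assumption
    · rcases zmod_cases k with rfl | rfl | rfl
      · rw [h0, e1, e2]; rfl
      · rw [h1, e2, e0]; rfl
      · rw [h2, e0, e1]; rfl
  generalize m (.inl (some 0)) = x at hm key
  generalize m (.inl (some 1)) = y at hm key
  generalize m (.inl (some 2)) = z at hm key
  have hn : x ^ 2 + y ^ 2 + z ^ 2 + (x + y + z) ^ 2 = 2 := by nlinarith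
  have bd : ∀ u v : ℤ, 0 ≤ v → u ^ 2 + v = 2 → -1 ≤ u ∧ u ≤ 1 := fun u v hv h =>
    ⟨by nlinarith, by nlinarith⟩
  obtain ⟨x1, x2⟩ := bd x (y ^ 2 + z ^ 2 + (x + y + z) ^ 2) (by positivity) (by linarith)
  obtain ⟨y1, y2⟩ := bd y (x ^ 2 + z ^ 2 + (x + y + z) ^ 2) (by positivity) (by linarith)
  obtain ⟨z1, z2⟩ := bd z (x ^ 2 + y ^ 2 + (x + y + z) ^ 2) (by positivity) (by linarith)
  have fin : ∀ x y z : Fin 3, ((x : ℤ) - 1) ^ 2 + ((y : ℤ) - 1) ^ 2 + ((z : ℤ) - 1) ^ 2 +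
      (((x : ℤ) - 1) + ((y : ℤ) - 1) + ((z : ℤ) - 1)) ^ 2 = 2 → ∃ a b,
      ((x : ℤ) - 1) = rootFun a b (.inl (some 0)) ∧ ((y : ℤ) - 1) = rootFun a b (.inl (some 1)) ∧
      ((z : ℤ) - 1) = rootFun a b (.inl (some 2)) ∧
      (((x : ℤ) - 1) + ((y : ℤ) - 1) + ((z : ℤ) - 1)) = rootFun a b (.inl none) := by
    decide +kernel
  have lift : ∀ u : ℤ, -1 ≤ u → u ≤ 1 → ∃ v : Fin 3, u = (v : ℤ) - 1 := fun u h1 h2 =>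
    ⟨⟨(u + 1).toNat, by omega⟩, by simp; omega⟩
  obtain ⟨x, rfl⟩ := lift x x1 x2
  obtain ⟨y, rfl⟩ := lift y y1 y2
  obtain ⟨z, rfl⟩ := lift z z1 z2
  obtain ⟨a, b, e0, e1, e2, e3⟩ := fin x y z hn
  exact key a b e0 e1 e2 e3

/-- Two vectors of the root system with scalar product `2`, that is two roots at an angle of sixty
degrees, share exactly their first or exactly their last index. -/
theorem rootFun_inner : ∀ a b c d : Option (ZMod 3),
    ∑ t, rootFun a b t * rootFun c d t = 2 →
      a ≠ b ∧ c ≠ d ∧ ((a = c ∧ b ≠ d) ∨ (b = d ∧ a ≠ c)) := by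
  decide +kernel

theorem rootFun_swap (a b : Option (ZMod 3)) (t : CharIndex) : rootFun a b t = -rootFun b a t := by
  rcases t with (_ | _) | _ <;> simp only [rootFun] <;> ring

/-- The map of the characters of odd degree given by the images of the character of degree three and
of the characters of degree one. -/
def starFun (a b₀ b₁ b₂ : Option (ZMod 3)) : Option (ZMod 3) → Option (ZMod 3)
  | none => a
  | some i => if i = 0 then b₀ else if i = 1 then b₁ else b₂

/-- The map of the irreducible characters induced by a map of those of odd degree. -/
def inducedFun (τ : Option (ZMod 3) → Option (ZMod 3)) : CharIndex → CharIndex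
  | .inl x => .inl (τ x)
  | .inr i => .inr (third (τ none) (τ (some i)))

set_option synthInstance.maxSize 1024 in
set_option synthInstance.maxHeartbeats 200000 in
/-- Four distinct characters of odd degree define a permutation of all the irreducible characters
that moves the support of the `i`-th projective indecomposable character onto a set outside of which
the root `a - bᵢ` vanishes, and that is compatible with `pairFun` and `octFun`. -/
theorem starFun_spec : ∀ a b₀ b₁ b₂ : Option (ZMod 3), a ≠ b₀ → a ≠ b₁ → a ≠ b₂ → b₀ ≠ b₁ →
    b₀ ≠ b₂ → b₁ ≠ b₂ →
    (∀ x y, starFun a b₀ b₁ b₂ x = starFun a b₀ b₁ b₂ y → x = y) ∧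
    (∀ s t, inducedFun (starFun a b₀ b₁ b₂) s = inducedFun (starFun a b₀ b₁ b₂) t → s = t) ∧
    (∀ i t, ¬ supp i t →
      rootFun a (starFun a b₀ b₁ b₂ (some i)) (inducedFun (starFun a b₀ b₁ b₂) t) = 0) ∧
    (∀ x y t, x ≠ y → pairFun (starFun a b₀ b₁ b₂ x) (starFun a b₀ b₁ b₂ y)
      (inducedFun (starFun a b₀ b₁ b₂) t) = pairFun x y t) ∧
    ∀ x t, octFun (starFun a b₀ b₁ b₂ x) (inducedFun (starFun a b₀ b₁ b₂) t) = octFun x t := by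
  intro a b₀ b₁ b₂ h1 h2 h3 h4 h5 h6
  refine ⟨?_, ?_, ?_, ?_, ?_⟩ <;> revert a b₀ b₁ b₂ <;> decide +kernel

/-- Three vectors which satisfy the relations of projective characters and have the scalar products
of the projective indecomposable characters agree with these up to sign and a permutation of the
irreducible characters, which preserves the functions `pairFun` and `octFun`. -/
theorem exists_perm_of_gram {F : ZMod 3 → CharIndex → ℤ} (hF : ∀ i, ProjRelation (F i))
    (hgram : ∀ i j, ∑ t, F i t * F j t = if i = j then 4 else 2) :
    ∃ (τ : Option (ZMod 3) ≃ Option (ZMod 3)) (T : CharIndex ≃ CharIndex),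
      (∀ i t, ¬ supp i t → F i (T t) = 0) ∧
      (∀ x y t, x ≠ y → pairFun (τ x) (τ y) (T t) = pairFun x y t) ∧
      ∀ x t, octFun (τ x) (T t) = octFun x t := by
  choose a b hab using fun i => (hF i).exists_root (by simpa using hgram i i)
  have inner : ∀ i j, i ≠ j → a i ≠ b i ∧ a j ≠ b j ∧
      ((a i = a j ∧ b i ≠ b j) ∨ (b i = b j ∧ a i ≠ a j)) := fun i j hij => by
    apply rootFun_inner
    rw [← hab, ← hab, hgram, if_neg hij]
  obtain ⟨n0, n1, h01⟩ := inner 0 1 (by decide)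
  obtain ⟨-, n2, h02⟩ := inner 0 2 (by decide)
  obtain ⟨-, -, h12⟩ := inner 1 2 (by decide)
  have main : ∀ c d : ZMod 3 → Option (ZMod 3), (∀ i t, F i t = 0 ↔ rootFun (c i) (d i) t = 0) →
      c 0 = c 1 → c 0 = c 2 → c 0 ≠ d 0 → c 0 ≠ d 1 → c 0 ≠ d 2 → d 0 ≠ d 1 → d 0 ≠ d 2 →
      d 1 ≠ d 2 → ∃ (τ : Option (ZMod 3) ≃ Option (ZMod 3)) (T : CharIndex ≃ CharIndex),
      (∀ i t, ¬ supp i t → F i (T t) = 0) ∧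
      (∀ x y t, x ≠ y → pairFun (τ x) (τ y) (T t) = pairFun x y t) ∧
      ∀ x t, octFun (τ x) (T t) = octFun x t := by
    intro c d hcd e1 e2 m0 m1 m2 m01 m02 m12
    obtain ⟨s1, s2, s3, s4, s5⟩ := starFun_spec (c 0) (d 0) (d 1) (d 2) m0 m1 m2 m01 m02 m12
    refine ⟨Equiv.ofBijective _ (Finite.injective_iff_bijective.1 fun x y h => s1 x y h),
      Equiv.ofBijective _ (Finite.injective_iff_bijective.1 fun x y h => s2 x y h),
      fun i t hit => (hcd _ _).2 ?_, s4, s5⟩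
    have h := s3 i t hit
    rcases zmod_cases i with rfl | rfl | rfl
    · exact h
    · rw [← e1]; exact h
    · rw [← e2]; exact h
  rcases h01 with ⟨p, q⟩ | ⟨p, q⟩ <;> rcases h02 with ⟨p', q'⟩ | ⟨p', q'⟩ <;>
    rcases h12 with ⟨p'', q''⟩ | ⟨p'', q''⟩
  · exact main a b (fun i t => by rw [hab]) p p' n0 (p ▸ n1) (p' ▸ n2) q q' q''
  all_goals first
    | exact main b a (fun i t => by rw [hab, rootFun_swap, neg_eq_zero]) p p' n0.symm
        (p ▸ n1.symm) (p' ▸ n2.symm) q q' q''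
    | (exfalso; grind)

end CharIndex

/-! ### Central idempotents and multiplicities -/

namespace SplitAlgebra

section

variable {K B ι : Type*} [Field K] [Ring B] [Algebra K B] [Fintype ι] [DecidableEq ι] {n : ι → ℕ}
  (φ : B ≃ₐ[K] ((i : ι) → Matrix (Fin (n i)) (Fin (n i)) K))

/-- The central idempotents of the factors span the center. -/
theorem exists_eq_sum_centralIdem (z : Subalgebra.center K B) :
    ∃ c : ι → K, z = ∑ i, c i • centralIdem φ i := by
  have hz : ∀ j, ∃ c : K, φ (z : B) j = c • (1 : Matrix (Fin (n j)) (Fin (n j)) K) := fun j => by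
    have hc : φ (z : B) j ∈ Set.center (Matrix (Fin (n j)) (Fin (n j)) K) := by
      rw [Semigroup.mem_center_iff]
      intro M
      have := congrArg (fun x => φ x j) (Subalgebra.mem_center_iff.1 z.2
        (φ.symm (Pi.single j M)))
      simpa using this
    rw [Matrix.center_eq_range] at hc
    obtain ⟨c, hc⟩ := hc
    exact ⟨c, by rw [← hc, Matrix.scalar_apply, Matrix.smul_one_eq_diagonal]⟩
  choose c hc using hz
  refine ⟨c, Subtype.ext (φ.injective (funext fun j => ?_))⟩
  rw [AddSubmonoidClass.coe_finsetSum, map_sum, Finset.sum_apply, Finset.sum_eq_single j]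
  · change _ = φ (c j • φ.symm (Pi.single j 1)) j
    rw [map_smul, AlgEquiv.apply_symm_apply, Pi.smul_apply, Pi.single_eq_same, hc]
  · intro i _ hi
    change φ (c i • φ.symm (Pi.single i 1)) j = 0
    rw [map_smul, AlgEquiv.apply_symm_apply, Pi.smul_apply, Pi.single_eq_of_ne hi.symm, smul_zero]
  · simp

/-- A linear map which maps the primitive central idempotents bijectively to primitive central
idempotents is injective. -/
theorem injective_of_centralIdem {B' ι' : Type*} [Ring B'] [Algebra K B'] [Fintype ι']
    [DecidableEq ι'] {n' : ι' → ℕ} (hn' : ∀ i, n' i ≠ 0)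
    (φ' : B' ≃ₐ[K] ((i : ι') → Matrix (Fin (n' i)) (Fin (n' i)) K))
    (ψ : Subalgebra.center K B →ₗ[K] Subalgebra.center K B') (E : ι ≃ ι')
    (h : ∀ i, ψ (centralIdem φ i) = centralIdem φ' (E i)) : Function.Injective ψ := by
  rw [injective_iff_map_eq_zero]
  intro z hz
  obtain ⟨c, rfl⟩ := exists_eq_sum_centralIdem φ z
  simp only [map_sum, map_smul, h] at hz
  refine Finset.sum_eq_zero fun j _ => ?_
  have h1 := congrArg (fun z : Subalgebra.center K B' => φ' (z : B') (E j)) hz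
  simp only [AddSubmonoidClass.coe_finsetSum, map_sum, Finset.sum_apply] at h1
  rw [Finset.sum_eq_single j] at h1
  · have : NeZero (n' (E j)) := ⟨hn' _⟩
    have h2 : φ' (c j • φ'.symm (Pi.single (E j) 1)) (E j) = 0 := h1.trans (by simp)
    rw [map_smul, AlgEquiv.apply_symm_apply, Pi.smul_apply, Pi.single_eq_same] at h2
    rw [(smul_eq_zero.1 h2).resolve_right one_ne_zero, zero_smul]
  · intro i _ hi
    change φ' (c i • φ'.symm (Pi.single (E i) 1)) (E j) = 0
    rw [map_smul, AlgEquiv.apply_symm_apply, Pi.smul_apply,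
      Pi.single_eq_of_ne fun h => hi (E.injective h.symm), smul_zero]
  · simp

/-- The generalised character with given multiplicities. -/
noncomputable def ofMultiplicities (hn : ∀ i, n i ≠ 0) (r : ι → ℕ) : CharGroup K B :=
  ∑ i, Finsupp.single (irr φ hn i) (r i : ℤ)

theorem ofMultiplicities_apply (hn : ∀ i, n i ≠ 0) (r : ι → ℕ) (i : ι) :
    ofMultiplicities φ hn r (irr φ hn i) = r i := by
  rw [ofMultiplicities, Finsupp.finsetSum_apply, Finset.sum_eq_single i]
  · rw [Finsupp.single_eq_same]
  · intro j _ hj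
    exact Finsupp.single_eq_of_ne fun h => hj (irr_injective φ hn h.symm)
  · simp

theorem ofMultiplicities_add (hn : ∀ i, n i ≠ 0) (r r' : ι → ℕ) :
    ofMultiplicities φ hn (r + r') = ofMultiplicities φ hn r + ofMultiplicities φ hn r' := by
  simp [ofMultiplicities, Finset.sum_add_distrib]

theorem toLinearForm_ofMultiplicities (hn : ∀ i, n i ≠ 0) (r : ι → ℕ) :
    (ofMultiplicities φ hn r).toLinearForm = ∑ i, (r i : K) • chi φ i := by
  rw [CharGroup.toLinearForm, ofMultiplicities,
    ← Finsupp.sum_finsetSum_index (h := fun (χ : irrCharacters K B) (n : ℤ) => n • (χ : B →ₗ[K] K))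
      (fun _ => zero_smul _ _) fun _ _ _ => add_smul _ _ _]
  refine Finset.sum_congr rfl fun i _ => ?_
  rw [Finsupp.sum_single_index
    (h := fun (χ : irrCharacters K B) (n : ℤ) => n • (χ : B →ₗ[K] K)) (zero_smul _ _)]
  change (r i : ℤ) • chi φ i = _
  rw [natCast_zsmul, Nat.cast_smul_eq_nsmul]

end

variable {O K A ι : Type*} [CommRing O] [Field K] [CharZero K] [Algebra O K] [Ring A] [Algebra O A]
  [Fintype ι] [DecidableEq ι] {n : ι → ℕ}
  (φ : K ⊗[O] A ≃ₐ[K] ((i : ι) → Matrix (Fin (n i)) (Fin (n i)) K))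

/-- The character of the projective module given by any idempotent lies in the group generated by
the characters of the projective indecomposable modules. -/
theorem ofMultiplicities_mem_projCharacters (hn : ∀ i, n i ≠ 0)
    (hinj : Function.Injective fun a : A => (1 : K) ⊗ₜ[O] a) {e : A} (he : IsIdempotentElem e)
    {r : ι → ℕ} (hr : ∀ i, chi φ i (1 ⊗ₜ e) = r i) :
    ofMultiplicities φ hn r ∈ projCharacters O K A := by
  have idem : ∀ f : A, IsIdempotentElem f → IsIdempotentElem ((1 : K) ⊗ₜ[O] f) := fun f hf => by
    rw [IsIdempotentElem, Algebra.TensorProduct.tmul_mul_tmul, hf.eq, one_mul]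
  induction hm : ∑ i, r i using Nat.strong_induction_on generalizing e r with
  | _ m ih =>
    subst hm
    by_cases hp : IsPrimitiveIdempotent e
    · refine AddSubgroup.subset_closure ⟨e, hp, ?_⟩
      rw [toLinearForm_ofMultiplicities, moduleCharacter_span_idem φ (idem e he)]
      exact Finset.sum_congr rfl fun i _ => by rw [hr]
    · by_cases h0 : e = 0
      · have : r = 0 := funext fun i => by
          have := hr i
          rw [h0, TensorProduct.tmul_zero, map_zero] at this
          exact_mod_cast this.symm
        rw [this]
        have : ofMultiplicities φ hn (0 : ι → ℕ) = 0 := by simp [ofMultiplicities]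
        rw [this]; exact zero_mem _
      · simp only [IsPrimitiveIdempotent, not_and, not_forall, not_or] at hp
        obtain ⟨f, g, hf, hg, hfg, hgf, hsum, hf0, hg0⟩ := hp he h0
        obtain ⟨p, hp1, hp2⟩ := exists_chi_eq (φ := φ) (idem f hf)
        obtain ⟨q, hq1, hq2⟩ := exists_chi_eq (φ := φ) (idem g hg)
        have hpos : ∀ (f : A) (p : ι → ℕ), f ≠ 0 → (∀ i, p i = 0 → φ (1 ⊗ₜ f) i = 0) →
            0 < ∑ i, p i := fun f p hf h => by
          by_contra! hle
          apply hf
          apply hinj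
          apply φ.injective
          funext i
          rw [h i (Finset.sum_eq_zero_iff.1 (Nat.le_zero.1 hle) i (Finset.mem_univ i))]
          simp
        have hrpq : r = p + q := funext fun i => by
          have := hr i
          rw [← hsum, TensorProduct.tmul_add, map_add, hp1, hq1] at this
          exact_mod_cast this.symm
        have hs : ∑ i, r i = ∑ i, p i + ∑ i, q i := by
          rw [hrpq]; exact Finset.sum_add_distrib
        have := hpos f p hf0 hp2
        have := hpos g q hg0 hq2
        rw [hrpq, ofMultiplicities_add]
        exact add_mem (ih _ (by omega) hf hp1 rfl) (ih _ (by omega) hg hq1 rfl)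

end SplitAlgebra

/-! ### Lifting from the residue field -/

theorem Module.Basis.mem_ideal_smul_top_iff {R M ι : Type*} [CommRing R] [AddCommGroup M]
    [Module R M] [Fintype ι] (b : Module.Basis ι R M) (I : Ideal R) (x : M) :
    x ∈ I • (⊤ : Submodule R M) ↔ ∀ i, b.repr x i ∈ I := by
  constructor
  · intro hx i
    refine Submodule.smul_induction_on hx (fun a ha m _ => ?_) fun x y hx hy => ?_
    · rw [map_smul]; exact I.mul_mem_right _ ha
    · rw [map_add]; exact add_mem hx hy
  · intro h
    rw [← b.sum_repr x]
    exact sum_mem fun i _ => Submodule.smul_mem_smul (h i) trivial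

/-- A finite free module over a complete ring is complete. -/
theorem IsAdicComplete.of_basis {R M ι : Type*} [CommRing R] [AddCommGroup M] [Module R M]
    [Fintype ι] (b : Module.Basis ι R M) (I : Ideal R) [IsAdicComplete I R] :
    IsAdicComplete I M where
  haus' x hx := by
    apply b.ext_elem
    intro i
    rw [map_zero, Finsupp.zero_apply]
    refine IsHausdorff.haus (I := I) inferInstance _ fun n => ?_
    have := hx n
    rw [SModEq.zero] at this ⊢
    rw [smul_eq_mul, Ideal.mul_top]
    exact (b.mem_ideal_smul_top_iff _ _).1 this i
  prec' f hf := by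
    choose L hL using fun i => IsPrecomplete.prec (I := I) inferInstance (f := fun n => b.repr (f n) i)
      (fun {m n} hmn => by
        have := hf hmn
        rw [SModEq.sub_mem] at this ⊢
        rw [smul_eq_mul, Ideal.mul_top]
        have := (b.mem_ideal_smul_top_iff _ _).1 this i
        rwa [map_sub] at this)
    refine ⟨b.equivFun.symm L, fun n => ?_⟩
    rw [SModEq.sub_mem, b.mem_ideal_smul_top_iff]
    intro i
    have := hL i n
    rw [SModEq.sub_mem, smul_eq_mul, Ideal.mul_top] at this
    rw [map_sub, Finsupp.sub_apply]
    have h2 : b.repr (b.equivFun.symm L) i = L i := by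
      rw [← b.equivFun_apply, LinearEquiv.apply_symm_apply]
    rwa [h2]

theorem Ideal.mul_mem_smul_top {O A : Type*} [CommRing O] [Ring A] [Algebra O A] {I J : Ideal O}
    {x y : A} (hx : x ∈ I • (⊤ : Submodule O A)) (hy : y ∈ J • (⊤ : Submodule O A)) :
    x * y ∈ (I * J) • (⊤ : Submodule O A) := by
  refine Submodule.smul_induction_on hx (fun a ha m _ => ?_) fun x x' hx hx' => ?_
  · refine Submodule.smul_induction_on hy (fun b hb m' _ => ?_) fun y y' hy hy' => ?_
    · rw [smul_mul_smul_comm]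
      exact Submodule.smul_mem_smul (Ideal.mul_mem_mul ha hb) trivial
    · rw [mul_add]; exact add_mem hy hy'
  · rw [add_mul]; exact add_mem hx hx'

/-- One step of Newton's method for a cube root of one squares the error. -/
theorem newton_cube_sub_one {O A : Type*} [CommRing O] [Ring A] [Algebra O A] {t : O}
    (ht : 3 * t = 1) (c : A) : (t • (c * (4 - c ^ 3))) ^ 3 - 1 =
      (c ^ 3 - 1) * (c ^ 3 - 1) * (t ^ 3 • (-18 + 8 * (c ^ 3 - 1) - (c ^ 3 - 1) ^ 2)) := by
  have h1 : (t • (Polynomial.X * (4 - Polynomial.X ^ 3)) : Polynomial O) ^ 3 - 1 =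
      (Polynomial.X ^ 3 - 1) * (Polynomial.X ^ 3 - 1) *
        (t ^ 3 • (-18 + 8 * (Polynomial.X ^ 3 - 1) - (Polynomial.X ^ 3 - 1) ^ 2)) := by
    simp only [Polynomial.smul_eq_C_mul, map_pow]
    have h3 : (3 : Polynomial O) * Polynomial.C t = 1 := by
      rw [← map_ofNat Polynomial.C 3, ← map_mul, ht, map_one]
    generalize Polynomial.C t = s at h3 ⊢
    linear_combination (9 * s ^ 2 + 3 * s + 1) * h3
  have := congrArg (Polynomial.aeval c) h1
  simpa [map_ofNat] using this

/-- The correction made by one step of Newton's method is a multiple of the error. -/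
theorem newton_sub {O A : Type*} [CommRing O] [Ring A] [Algebra O A] {t : O}
    (ht : 3 * t = 1) (c : A) : t • (c * (4 - c ^ 3)) - c = t • (c * (1 - c ^ 3)) := by
  have h1 : c = t • (3 * c) := by
    rw [show (3 : A) * c = (3 : O) • c by rw [Algebra.smul_def, map_ofNat], smul_smul, mul_comm,
      ht, one_smul]
  have h2 : c * (4 - c ^ 3) - 3 * c = c * (1 - c ^ 3) := by noncomm_ring
  rw [← h2, smul_sub, ← h1]

/-- A cube root of one modulo `I` lifts to a cube root of one. The sequence
`c ↦ c (4 - c ^ 3) / 3` given by Newton's method converges to it. -/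
theorem exists_cube_eq_one_lift {O A : Type*} [CommRing O] [Ring A] [Algebra O A] (I : Ideal O)
    [IsAdicComplete I A] {t : O} (ht : 3 * t = 1) {c₀ : A}
    (h₀ : c₀ ^ 3 - 1 ∈ I • (⊤ : Submodule O A)) :
    ∃ c : A, c ^ 3 = 1 ∧ c - c₀ ∈ I • (⊤ : Submodule O A) := by
  let N (n : ℕ) : Submodule O A := I ^ n • ⊤
  have mono : ∀ {m n}, m ≤ n → N n ≤ N m := fun hmn =>
    Submodule.smul_mono_left (Ideal.pow_le_pow_right hmn)
  have mulN : ∀ {m n} {x y : A}, x ∈ N m → y ∈ N n → x * y ∈ N (m + n) := fun hx hy => by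
    have := Ideal.mul_mem_smul_top hx hy
    rwa [← pow_add] at this
  have N0 : ∀ x : A, x ∈ N 0 := fun x => by simp [N]
  have mulL : ∀ {n} (x : A) {y : A}, y ∈ N n → x * y ∈ N n := fun x y hy => by
    have := mulN (N0 x) hy
    rwa [zero_add] at this
  have mulR : ∀ {n} {x : A} (y : A), x ∈ N n → x * y ∈ N n := fun y hx => by
    have := mulN hx (N0 y)
    rwa [add_zero] at this
  obtain ⟨s, s_zero, s_succ⟩ : ∃ s : ℕ → A, s 0 = c₀ ∧
      ∀ n, s (n + 1) = t • (s n * (4 - s n ^ 3)) :=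
    ⟨fun n => (fun c : A => t • (c * (4 - c ^ 3)))^[n] c₀, rfl,
      fun n => Function.iterate_succ_apply' _ n c₀⟩
  have hs : ∀ n, s n ^ 3 - 1 ∈ N (n + 1) := fun n => by
    induction n with
    | zero => rw [s_zero]; simpa [N] using h₀
    | succ n ih =>
      rw [s_succ, newton_cube_sub_one ht]
      exact mulR _ (mono (by omega) (mulN ih ih))
  have hd : ∀ n, s (n + 1) - s n ∈ N (n + 1) := fun n => by
    rw [s_succ, newton_sub ht]
    refine Submodule.smul_mem _ _ (mulL _ ?_)
    rw [← neg_sub]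
    exact neg_mem (hs n)
  have hdd : ∀ {m n}, m ≤ n → s n - s m ∈ N m := fun {m n} hmn => by
    induction n, hmn using Nat.le_induction with
    | base => rw [sub_self]; exact zero_mem _
    | succ n hmn ih =>
      rw [← sub_add_sub_cancel _ (s n)]
      exact add_mem (mono (by omega) (hd n)) ih
  obtain ⟨c, hc⟩ := IsPrecomplete.prec (I := I) inferInstance (f := s) (fun {m n} hmn => by
    rw [SModEq.comm, SModEq.sub_mem]; exact hdd hmn)
  have hc' : ∀ n, c - s n ∈ N n := fun n => by
    have := hc n
    rwa [SModEq.comm, SModEq.sub_mem] at this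
  refine ⟨c, ?_, ?_⟩
  · rw [← sub_eq_zero]
    refine IsHausdorff.haus (I := I) inferInstance _ fun n => ?_
    rw [SModEq.zero]
    have h1 : c ^ 3 - 1 = (c - s n) * (c * c) + s n * ((c - s n) * c) + s n * (s n * (c - s n)) +
        (s n ^ 3 - 1) := by noncomm_ring
    rw [h1]
    exact add_mem (add_mem (add_mem (mulR _ (hc' n)) (mulL _ (mulR _ (hc' n))))
      (mulL _ (mulL _ (hc' n)))) (mono (Nat.le_succ n) (hs n))
  · have h1 := hc' 1
    have h2 := hd 0
    have : c - c₀ = (c - s 1) + (s (0 + 1) - s 0) := by rw [s_zero, zero_add]; abel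
    rw [this]
    have := add_mem h1 h2
    simpa [N] using this

namespace ResidueFrame

open IsLocalRing

/-- The dimensions of the Peirce components, as traces of the projections onto them. -/
theorem trace_peirce {O k A B : Type*} [CommRing O] [IsLocalRing O] [CommRing k] [Algebra O k]
    [Ring A] [Ring B] [Algebra O A] [Algebra k B] [Algebra O B] [IsScalarTower O k B]
    [Module.Finite O A] [Module.Free O A] {r : A →ₐ[O] B} {e : ZMod 3 → A} {X Y : ZMod 3 → B}
    (h : ResidueFrame k (fun i => r (e i)) X Y) (hk : Function.Surjective (algebraMap O k))
    (hr : Function.Surjective r)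
    (hker : ∀ x, r x = 0 → x ∈ maximalIdeal O • (⊤ : Submodule O A))
    (idem : ∀ i, e i * e i = e i) (orth : ∀ i j, i ≠ j → e i * e j = 0)
    (hrank : Module.finrank O A = 24) (i j : ZMod 3) :
    LinearMap.trace O A (LinearMap.mulLeft O (e i) ∘ₗ LinearMap.mulRight O (e j)) =
      if i = j then 4 else 2 := by
  let src (p : ZMod 3 × Fin 8) : ZMod 3 := if p.2 = 2 ∨ p.2 = 4 ∨ p.2 = 6 then p.1 + 1 else p.1
  let tgt (p : ZMod 3 × Fin 8) : ZMod 3 := if p.2 = 1 ∨ p.2 = 4 ∨ p.2 = 5 then p.1 + 1 else p.1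
  have hhom : ∀ p, r (e (src p)) * pathWord (fun i => r (e i)) X Y p.1 p.2 * r (e (tgt p)) =
      pathWord (fun i => r (e i)) X Y p.1 p.2 := by
    rintro ⟨l, n⟩
    have hc := cyc_self l
    have e1 := h.eX l
    have e2 := h.Xe l _ _ hc
    have e3 := h.eY l _ _ hc
    have e4 := h.Ye l
    have e5 := h.idem l
    have a1 : ∀ x, r (e l) * (X l * x) = X l * x := fun x => by rw [← mul_assoc, e1]
    have a3 : ∀ x, r (e (l + 1)) * (Y l * x) = Y l * x := fun x => by rw [← mul_assoc, e3]
    fin_cases n <;> simp [src, tgt, pathWord, mul_assoc, e1, e2, e3, e4, e5, a1, a3]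
  choose w₀ hw₀ using fun p : ZMod 3 × Fin 8 => hr (pathWord (fun i => r (e i)) X Y p.1 p.2)
  let w (p : ZMod 3 × Fin 8) : A := e (src p) * w₀ p * e (tgt p)
  have hw : ∀ p, r (w p) = pathWord (fun i => r (e i)) X Y p.1 p.2 := fun p => by
    rw [map_mul, map_mul, hw₀, hhom]
  have hspan : ⊤ ≤ Submodule.span O (Set.range w) := by
    have hmap : (⊤ : Submodule O B) ≤ (Submodule.span O (Set.range w)).map r.toLinearMap := by
      have h1 := Submodule.restrictScalars_mono (S := O) h.top_le_span
      rw [Submodule.restrictScalars_top, Submodule.restrictScalars_span _ _ hk] at h1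
      refine h1.trans (Submodule.span_le.2 ?_)
      rintro _ ⟨p, rfl⟩
      exact ⟨w p, Submodule.subset_span ⟨p, rfl⟩, hw p⟩
    refine Submodule.le_of_le_smul_of_le_jacobson_bot Module.Finite.fg_top
      (IsLocalRing.maximalIdeal_le_jacobson ⊥) fun a _ => ?_
    obtain ⟨n, hn, hna⟩ := hmap (Submodule.mem_top (x := r a))
    have : a = n + (a - n) := by abel
    rw [this]
    exact Submodule.add_mem_sup hn (hker _ (by rw [map_sub, sub_eq_zero]; exact hna.symm))
  let b := Module.Basis.mk
    (linearIndependent_of_top_le_span_of_card_eq_finrank hspan (by rw [hrank]; rfl)) hspan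
  have hb : ∀ p, (LinearMap.mulLeft O (e i) ∘ₗ LinearMap.mulRight O (e j)) (b p) =
      if src p = i ∧ tgt p = j then b p else 0 := fun p => by
    rw [Module.Basis.mk_apply, LinearMap.comp_apply, LinearMap.mulRight_apply,
      LinearMap.mulLeft_apply]
    simp only [w]
    by_cases h1 : src p = i
    · by_cases h2 : tgt p = j
      · rw [if_pos ⟨h1, h2⟩, ← h1, ← h2]
        simp only [mul_assoc, idem]
        simp only [← mul_assoc, idem]
      · rw [if_neg fun h => h2 h.2, mul_assoc, orth _ _ h2, mul_zero, mul_zero]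
    · rw [if_neg fun h => h1 h.1, ← mul_assoc, ← mul_assoc, ← mul_assoc,
        orth _ _ (Ne.symm h1), zero_mul, zero_mul, zero_mul]
  classical
  rw [LinearMap.trace_eq_matrix_trace O b, Matrix.trace]
  have hdiag : ∀ p, (LinearMap.toMatrix b b
      (LinearMap.mulLeft O (e i) ∘ₗ LinearMap.mulRight O (e j))).diag p =
      (((if src p = i ∧ tgt p = j then 1 else 0 : ℕ)) : O) := fun p => by
    rw [Matrix.diag_apply, LinearMap.toMatrix_apply, hb]
    split_ifs <;> simp
  rw [Finset.sum_congr rfl fun p _ => hdiag p, ← Nat.cast_sum]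
  have : ∑ p, (if src p = i ∧ tgt p = j then 1 else 0 : ℕ) = if i = j then 4 else 2 := by
    clear hdiag hb
    simp only [src, tgt]
    revert i j
    decide +kernel
  rw [this]
  split_ifs <;> simp

end ResidueFrame

/-! ### Orders with the reduction of the group ring of `Ã₄` -/

section ResidueHom

open IsLocalRing

variable {O : Type*} [CommRing O] [IsLocalRing O]

/-- A complete local ring with algebraically closed residue field of characteristic two contains a
primitive cube root of unity. -/
theorem exists_root_of_isAdicComplete [IsAdicComplete (maximalIdeal O) O]
    [IsAlgClosed (ResidueField O)] (h2 : (2 : O) ∈ maximalIdeal O) : ∃ ω : O, ω ^ 2 + ω + 1 = 0 := by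
  obtain ⟨x, hx⟩ := IsAlgClosed.exists_root
    (Polynomial.X ^ 2 + Polynomial.X + 1 : Polynomial (ResidueField O)) (by
      have : (Polynomial.X ^ 2 + Polynomial.X + 1 : Polynomial (ResidueField O)).degree = 2 := by
        compute_degree!
      rw [this]; decide)
  obtain ⟨a, rfl⟩ := residue_surjective x
  have ha : residue O (a ^ 2 + a + 1) = 0 := by simpa using hx
  rw [residue_eq_zero_iff] at ha
  have hmonic : (Polynomial.X ^ 2 + Polynomial.X + 1 : Polynomial O).Monic := by monicity!
  obtain ⟨ω, hω, -⟩ := HenselianRing.is_henselian (I := maximalIdeal O) _ hmonic a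
    (by simpa using ha) (by
      have h1 : (Polynomial.derivative (Polynomial.X ^ 2 + Polynomial.X + 1 : Polynomial O)).eval a
          = 1 + 2 * a := by simp; ring
      rw [h1, map_add, map_mul, map_one, Ideal.Quotient.eq_zero_iff_mem.2 h2, zero_mul, add_zero]
      exact isUnit_one)
  exact ⟨ω, by simpa using hω⟩

theorem exists_three_mul_eq_one (h2 : (2 : O) ∈ maximalIdeal O) : ∃ t : O, 3 * t = 1 := by
  have h3 : IsUnit (3 : O) := by
    by_contra hu
    have h3 : (3 : O) ∈ maximalIdeal O := (mem_maximalIdeal _).2 hu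
    have := sub_mem h3 h2
    exact CharIndex.one_notMem O (by convert this using 1; norm_num)
  exact ⟨_, h3.mul_val_inv⟩

/-- An order whose reduction is finite-dimensional is finitely generated. -/
theorem finite_of_residue {A B : Type*} [Ring A] [Algebra O A] [Module.Free O A] [Ring B]
    [Algebra (ResidueField O) B] [Module.Finite (ResidueField O) B]
    (f : ResidueField O ⊗[O] A ≃ₐ[ResidueField O] B) : Module.Finite O A := by
  let b := Module.Free.chooseBasis O A
  have : Module.Finite (ResidueField O) (ResidueField O ⊗[O] A) :=
    Module.Finite.equiv f.symm.toLinearEquiv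
  have : Finite (Module.Free.ChooseBasisIndex O A) :=
    Module.Finite.finite_basis (b.baseChange (ResidueField O))
  exact Module.Finite.of_basis b

theorem finrank_eq_of_residue {A B : Type*} [Ring A] [Algebra O A] [Module.Free O A] [Ring B]
    [Algebra (ResidueField O) B] (f : ResidueField O ⊗[O] A ≃ₐ[ResidueField O] B) :
    Module.finrank O A = Module.finrank (ResidueField O) B := by
  rw [← f.toLinearEquiv.finrank_eq, Module.finrank_baseChange]

variable {A B : Type*} [Ring A] [Algebra O A] [Ring B] [Algebra (ResidueField O) B] [Algebra O B]
  [IsScalarTower O (ResidueField O) B]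

/-- The reduction homomorphism given by an isomorphism of the reduction of `A` with `B`. -/
noncomputable def residueHom (f : ResidueField O ⊗[O] A ≃ₐ[ResidueField O] B) : A →ₐ[O] B :=
  (f.toAlgHom.restrictScalars O).comp Algebra.TensorProduct.includeRight

variable (f : ResidueField O ⊗[O] A ≃ₐ[ResidueField O] B)

theorem residueHom_apply (x : A) : residueHom f x = f (1 ⊗ₜ x) := rfl

theorem residueHom_surjective : Function.Surjective (residueHom f) := fun y => by
  obtain ⟨z, rfl⟩ := f.surjective y
  induction z with
  | zero => exact ⟨0, by simp⟩
  | add u v hu hv =>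
    obtain ⟨x, hx⟩ := hu
    obtain ⟨y, hy⟩ := hv
    exact ⟨x + y, by rw [map_add, map_add, hx, hy]⟩
  | tmul c x =>
    obtain ⟨a, rfl⟩ := residue_surjective c
    refine ⟨a • x, ?_⟩
    rw [residueHom_apply, TensorProduct.tmul_smul, TensorProduct.smul_tmul', Algebra.smul_def,
      mul_one]
    rfl

/-- The kernel of the reduction is the maximal ideal times the order. -/
theorem mem_of_residueHom_eq_zero [Module.Free O A] [Module.Finite O A] {x : A} (hx : residueHom f x = 0) :
    x ∈ maximalIdeal O • (⊤ : Submodule O A) := by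
  let b := Module.Free.chooseBasis O A
  rw [b.mem_ideal_smul_top_iff]
  intro i
  have h1 : (1 : ResidueField O) ⊗ₜ[O] x = 0 :=
    f.injective (hx.trans (map_zero f).symm)
  have h2 := Module.Basis.baseChange_repr_tmul (ResidueField O) b 1 x i
  rw [h1, map_zero, Finsupp.zero_apply, Algebra.smul_def, mul_one] at h2
  exact (residue_eq_zero_iff _).1 h2.symm

end ResidueHom

namespace Atilde4

open IsLocalRing

/-- If the center of `A` is isomorphic to the center of the group ring, then it maps onto the center
of the reduction of `A`: its image has the right dimension. -/
theorem center_surjective {O : Type*} [CommRing O] [IsDomain O] [IsDiscreteValuationRing O]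
    [CharZero O] {A : Type*} [Ring A] [Algebra O A] [Module.Free O A]
    {r : A →ₐ[O] MonoidAlgebra (ResidueField O) Atilde4} (hr : Function.Surjective r)
    (hker : ∀ x, r x = 0 → x ∈ maximalIdeal O • (⊤ : Submodule O A))
    (σ : Subalgebra.center O A ≃ₐ[O] Subalgebra.center O (MonoidAlgebra O Atilde4))
    {ω t : O} (hω : ω ^ 2 + ω + 1 = 0) (ht : 3 * t = 1)
    (y : MonoidAlgebra (ResidueField O) Atilde4)
    (hy : y ∈ Subalgebra.center (ResidueField O) (MonoidAlgebra (ResidueField O) Atilde4)) :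
    ∃ z : Subalgebra.center O A, r z = y := by
  let u (i : Fin 7) : Subalgebra.center O A := σ.symm (CharIndex.centralClassSum hω ht i)
  let S : Submodule (ResidueField O) (MonoidAlgebra (ResidueField O) Atilde4) :=
    Submodule.span _ (Set.range (classSum (ResidueField O)))
  have hcS : ∀ y ∈ Subalgebra.center (ResidueField O) (MonoidAlgebra (ResidueField O) Atilde4),
      y ∈ S := fun y hy => by
    rw [eq_sum_classSum hy]
    exact sum_mem fun i _ => S.smul_mem _ (Submodule.subset_span ⟨i, rfl⟩)
  have hrc : ∀ z : Subalgebra.center O A,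
      r z ∈ Subalgebra.center (ResidueField O) (MonoidAlgebra (ResidueField O) Atilde4) := fun z => by
    rw [Subalgebra.mem_center_iff]
    intro b
    obtain ⟨a, rfl⟩ := hr b
    rw [← map_mul, ← map_mul, Subalgebra.mem_center_iff.1 z.2 a]
  have hli : LinearIndependent (ResidueField O) fun i => (⟨r (u i), hcS _ (hrc (u i))⟩ : S) := by
    rw [Fintype.linearIndependent_iff]
    intro g hg i
    choose a ha using fun i => residue_surjective (g i)
    let x : Subalgebra.center O A := ∑ i, a i • u i
    have hx : r x = 0 := by
      have h1 := congrArg (Subtype.val : S → _) hg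
      simp only [AddSubmonoidClass.coe_finsetSum, SetLike.val_smul, ZeroMemClass.coe_zero] at h1
      rw [← h1]
      simp only [x, AddSubmonoidClass.coe_finsetSum, SetLike.val_smul, map_sum, map_smul, ← ha]
      rfl
    obtain ⟨p, hp⟩ := IsDiscreteValuationRing.exists_irreducible O
    have hm := hp.maximalIdeal_eq
    have hxm := hker _ hx
    rw [hm, Submodule.ideal_span_singleton_smul, Submodule.mem_smul_pointwise_iff_exists] at hxm
    obtain ⟨w, -, hw⟩ := hxm
    -- the quotient of a central element by `p` is central
    have hwc : w ∈ Subalgebra.center O A := by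
      rw [Subalgebra.mem_center_iff]
      intro b
      have h1 := Subalgebra.mem_center_iff.1 x.2 b
      rw [← hw, mul_smul_comm, smul_mul_assoc, ← sub_eq_zero, ← smul_sub] at h1
      exact sub_eq_zero.1 ((smul_eq_zero.1 h1).resolve_left hp.ne_zero)
    have h2 : x = p • (⟨w, hwc⟩ : Subalgebra.center O A) := Subtype.ext hw.symm
    have h3 := congrArg (fun z : Subalgebra.center O A =>
      ((σ z : Subalgebra.center O (MonoidAlgebra O Atilde4)) :
        MonoidAlgebra O Atilde4).coeff (classRep i)) h2
    simp only [x, u, map_sum, map_smul, AlgEquiv.apply_symm_apply, AddSubmonoidClass.coe_finsetSum,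
      SetLike.val_smul, CharIndex.centralClassSum] at h3
    rw [MonoidAlgebra.coeff_sum, Finsupp.finsetSum_apply, Finset.sum_eq_single i] at h3
    · rw [MonoidAlgebra.coeff_smul, Finsupp.smul_apply, classSum_coeff, if_pos rfl, smul_eq_mul,
        mul_one, MonoidAlgebra.coeff_smul, Finsupp.smul_apply, smul_eq_mul] at h3
      rw [← ha, residue_eq_zero_iff, h3, hm]
      exact Ideal.mul_mem_right _ _ (Ideal.mem_span_singleton_self p)
    · intro j _ hj
      rw [MonoidAlgebra.coeff_smul, Finsupp.smul_apply, classSum_coeff, if_neg hj, smul_zero]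
    · simp
  have : Module.Finite (ResidueField O) S := Module.Finite.span_of_finite _ (Set.finite_range _)
  have hrank : Module.finrank (ResidueField O) S ≤ Fintype.card (Fin 7) := finrank_range_le_card _
  have htop := hli.span_eq_top_of_card_eq_finrank'
    (le_antisymm hli.fintype_card_le_finrank hrank)
  obtain ⟨c, hc⟩ := Submodule.mem_span_range_iff_exists_fun (ResidueField O) |>.1
    (htop.ge (Submodule.mem_top (x := (⟨y, hcS y hy⟩ : S))))
  choose a ha using fun i => residue_surjective (c i)
  refine ⟨∑ i, a i • u i, ?_⟩
  have h1 := congrArg (Subtype.val : S → _) hc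
  simp only [AddSubmonoidClass.coe_finsetSum, SetLike.val_smul] at h1
  rw [← h1]
  simp only [AddSubmonoidClass.coe_finsetSum, SetLike.val_smul, map_sum, map_smul, ← ha]
  rfl

end Atilde4

/-! ### Orders with the characters of the group ring of `Ã₄` -/

namespace SplitAlgebra

section

variable {K B ι : Type*} [Field K] [Ring B] [Algebra K B] [DecidableEq ι] {n : ι → ℕ}
  (φ : B ≃ₐ[K] ((i : ι) → Matrix (Fin (n i)) (Fin (n i)) K))

theorem centralIdem_mul (i : ι) (b : B) :
    (centralIdem φ i : B) * b = φ.symm (Pi.single i (φ b i)) := by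
  apply φ.injective
  rw [map_mul, AlgEquiv.apply_symm_apply]
  change φ (φ.symm (Pi.single i 1)) * φ b = _
  rw [AlgEquiv.apply_symm_apply]
  funext j
  by_cases h : j = i
  · subst h; simp
  · simp [Pi.single_eq_of_ne h]

theorem apply_centralIdem (i : ι) : φ (centralIdem φ i : B) = Pi.single i 1 :=
  φ.apply_symm_apply _

theorem sum_centralIdem [Fintype ι] : ∑ i, (centralIdem φ i : B) = 1 := by
  apply φ.injective
  simp only [map_sum, apply_centralIdem, map_one]
  exact Finset.univ_sum_single 1

end

/-- The scalar product of the characters of two projective modules given by idempotents is the rank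
of a Peirce component. -/
theorem sum_chi_mul_chi {O K A ι : Type*} [CommRing O] [Field K] [Algebra O K] [Ring A]
    [Algebra O A] [Module.Finite O A] [Module.Free O A] [Fintype ι] [DecidableEq ι] {n : ι → ℕ}
    (φ : K ⊗[O] A ≃ₐ[K] ((i : ι) → Matrix (Fin (n i)) (Fin (n i)) K)) (a b : A) :
    ∑ i, chi φ i (1 ⊗ₜ a) * chi φ i (1 ⊗ₜ b) =
      algebraMap O K (LinearMap.trace O A (LinearMap.mulLeft O a ∘ₗ LinearMap.mulRight O b)) := by
  rw [← trace_mulLeftRight, ← LinearMap.trace_baseChange]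
  congr 1
  ext x
  simp

end SplitAlgebra

section Main

open IsLocalRing CharIndex Atilde4

/-- The primitive idempotents and the arrows of the algebra of `Ã₄`, with lifts of the
idempotents. The element of order three of `Ã₄` lifts to a cube root of one, and the idempotents are
polynomials in it. -/
theorem exists_idempotents {O : Type*} [CommRing O] [IsLocalRing O]
    [IsAdicComplete (maximalIdeal O) O] {A : Type*} [Ring A] [Algebra O A] [Module.Free O A]
    [Module.Finite O A] (h2 : (2 : O) ∈ maximalIdeal O) {ω t : O} (hω : ω ^ 2 + ω + 1 = 0)
    (ht : 3 * t = 1) {r : A →ₐ[O] MonoidAlgebra (ResidueField O) Atilde4}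
    (hr : Function.Surjective r)
    (hker : ∀ x, r x = 0 → x ∈ maximalIdeal O • (⊤ : Submodule O A)) :
    ∃ (e : ZMod 3 → A) (X Y : ZMod 3 → MonoidAlgebra (ResidueField O) Atilde4),
      (∀ i, e i * e i = e i) ∧ (∀ i j, i ≠ j → e i * e j = 0) ∧ e 0 + e 1 + e 2 = 1 ∧
      ResidueFrame (ResidueField O) (fun i => r (e i)) X Y := by
  have hmax : ∀ x ∈ maximalIdeal O • (⊤ : Submodule O A), r x = 0 := fun x hx => by
    refine Submodule.smul_induction_on hx (fun a ha m _ => ?_) fun x y hx hy => ?_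
    · rw [map_smul, ← algebraMap_smul (ResidueField O) a]
      rw [show algebraMap O (ResidueField O) a = 0 from (residue_eq_zero_iff a).2 ha, zero_smul]
    · rw [map_add, hx, hy, add_zero]
  have : IsAdicComplete (maximalIdeal O) A :=
    IsAdicComplete.of_basis (Module.finBasis O A) (maximalIdeal O)
  obtain ⟨c₀, hc₀⟩ := hr (genC (ResidueField O))
  obtain ⟨c, hc, hcc₀⟩ := exists_cube_eq_one_lift (maximalIdeal O) ht (c₀ := c₀) (hker _ (by
    rw [map_sub, map_pow, hc₀, map_one, pow_succ', pow_two,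
      (tetraRelations (ResidueField O)).CCC, sub_self]))
  have hrc : r c = genC (ResidueField O) := by
    rw [← hc₀, ← sub_eq_zero, ← map_sub]; exact hmax _ hcc₀
  have hc' : c * (c * c) = 1 := by rw [← hc, pow_succ', pow_two]
  let e (i : ZMod 3) : A := idemC ω t c i
  have idem : ∀ i, e i * e i = e i := fun i => by
    rw [idemC_mul_idemC hω ht hc', if_pos rfl]
  have orth : ∀ i j, i ≠ j → e i * e j = 0 := fun i j hij => by
    rw [idemC_mul_idemC hω ht hc', if_neg hij]
  have frame := residueFrame (map_root (residue O) hω) (map_third (residue O) ht) (two_eq_zero h2)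
  have he : idemC (residue O ω) (residue O t) (genC (ResidueField O)) =
      fun i => r (e i) := funext fun i => by
    rw [← hrc]; exact (map_idemC_semilinear (k := ResidueField O) r ω t c i).symm
  rw [he] at frame
  exact ⟨e, _, _, idem, orth, idemC_sum hω ht, frame⟩

/-- An order with the reduction and, up to signs, the center and the projective characters of the
group ring of `Ã₄` is isomorphic to the algebra given by generators and relations. -/
theorem nonempty_algEquiv_presAlgebra {O : Type*} [CommRing O] [IsDomain O]
    [IsDiscreteValuationRing O] [IsAdicComplete (maximalIdeal O) O] [CharZero O]
    (K : Type*) [Field K] [CharZero K] [Algebra O K] [IsFractionRing O K]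
    {A : Type*} [Ring A] [Algebra O A] [Module.Free O A]
    (hsplit : IsSplitSemisimple K (K ⊗[O] A))
    (hres : Nonempty (ResidueField O ⊗[O] A ≃ₐ[ResidueField O]
      MonoidAlgebra (ResidueField O) Atilde4))
    (Φ : CharGroup K (K ⊗[O] A) ≃+ CharGroup K (K ⊗[O] MonoidAlgebra O Atilde4))
    (hisom : ∀ f g, (Φ f).scalarProduct (Φ g) = f.scalarProduct g)
    (hproj : (projCharacters O K A).map Φ.toAddMonoidHom =
      projCharacters O K (MonoidAlgebra O Atilde4))
    (hcenter : InducesCenterIso O K Φ) (h2 : (2 : O) ∈ maximalIdeal O) {ω t : O}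
    (hω : ω ^ 2 + ω + 1 = 0) (ht : 3 * t = 1) : Nonempty (A ≃ₐ[O] PresAlgebra O) := by
  obtain ⟨n, d, hd, ⟨φ⟩⟩ := hsplit
  obtain ⟨f⟩ := hres
  have : Module.Finite O A := finite_of_residue f
  have hrank : Module.finrank O A = 24 := (finrank_eq_of_residue f).trans finrank_monoidAlgebra
  let r := residueHom f
  have hr : Function.Surjective r := residueHom_surjective f
  have hker : ∀ x, r x = 0 → x ∈ maximalIdeal O • (⊤ : Submodule O A) := fun x =>
    mem_of_residueHom_eq_zero f
  obtain ⟨e, X, Y, idem, orth, sum_eq, frame⟩ := exists_idempotents h2 hω ht hr hker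
  -- their characters satisfy the relations of projective characters of the group ring
  have hidem : ∀ i, IsIdempotentElem ((1 : K) ⊗ₜ[O] e i) := fun i => by
    rw [IsIdempotentElem, Algebra.TensorProduct.tmul_mul_tmul, idem, one_mul]
  choose m hm hm' using fun i => SplitAlgebra.exists_chi_eq (φ := φ) (hidem i)
  let φG := tensorEquiv K hω ht
  have hdG : ∀ x, dim x ≠ 0 := fun x => by rcases x with (_ | _) | _ <;> simp [dim]
  obtain ⟨θ, s, hs, hθ, hval⟩ := Finsupp.exists_equiv_of_isometry Φ hisom
  let irrA := Equiv.ofBijective _ ⟨SplitAlgebra.irr_injective φ hd, SplitAlgebra.irr_surjective φ hd⟩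
  let irrG := Equiv.ofBijective _
    ⟨SplitAlgebra.irr_injective φG hdG, SplitAlgebra.irr_surjective φG hdG⟩
  let E : CharIndex ≃ Fin n := irrG.trans (θ.symm.trans irrA.symm)
  have hE : ∀ x, θ (irrA (E x)) = irrG x := fun x => by simp [E]
  let p (i : ZMod 3) : CharGroup K (K ⊗[O] A) := SplitAlgebra.ofMultiplicities φ hd (m i)
  let F (i : ZMod 3) (x : CharIndex) : ℤ := Φ (p i) (irrG x)
  have hF : ∀ i, ProjRelation (F i) := fun i => by
    refine projRelation_of_mem hω ht K h2 hdG ?_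
    rw [← hproj]
    exact AddSubgroup.mem_map_of_mem Φ.toAddMonoidHom
      (SplitAlgebra.ofMultiplicities_mem_projCharacters φ hd
        (inclusion_injective (O := O) (K := K) (A := A)) (idem i) (hm i))
  have hFm : ∀ i x, F i x = s (irrA (E x)) * m i (E x) := fun i x => by
    simp only [F]
    rw [← hE, hval]
    congr 1
    exact SplitAlgebra.ofMultiplicities_apply φ hd (m i) (E x)
  have hgram : ∀ i j, ∑ x, F i x * F j x = if i = j then 4 else 2 := fun i j => by
    have h1 : ∀ x, F i x * F j x = (m i (E x) : ℤ) * m j (E x) := fun x => by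
      rw [hFm, hFm, mul_mul_mul_comm]
      rcases hs (irrA (E x)) with h | h <;> rw [h] <;> ring
    have h3 := SplitAlgebra.sum_chi_mul_chi φ (e i) (e j)
    rw [frame.trace_peirce residue_surjective hr hker idem orth hrank] at h3
    simp only [hm] at h3
    rw [Finset.sum_congr rfl fun x _ => h1 x,
      Equiv.sum_comp E fun y => (m i y : ℤ) * m j y]
    have h4 : ((∑ y, (m i y : ℤ) * m j y : ℤ) : K) = ((if i = j then 4 else 2 : ℤ) : K) := by
      push_cast
      rw [h3]
      split_ifs
      · exact map_ofNat _ 4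
      · exact map_ofNat _ 2
    exact_mod_cast h4
  obtain ⟨τ, T, hT, hpair, hoct⟩ := exists_perm_of_gram hF hgram
  -- the center of `A` in terms of the primitive central idempotents
  obtain ⟨ψ, σ, hψ, hσ⟩ := hcenter
  have hψE : ∀ x, ψ (SplitAlgebra.centralIdem φ (E x)) = SplitAlgebra.centralIdem φG x := fun x => by
    refine hψ (irrA (E x)) _ _ (SplitAlgebra.isCentralIdempotentOf φ hd _ one_ne_zero) ?_
    rw [hθ, hE]
    refine SplitAlgebra.isCentralIdempotentOf φG hdG x ?_
    rcases hs (irrA (E x)) with h | h <;> rw [h] <;> decide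
  have hψinj : Function.Injective ψ :=
    SplitAlgebra.injective_of_centralIdem φ hdG φG ψ E.symm fun i => by
      rw [← hψE, Equiv.apply_symm_apply]
  let ε (x : CharIndex) : K ⊗[O] A := SplitAlgebra.centralIdem φ (E (T x))
  have key : ∀ (z : Subalgebra.center O A) (g : CharIndex → ℤ),
      (∀ x, rep hω ht x (σ z : MonoidAlgebra O Atilde4) = (g x : O) • (1 : Mat O x)) →
      inclusion O K A z = centralSum ε (g ∘ T) := fun z g hg => by
    have h1 : centerMap O K A z = ∑ x, g x • SplitAlgebra.centralIdem φ (E x) := by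
      apply hψinj
      rw [hσ, map_sum]
      simp only [map_zsmul, hψE]
      apply Subtype.ext
      refine (one_tmul_eq_centralSum K hω ht hg).trans ?_
      rw [AddSubmonoidClass.coe_finsetSum]
      rfl
    have h3 := congrArg (Subtype.val : Subalgebra.center K (K ⊗[O] A) → _) h1
    refine h3.trans ?_
    rw [AddSubmonoidClass.coe_finsetSum, centralSum, ← Equiv.sum_comp T]
    rfl
  have lift : CentralLift O (ResidueField O) r e X Y (inclusion O K A) ε
      (fun x y => σ.symm (pairElt hω ht (τ x) (τ y))) (fun x => σ.symm (octElt hω ht (τ x))) :=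
    { idem := idem
      orth := orth
      sum_eq_one := sum_eq
      inj := inclusion_injective
      idem' := fun x => by
        rw [SplitAlgebra.centralIdem_mul, SplitAlgebra.apply_centralIdem, Pi.single_eq_same]; rfl
      orth' := fun x y hxy => by
        rw [SplitAlgebra.centralIdem_mul, SplitAlgebra.apply_centralIdem,
          Pi.single_eq_of_ne fun h => hxy (T.injective (E.injective h)), Pi.single_zero, map_zero]
      sum_eq_one' := by
        rw [← SplitAlgebra.sum_centralIdem φ]
        exact Equiv.sum_comp (T.trans E) fun i => (SplitAlgebra.centralIdem φ i : K ⊗[O] A)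
      central := fun x b =>
        (Subalgebra.mem_center_iff.1 (SplitAlgebra.centralIdem φ (E (T x))).2 b).symm
      vanish := fun i x hix => by
        have h1 := hFm i (T x)
        rw [hT i x hix] at h1
        have h3 : m i (E (T x)) = 0 := by
          rcases hs (irrA (E (T x))) with h | h <;> rw [h] at h1 <;> simpa using h1.symm
        rw [SplitAlgebra.centralIdem_mul]
        change φ.symm (Pi.single _ (φ (1 ⊗ₜ e i) _)) = 0
        rw [hm' i _ h3, Pi.single_zero, map_zero]
      two_mem := h2
      algebraMap_surj := residue_surjective
      algebraMap_eq_zero := fun x hx => (residue_eq_zero_iff x).2 hx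
      surj := hr
      mem_of_eq_zero := hker
      frame := frame
      pair_eq := fun x y hxy => by
        rw [key _ (pairFun (τ x) (τ y)) fun u => by
          rw [AlgEquiv.apply_symm_apply]; exact rep_pairElt hω ht u (τ.injective.ne hxy)]
        congr 1
        funext u
        exact hpair x y u hxy
      oct_eq := fun x => by
        rw [key _ (octFun (τ x)) fun u => by
          rw [AlgEquiv.apply_symm_apply]; exact rep_octElt hω ht u (τ x)]
        congr 1
        funext u
        exact hoct x u
      center_le := fun z _ => by
        have hz := top_le_span_center hω ht (Submodule.mem_top (x := σ z))
        rw [← σ.symm_apply_apply z]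
        generalize σ z = w at hz
        induction hz using Submodule.span_induction with
        | mem w hw =>
          refine Submodule.subset_span ?_
          rcases hw with rfl | ⟨x, y, hxy, rfl⟩ | ⟨x, rfl⟩
          · exact Or.inl (map_one σ.symm)
          · exact Or.inr (Or.inl ⟨τ.symm x, τ.symm y, τ.symm.injective.ne hxy, by
              rw [τ.apply_symm_apply, τ.apply_symm_apply]⟩)
          · exact Or.inr (Or.inr ⟨τ.symm x, by rw [τ.apply_symm_apply]⟩)
        | zero => rw [map_zero]; exact zero_mem _
        | add x y _ _ hx hy => rw [map_add]; exact add_mem hx hy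
        | smul a x _ hx => rw [map_smul]; exact Submodule.smul_mem _ _ hx
      center_surj := center_surjective hr hker σ hω ht }
  exact lift.nonempty_algEquiv hrank finrank_monoidAlgebra ht

end Main

theorem theoremC {O : Type*} [CommRing O] [IsDomain O] [IsDiscreteValuationRing O]
    [IsAdicComplete (IsLocalRing.maximalIdeal O) O]
    [IsAlgClosed (IsLocalRing.ResidueField O)] [CharP (IsLocalRing.ResidueField O) 2]
    (K : Type*) [Field K] [CharZero K] [Algebra O K] [IsFractionRing O K]
    {A : Type*} [Ring A] [Algebra O A] [Module.Free O A] (hbasic : IsBasicRing A)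
    (hsplit : IsSplitSemisimple K (K ⊗[O] A))
    (hres : Nonempty (IsLocalRing.ResidueField O ⊗[O] A ≃ₐ[IsLocalRing.ResidueField O]
      MonoidAlgebra (IsLocalRing.ResidueField O) Atilde4))
    (Φ : CharGroup K (K ⊗[O] A) ≃+ CharGroup K (K ⊗[O] MonoidAlgebra O Atilde4))
    (hisom : ∀ f g, (Φ f).scalarProduct (Φ g) = f.scalarProduct g)
    (hproj : (projCharacters O K A).map Φ.toAddMonoidHom =
      projCharacters O K (MonoidAlgebra O Atilde4))
    (hcenter : InducesCenterIso O K Φ) :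
    Nonempty (A ≃ₐ[O] PresAlgebra O) ∧ Nonempty (A ≃ₐ[O] MonoidAlgebra O Atilde4) := by
  have : CharZero O := ⟨fun m n h => by simpa using congrArg (algebraMap O K) h⟩
  have h2 : (2 : O) ∈ IsLocalRing.maximalIdeal O := by
    rw [← IsLocalRing.residue_eq_zero_iff, map_ofNat]
    exact CharP.cast_eq_zero (IsLocalRing.ResidueField O) 2
  obtain ⟨ω, hω⟩ := exists_root_of_isAdicComplete h2
  obtain ⟨t, ht⟩ := exists_three_mul_eq_one h2
  obtain ⟨g⟩ := nonempty_algEquiv_presAlgebra K hsplit hres Φ hisom hproj hcenter h2 hω ht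
  obtain ⟨g'⟩ := CharIndex.groupAlgebra_nonempty_algEquiv K hω ht h2
  exact ⟨⟨g⟩, ⟨g.trans g'.symm⟩⟩
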